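/- Let $2\le p<3$, $T>0$, $L,M>0$ and $m,k,d\ge 0$ be given. For a two-parameter function $A$ on $\{0\le s\le t\le T\}$ and $q\ge 1$ write $\|A\|_q:=\big(\sup_{\mathcal P}\sum_{[s,t]\in\mathcal P}|A_{s,t}|^q\big)^{1/q}$, the supremum being over all partitions of $[0,T]$; for a path $X$ put $X_{s,t}:=X_t-X_s$ and let $\|X\|_q$ be the $q$-variation of its increments. Let $\|\cdot\|_\infty$ be the supremum norm on $[0,T]$. A $\frac1p$-Hölder rough path is a pair $\boldsymbol\zeta=(\zeta,\zeta^{(2)})$ of a path $\zeta:[0,T]\to\mathbb R^d$ and a map $\zeta^{(2)}:\{0\le s\le t\le T\}\to\mathbb R^d\otimes\mathbb R^d$ with $\zeta^{(2)}_{s,t}=\zeta^{(2)}_{s,r}+\zeta^{(2)}_{r,t}+\zeta_{s,r}\otimes\zeta_{r,t}$ for $s\le r\le t$ and $|||\boldsymbol\zeta|||:=\sup_{s<t}\frac{|\zeta_{s,t}|}{|t-s|^{1/p}}+\sup_{s<t}\frac{|\zeta^{(2)}_{s,t}|}{|t-s|^{2/p}}<\infty$. Put $\varrho_p(\boldsymbol\eta,\boldsymbol\zeta):=\|\eta-\zeta\|_p+\|\eta^{(2)}-\zeta^{(2)}\|_{p/2}$.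 A pair $(X,X')$ of continuous paths of finite $p$-variation with values in $E$ and $\mathcal L(\mathbb R^d;E)$ is controlled by $\boldsymbol\zeta$ if the remainder $R^X_{s,t}:=X_{s,t}-X'_s\zeta_{s,t}$ satisfies $\|R^X\|_{p/2}<\infty$. If $(Z,Z')$ is such a pair with $Z$ taking values in $\mathcal L(\mathbb R^d;\mathbb R^n)$, its rough integral is $\int_a^b Z\,\mathrm d\boldsymbol\zeta:=\lim_{|\mathcal P|\to0}\sum_{[s,t]\in\mathcal P}\big(Z_s\zeta_{s,t}+Z'_s\zeta^{(2)}_{s,t}\big)$ over partitions $\mathcal P$ of $[a,b]$ (where $Z'_s(u\otimes v):=(Z'_su)v$). For a $C^3_b$ function $\psi$, $\psi(X,\gamma)$ is integrated with the derivative $\psi(X,\gamma)':=D_x\psi(X,\gamma)X'$. Here $C^3_b$ means three times continuously differentiable, with the function and its derivatives up to order three bounded. Let $b:\mathbb R^m\times\mathbb R^k\to\mathbb R^m$ be bounded and Lipschitz and let $\lambda:\mathbb R^m\times\mathbb R^k\to\mathcal L(\mathbb R^d;\mathbb R^m)$ be of class $C^3_b$. Let $\gamma,\vartheta:[0,T]\to\mathbb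 R^k$ be continuous with $\|\gamma\|_{p/2},\|\vartheta\|_{p/2}\le M$, and let $\boldsymbol\eta,\boldsymbol\zeta$ be $\frac1p$-Hölder rough paths with $|||\boldsymbol\eta|||,|||\boldsymbol\zeta|||\le L$. Let $(X,X')$, with $X'=\lambda(X,\gamma)$, be controlled by $\boldsymbol\eta$ and solve $$X_t=x+\int_0^tb(X_s,\gamma_s)\,\mathrm ds+\int_0^t\lambda(X_s,\gamma_s)\,\mathrm d\boldsymbol\eta_s,\qquad t\in[0,T],$$ and let $(Y,Y')$, with $Y'=\lambda(Y,\vartheta)$, be controlled by $\boldsymbol\zeta$ and solve the same equation with $(y,\vartheta,\boldsymbol\zeta)$ in place of $(x,\gamma,\boldsymbol\eta)$. Then $$\|X'-Y'\|_p+\|R^X-R^Y\|_{p/2}\le C\Big(|x-y|+\|\gamma-\vartheta\|_\infty+\|\gamma-\vartheta\|_{p/2}+\varrho_p(\boldsymbol\eta,\boldsymbol\zeta)\Big),$$ where $C$ depends only on $b,\lambda,p,T,L,M$ (and the dimensions). Moreover, for every $\psi:\mathbb R^m\times\mathbb R^k\to\mathcal L(\mathbb R^d;\mathbb R^n)$ of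 class $C^3_b$, the rough integrals below exist for every upper limit in $[0,T]$, and $$\Big\|\int_0^\cdot\psi(X_s,\gamma_s)\,\mathrm d\boldsymbol\eta_s-\int_0^\cdot\psi(Y_s,\vartheta_s)\,\mathrm d\boldsymbol\zeta_s\Big\|_p\le C'\Big(|x-y|+\|\gamma-\vartheta\|_\infty+\|\gamma-\vartheta\|_{p/2}+\varrho_p(\boldsymbol\eta,\boldsymbol\zeta)\Big),$$ where $C'$ depends only on $b,\lambda,\psi,p,T,L,M$ (and the dimensions). -/

import Mathlib

open scoped ENNReal NNReal TensorProduct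

namespace ControlledRDE

noncomputable section

/-- Euclidean space `ℝⁿ`. -/
abbrev Euc (n : ℕ) : Type := EuclideanSpace ℝ (Fin n)

/-- A partition `a = t₀ < t₁ < ⋯ < t_N = b` of the interval `[a, b]`. For `a = b` this is the
single point `a`, with no subintervals. -/
structure IntervalPartition (a b : ℝ) where
  size : ℕ
  pts : Fin (size + 1) → ℝ
  strictMono : StrictMono pts
  first : pts 0 = a
  last : pts (Fin.last size) = b

/-- The sum of the two-parameter function `A` over the subintervals of a partition. -/
def IntervalPartition.sum {a b : ℝ} {E : Type*} [AddCommMonoid E]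
    (P : IntervalPartition a b) (A : ℝ → ℝ → E) : E :=
  ∑ i : Fin P.size, A (P.pts i.castSucc) (P.pts i.succ)

/-- All subintervals of the partition have length less than `δ`. -/
def IntervalPartition.MeshLT {a b : ℝ} (P : IntervalPartition a b) (δ : ℝ) : Prop :=
  ∀ i : Fin P.size, P.pts i.succ - P.pts i.castSucc < δ

/-- The increments `X_{s,t} = X_t - X_s` of a path. -/
def incr {E : Type*} [Sub E] (X : ℝ → E) (s t : ℝ) : E := X t - X s

/-- The `q`-variation `(sup_P ∑_{[s,t] ∈ P} |A_{s,t}|^q)^{1/q}` of a two-parameter function over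
`[a, b]`, with values in `[0, ∞]`. The `q`-variation of a path `X` is `pVar q (incr X) a b`. -/
def pVar {E : Type*} [NormedAddCommGroup E] (q : ℝ) (A : ℝ → ℝ → E) (a b : ℝ) : ℝ≥0∞ :=
  (⨆ P : IntervalPartition a b, P.sum (fun s t => ‖A s t‖ₑ ^ q)) ^ (1 / q)

/-- The supremum norm over `[0, T]`, with values in `[0, ∞]`. -/
def supNorm {E : Type*} [NormedAddCommGroup E] (T : ℝ) (X : ℝ → E) : ℝ≥0∞ :=
  ⨆ t ∈ Set.Icc 0 T, ‖X t‖ₑ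

/-- The `α`-Hölder seminorm `sup_{s < t} |A_{s,t}| / |t - s|^α` over `[0, T]`, with values in
`[0, ∞]`. -/
def holderNorm {E : Type*} [NormedAddCommGroup E] (α T : ℝ) (A : ℝ → ℝ → E) : ℝ≥0∞ :=
  ⨆ s ∈ Set.Icc 0 T, ⨆ t ∈ Set.Ioc s T, ‖A s t‖ₑ / ENNReal.ofReal ((t - s) ^ α)

/-- Continuous paths on `[0, T]` of finite `q`-variation. -/
structure IsVarPath {E : Type*} [NormedAddCommGroup E] (q T : ℝ) (X : ℝ → E) : Prop where
  continuousOn : ContinuousOn X (Set.Icc 0 T)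
  finite : pVar q (incr X) 0 T < ∞

/-- `1/p`-Hölder rough paths on `[0, T]` with values in `ℝᵈ`. Only the values of `path` on `[0, T]`
and of `area` on `{0 ≤ s ≤ t ≤ T}` are relevant. The norm on `ℝᵈ ⊗ ℝᵈ` is the Hilbert tensor norm,
that is, the Euclidean norm of `ℝ^{d × d}`. -/
structure RoughPath (p T : ℝ) (d : ℕ) where
  path : ℝ → Euc d
  area : ℝ → ℝ → Euc d ⊗[ℝ] Euc d
  chen : ∀ s r t : ℝ, 0 ≤ s → s ≤ r → r ≤ t → t ≤ T →
    area s t = area s r + area r t + incr path s r ⊗ₜ[ℝ] incr path r t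
  holder_finite : holderNorm (1 / p) T (incr path) + holderNorm (2 / p) T area < ∞

/-- The `1/p`-Hölder rough path norm. -/
def RoughPath.holder {p T : ℝ} {d : ℕ} (ζ : RoughPath p T d) : ℝ≥0∞ :=
  holderNorm (1 / p) T (incr ζ.path) + holderNorm (2 / p) T ζ.area

/-- The `p`-variation rough path distance `ϱ_p`. -/
def roughDist {p T : ℝ} {d : ℕ} (η ζ : RoughPath p T d) : ℝ≥0∞ :=
  pVar p (incr fun t => η.path t - ζ.path t) 0 T +
    pVar (p / 2) (fun s t => η.area s t - ζ.area s t) 0 T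

/-- The remainder `R^X_{s,t} = X_{s,t} - X'_s ζ_{s,t}`. -/
def remainder {p T : ℝ} {d : ℕ} {E : Type*} [NormedAddCommGroup E] [NormedSpace ℝ E]
    (ζ : RoughPath p T d) (X : ℝ → E) (X' : ℝ → Euc d →L[ℝ] E) (s t : ℝ) : E :=
  incr X s t - X' s (incr ζ.path s t)

/-- `(X, X')` is a path controlled by `ζ`. -/
structure IsControlled {p T : ℝ} {d : ℕ} {E : Type*} [NormedAddCommGroup E] [NormedSpace ℝ E]
    (ζ : RoughPath p T d) (X : ℝ → E) (X' : ℝ → Euc d →L[ℝ] E) : Prop where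
  path_var : IsVarPath p T X
  deriv_var : IsVarPath p T X'
  remainder_var : pVar (p / 2) (remainder ζ X X') 0 T < ∞

/-- The action on `ℝᵈ ⊗ ℝᵈ` of `A ∈ L(ℝᵈ; L(ℝᵈ; E))`, determined by `u ⊗ v ↦ A u v`. -/
def tensorApply {d : ℕ} {E : Type*} [NormedAddCommGroup E] [NormedSpace ℝ E]
    (A : Euc d →L[ℝ] Euc d →L[ℝ] E) : Euc d ⊗[ℝ] Euc d →ₗ[ℝ] E :=
  TensorProduct.lift A.toLinearMap₁₂

/-- The rough integral over `[a, b]` of `(Z, Z')` against `ζ` exists and equals `I`: the compensated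
sums `∑ Z_s ζ_{s,t} + Z'_s ζ⁽²⁾_{s,t}` converge to `I` as the mesh of the partition tends to `0`. -/
def HasRoughIntegral {p T : ℝ} {d : ℕ} {E : Type*} [NormedAddCommGroup E] [NormedSpace ℝ E]
    (ζ : RoughPath p T d) (Z : ℝ → Euc d →L[ℝ] E) (Z' : ℝ → Euc d →L[ℝ] Euc d →L[ℝ] E)
    (a b : ℝ) (I : E) : Prop :=
  ∀ ε > 0, ∃ δ > 0, ∀ P : IntervalPartition a b, P.MeshLT δ →
    ‖P.sum (fun s t => Z s (incr ζ.path s t) + tensorApply (Z' s) (ζ.area s t)) - I‖ < ε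

/-- Bounded Lipschitz functions. -/
def IsLipB {E F : Type*} [NormedAddCommGroup E] [NormedAddCommGroup F] (b : E → F) : Prop :=
  (∃ K : ℝ≥0, LipschitzWith K b) ∧ ∃ K : ℝ, ∀ z, ‖b z‖ ≤ K

/-- The class `Cⁿ_b`: `n` times continuously differentiable, with the function and all its
derivatives up to order `n` bounded. -/
def IsCb {E F : Type*} [NormedAddCommGroup E] [NormedSpace ℝ E] [NormedAddCommGroup F]
    [NormedSpace ℝ F] (n : ℕ) (f : E → F) : Prop :=
  ContDiff ℝ n f ∧ ∃ K : ℝ, ∀ i ≤ n, ∀ z, ‖iteratedFDeriv ℝ i f z‖ ≤ K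

/-- The path `ψ(X, γ)`. -/
def comp {m k : ℕ} {G : Type*} (ψ : Euc m × Euc k → G) (X : ℝ → Euc m) (γ : ℝ → Euc k)
    (s : ℝ) : G :=
  ψ (X s, γ s)

/-- The Gubinelli derivative `ψ(X, γ)' = D_x ψ(X, γ) X'` of the path `ψ(X, γ)`. -/
def compDeriv {m k d : ℕ} {G : Type*} [NormedAddCommGroup G] [NormedSpace ℝ G]
    (ψ : Euc m × Euc k → G) (X : ℝ → Euc m) (X' : ℝ → Euc d →L[ℝ] Euc m) (γ : ℝ → Euc k)
    (s : ℝ) : Euc d →L[ℝ] G :=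
  (fderiv ℝ (fun x => ψ (x, γ s)) (X s)).comp (X' s)

/-- `(X, X')` is a solution on `[0, T]`, with `X' = σ(X, γ)`, of
`X_t = x + ∫₀ᵗ b(X_s, γ_s) ds + ∫₀ᵗ σ(X_s, γ_s) dζ_s`. -/
structure IsRDESolution {p T : ℝ} {m k d : ℕ} (b : Euc m × Euc k → Euc m)
    (σ : Euc m × Euc k → Euc d →L[ℝ] Euc m) (ζ : RoughPath p T d) (γ : ℝ → Euc k) (x : Euc m)
    (X : ℝ → Euc m) (X' : ℝ → Euc d →L[ℝ] Euc m) : Prop where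
  controlled : IsControlled ζ X X'
  deriv_eq : ∀ t ∈ Set.Icc 0 T, X' t = σ (X t, γ t)
  equation : ∀ t ∈ Set.Icc 0 T,
    HasRoughIntegral ζ (comp σ X γ) (compDeriv σ X X' γ) 0 t
      (X t - x - ∫ s in (0 : ℝ)..t, b (X s, γ s))

/-- The data of two controlled equations with common coefficients `b, σ`: both controls have
`p/2`-variation at most `M`, both rough paths have `1/p`-Hölder norm at most `L`, `(X, X')` solves
the equation with data `(x, γ, η)` and `(Y, Y')` the one with data `(y, θ, ζ)`. -/
structure IsSolutionPair {p T : ℝ} {m k d : ℕ} (L M : ℝ) (b : Euc m × Euc k → Euc m)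
    (σ : Euc m × Euc k → Euc d →L[ℝ] Euc m) (γ θ : ℝ → Euc k) (η ζ : RoughPath p T d)
    (x y : Euc m) (X Y : ℝ → Euc m) (X' Y' : ℝ → Euc d →L[ℝ] Euc m) : Prop where
  control_left : IsVarPath (p / 2) T γ
  control_right : IsVarPath (p / 2) T θ
  control_left_le : pVar (p / 2) (incr γ) 0 T ≤ ENNReal.ofReal M
  control_right_le : pVar (p / 2) (incr θ) 0 T ≤ ENNReal.ofReal M
  rough_left_le : η.holder ≤ ENNReal.ofReal L
  rough_right_le : ζ.holder ≤ ENNReal.ofReal L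
  sol_left : IsRDESolution b σ η γ x X X'
  sol_right : IsRDESolution b σ ζ θ y Y Y'

/-- The distance `|x - y| + ‖γ - θ‖_∞ + ‖γ - θ‖_{p/2} + ϱ_p(η, ζ)` of the data. -/
def dataDist {p T : ℝ} {m k d : ℕ} (x y : Euc m) (γ θ : ℝ → Euc k) (η ζ : RoughPath p T d) :
    ℝ≥0∞ :=
  ‖x - y‖ₑ + supNorm T (fun t => γ t - θ t) + pVar (p / 2) (incr fun t => γ t - θ t) 0 T +
    roughDist η ζ

end

end ControlledRDE

open ControlledRDE

namespace ControlledRDE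

/-! ### Partitions as sequences -/

/-! All variation norms are replaced by pointwise bounds against a single function `ω` on intervals
whose power `ω ^ p` is superadditive. Fix `ρ > 0` above the distance of the data. The control `W` is
the sum of the length `t - s`, the `p/2`-variations of both driving paths `γ, θ`, and the variations
of the differences of the data, the latter divided by `ρ ^ p` or `ρ ^ (p/2)`. Put `ω = W ^ (1/p)`.
The normalisation keeps `W 0 T` below a constant depending only on `T, M, p`, while the rough paths
are of size `ω` and `ω²`, and their differences of size `ρ ω` and `ρ ω²`. A bound of order `ω ^ j`
gives back a bound on the `p/j`-variation by superadditivity (`pVar_le_of_boundedBy`), so it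
suffices to prove estimates linear in `ρ`, with constants that do not see the individual data. At
the end `ρ` decreases to the distance (`le_mul_of_forall_ofReal`).

Rough integrals are handled by sewing. Chen's relation makes the defect of additivity of the germ a
sum of products of orders 2 + 1 and 1 + 2 in `ω` (`germ_defect`). Since `3/p > 1`, the Riemann sums
stay within `O(ω³)` of the germ (`norm_sum_sub_le_of_almostAdditive`), which yields both the
existence of integrals and the estimate of their increments.

For a solution, the equation expresses the remainder through drift, sewing error and area. If the
remainder is bounded by `B ω²`, the sewing error is `O((1 + B) ω³)`, so where `ω` is small the
equation improves `B` to `C + B/2`; iteration removes the dependence on the initial `B`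
(`BoundedBy.bootstrap`, `remainder_short`). Two solutions are compared in the same way
(`remainder_sub_improve`), using that the coefficients satisfy a four-point inequality and its
Taylor counterpart, for which three bounded derivatives are enough. A Gronwall argument that counts
the steps needed in terms of `W` (`gronwall_of_control`) passes from short intervals to `[0, T]`.

Gronwall and the convergence of Riemann sums also need `W` to be small on short intervals. For the
variation of a continuous path this is `isRegularOn_varCtrl`; for the rough path differences it
comes from the Hölder bounds. -/

lemma IntervalPartition.exists_seq {a b : ℝ} (P : IntervalPartition a b) :
    ∃ u : ℕ → ℝ, Monotone u ∧ u 0 = a ∧ u P.size = b ∧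
      (∀ i, a ≤ u i ∧ u i ≤ b) ∧ (∀ i < P.size, u i < u (i + 1)) ∧
      (∀ δ, P.MeshLT δ ↔ ∀ i < P.size, u (i + 1) - u i < δ) ∧
      ∀ {E : Type} [AddCommMonoid E] (A : ℝ → ℝ → E),
        P.sum A = ∑ i ∈ Finset.range P.size, A (u i) (u (i + 1)) := by
  -- Clamping the index at `P.size` makes the sequence constant after the right endpoint, hence
  -- monotone on all of `ℕ`.
  have hm : Monotone fun i : ℕ => P.pts ⟨min i P.size, by omega⟩ := by
    intro i j hij
    apply P.strictMono.monotone
    simp only [Fin.mk_le_mk]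
    omega
  have h0 : P.pts ⟨min 0 P.size, by omega⟩ = a := by
    refine Eq.trans ?_ P.first; congr 1
  have h1 : P.pts ⟨min P.size P.size, by omega⟩ = b := by
    refine Eq.trans ?_ P.last; congr 1; ext; simp
  have hc : ∀ i : Fin P.size, P.pts i.castSucc = P.pts ⟨min (i : ℕ) P.size, by omega⟩ := by
    intro i; congr 1; ext; simp
  have hs : ∀ i : Fin P.size, P.pts i.succ = P.pts ⟨min ((i : ℕ) + 1) P.size, by omega⟩ := by
    intro i; congr 1; ext; simp
  refine ⟨fun i => P.pts ⟨min i P.size, by omega⟩, hm, h0, h1, ?_, ?_, ?_, ?_⟩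
  · intro i
    refine ⟨?_, ?_⟩
    · exact h0.symm.le.trans (hm (Nat.zero_le i))
    · exact (P.strictMono.monotone (Fin.le_last _)).trans P.last.le
  · intro i hi
    apply P.strictMono
    simp only [Fin.mk_lt_mk]
    omega
  · intro δ
    constructor
    · intro h i hi
      have := h ⟨i, hi⟩
      rw [hc, hs] at this
      exact this
    · intro h i
      rw [hc, hs]
      exact h i i.2
  · intro E _ A
    unfold IntervalPartition.sum
    rw [← Fin.sum_univ_eq_sum_range
      (fun i => A (P.pts ⟨min i P.size, by omega⟩) (P.pts ⟨min (i + 1) P.size, by omega⟩))]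
    refine Finset.sum_congr rfl fun i _ => ?_
    rw [hc, hs]

lemma exists_partition_of_seq {a b : ℝ} (u : ℕ → ℝ) (n : ℕ) (h0 : u 0 = a) (h1 : u n = b)
    (hu : ∀ i < n, u i < u (i + 1)) :
    ∃ P : IntervalPartition a b,
      (∀ δ, P.MeshLT δ ↔ ∀ i < n, u (i + 1) - u i < δ) ∧
      ∀ {E : Type} [AddCommMonoid E] (A : ℝ → ℝ → E),
        P.sum A = ∑ i ∈ Finset.range n, A (u i) (u (i + 1)) := by
  refine ⟨⟨n, fun i => u i, ?_, by simpa using h0, by simpa using h1⟩, ?_, ?_⟩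
  · rw [Fin.strictMono_iff_lt_succ]
    intro i
    simpa using hu i i.2
  · intro δ
    constructor
    · intro h i hi
      simpa using h ⟨i, hi⟩
    · intro h i
      simpa using h i i.2
  · intro E _ A
    unfold IntervalPartition.sum
    simp only [Fin.val_castSucc, Fin.val_succ]
    exact Fin.sum_univ_eq_sum_range (fun i => A (u i) (u (i + 1))) n

lemma IntervalPartition.exists_concat {a b c : ℝ} (P : IntervalPartition a b)
    (Q : IntervalPartition b c) :
    ∃ R : IntervalPartition a c, (∀ δ, P.MeshLT δ → Q.MeshLT δ → R.MeshLT δ) ∧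
      ∀ {E : Type} [AddCommMonoid E] (A : ℝ → ℝ → E), R.sum A = P.sum A + Q.sum A := by
  obtain ⟨u, -, u0, u1, -, us, um, uS⟩ := P.exists_seq
  obtain ⟨v, -, v0, v1, -, vs, vm, vS⟩ := Q.exists_seq
  set w : ℕ → ℝ := fun i => if i ≤ P.size then u i else v (i - P.size) with hw
  have w1 : ∀ i ≤ P.size, w i = u i := fun i hi => by simp [hw, hi]
  have w2 : ∀ i, w (P.size + i) = v i := by
    intro i
    rcases Nat.eq_zero_or_pos i with rfl | hi
    · simp [hw, u1, v0]
    · simp only [hw]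
      rw [if_neg (by omega)]
      congr 1; omega
  have key : ∀ i < P.size + Q.size, (i < P.size ∧ w i = u i ∧ w (i + 1) = u (i + 1)) ∨
      ∃ j < Q.size, w i = v j ∧ w (i + 1) = v (j + 1) := by
    intro i hi
    by_cases h : i < P.size
    · exact Or.inl ⟨h, w1 i h.le, w1 _ h⟩
    · refine Or.inr ⟨i - P.size, by omega, ?_, ?_⟩
      · rw [← w2]; congr 1; omega
      · rw [← w2]; congr 1; omega
  obtain ⟨R, Rm, RS⟩ := exists_partition_of_seq (a := a) (b := c) w (P.size + Q.size)
    (by rw [w1 0 (Nat.zero_le _), u0]) (by rw [w2, v1]) (by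
      intro i hi
      rcases key i hi with ⟨h, e1, e2⟩ | ⟨j, h, e1, e2⟩
      · rw [e1, e2]; exact us i h
      · rw [e1, e2]; exact vs j h)
  refine ⟨R, ?_, ?_⟩
  · intro δ hP hQ
    rw [Rm]
    intro i hi
    rcases key i hi with ⟨h, e1, e2⟩ | ⟨j, h, e1, e2⟩
    · rw [e1, e2]; exact (um δ).1 hP i h
    · rw [e1, e2]; exact (vm δ).1 hQ j h
  · intro E _ A
    rw [RS, uS, vS, Finset.sum_range_add]
    congr 1
    · refine Finset.sum_congr rfl fun i hi => ?_
      rw [w1 i (Finset.mem_range.1 hi).le, w1 (i + 1) (Finset.mem_range.1 hi)]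
    · refine Finset.sum_congr rfl fun i hi => ?_
      rw [w2, add_assoc, w2]

lemma exists_partition_meshLT {a b : ℝ} (hab : a ≤ b) {δ : ℝ} (hδ : 0 < δ) :
    ∃ P : IntervalPartition a b, P.MeshLT δ := by
  rcases hab.eq_or_lt with rfl | hab
  · obtain ⟨P, hP, -⟩ := exists_partition_of_seq (a := a) (b := a) (fun _ => a) 0 rfl rfl (by simp)
    exact ⟨P, (hP δ).2 (by simp)⟩
  · obtain ⟨n, hn⟩ := exists_nat_gt ((b - a) / δ)
    have hn0 : (0 : ℝ) < n := lt_trans (by have := sub_pos.2 hab; positivity) hn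
    have hstep : ∀ i : ℕ, (a + ((i + 1 : ℕ) : ℝ) * ((b - a) / n)) - (a + i * ((b - a) / n))
        = (b - a) / n := by intro i; push_cast; ring
    obtain ⟨P, hP, -⟩ := exists_partition_of_seq (a := a) (b := b)
      (fun i => a + i * ((b - a) / n)) n (by simp) (by field_simp; ring) (by
        intro i _
        have := hstep i
        have h2 : 0 < (b - a) / n := div_pos (sub_pos.2 hab) hn0
        linarith)
    refine ⟨P, (hP δ).2 ?_⟩
    intro i _
    rw [hstep, div_lt_iff₀ hn0]
    rw [div_lt_iff₀ hδ] at hn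
    linarith

lemma exists_single_partition {a b : ℝ} (hab : a < b) :
    ∃ P : IntervalPartition a b, ∀ {E : Type} [AddCommMonoid E] (A : ℝ → ℝ → E),
      P.sum A = A a b := by
  obtain ⟨P, -, hP⟩ := exists_partition_of_seq (a := a) (b := b)
    (fun i => if i = 0 then a else b) 1 (by simp) (by simp) (by simpa using hab)
  exact ⟨P, fun A => by rw [hP]; simp⟩

/-! ### Controls -/

/-- Nonnegative superadditive functions of the subintervals of `[a, b]`. -/
structure IsControlOn (a b : ℝ) (W : ℝ → ℝ → ℝ) : Prop where
  nonneg : ∀ s t, a ≤ s → s ≤ t → t ≤ b → 0 ≤ W s t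
  superadd : ∀ s u t, a ≤ s → s ≤ u → u ≤ t → t ≤ b → W s u + W u t ≤ W s t

namespace IsControlOn

variable {a b : ℝ} {W W' : ℝ → ℝ → ℝ}

lemma restrict (h : IsControlOn a b W) {a' b' : ℝ} (ha : a ≤ a') (hb : b' ≤ b) :
    IsControlOn a' b' W :=
  ⟨fun s t h1 h2 h3 => h.nonneg s t (ha.trans h1) h2 (h3.trans hb),
    fun s u t h1 h2 h3 h4 => h.superadd s u t (ha.trans h1) h2 h3 (h4.trans hb)⟩

lemma add (h : IsControlOn a b W) (h' : IsControlOn a b W') :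
    IsControlOn a b (fun s t => W s t + W' s t) :=
  ⟨fun s t h1 h2 h3 => add_nonneg (h.nonneg s t h1 h2 h3) (h'.nonneg s t h1 h2 h3),
    fun s u t h1 h2 h3 h4 => by
      have := h.superadd s u t h1 h2 h3 h4
      have := h'.superadd s u t h1 h2 h3 h4
      linarith⟩

lemma const_mul (h : IsControlOn a b W) {c : ℝ} (hc : 0 ≤ c) :
    IsControlOn a b (fun s t => c * W s t) :=
  ⟨fun s t h1 h2 h3 => mul_nonneg hc (h.nonneg s t h1 h2 h3),
    fun s u t h1 h2 h3 h4 => by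
      have := mul_le_mul_of_nonneg_left (h.superadd s u t h1 h2 h3 h4) hc
      linarith⟩

lemma length (a b : ℝ) : IsControlOn a b (fun s t => t - s) :=
  ⟨fun s t _ h _ => sub_nonneg.2 h, fun s u t _ _ _ _ => by linarith⟩

lemma diag (h : IsControlOn a b W) {s : ℝ} (h1 : a ≤ s) (h2 : s ≤ b) : W s s = 0 := by
  have e1 := h.nonneg s s h1 le_rfl h2
  have e2 := h.superadd s s s h1 le_rfl le_rfl h2
  linarith

lemma mono (h : IsControlOn a b W) {s s' t t' : ℝ} (h1 : a ≤ s) (h2 : s ≤ s') (h3 : s' ≤ t')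
    (h4 : t' ≤ t) (h5 : t ≤ b) : W s' t' ≤ W s t := by
  have e1 := h.superadd s s' t h1 h2 (h3.trans h4) h5
  have e2 := h.superadd s' t' t (h1.trans h2) h3 h4 h5
  have e3 := h.nonneg s s' h1 h2 (h3.trans (h4.trans h5))
  have e4 := h.nonneg t' t (h1.trans (h2.trans h3)) h4 h5
  linarith

lemma sum_le (h : IsControlOn a b W) {u : ℕ → ℝ} (hu : Monotone u) (ha : ∀ i, a ≤ u i)
    (hb : ∀ i, u i ≤ b) (n : ℕ) : ∑ i ∈ Finset.range n, W (u i) (u (i + 1)) ≤ W (u 0) (u n) := by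
  induction n with
  | zero => simpa using h.nonneg _ _ (ha 0) le_rfl (hb 0)
  | succ n ih =>
    rw [Finset.sum_range_succ]
    have := h.superadd (u 0) (u n) (u (n + 1)) (ha 0) (hu (Nat.zero_le n)) (hu n.le_succ)
      (hb (n + 1))
    linarith

end IsControlOn

/-- The control is small on short intervals. -/
def IsRegularOn (a b : ℝ) (W : ℝ → ℝ → ℝ) : Prop :=
  ∀ ε > 0, ∃ δ > 0, ∀ s t, a ≤ s → s ≤ t → t ≤ b → t - s < δ → W s t < ε

namespace IsRegularOn

variable {a b : ℝ} {W W' : ℝ → ℝ → ℝ}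

lemma add (h : IsRegularOn a b W) (h' : IsRegularOn a b W') :
    IsRegularOn a b (fun s t => W s t + W' s t) := by
  intro ε hε
  obtain ⟨δ, hδ, H⟩ := h (ε / 2) (by positivity)
  obtain ⟨δ', hδ', H'⟩ := h' (ε / 2) (by positivity)
  refine ⟨min δ δ', lt_min hδ hδ', fun s t h1 h2 h3 h4 => ?_⟩
  have := H s t h1 h2 h3 (h4.trans_le (min_le_left _ _))
  have := H' s t h1 h2 h3 (h4.trans_le (min_le_right _ _))
  linarith

lemma const_mul (h : IsRegularOn a b W) {c : ℝ} (hc : 0 < c) :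
    IsRegularOn a b (fun s t => c * W s t) := by
  intro ε hε
  obtain ⟨δ, hδ, H⟩ := h (ε / c) (by positivity)
  refine ⟨δ, hδ, fun s t h1 h2 h3 h4 => ?_⟩
  have := H s t h1 h2 h3 h4
  rw [lt_div_iff₀ hc] at this
  linarith

lemma length (a b : ℝ) : IsRegularOn a b (fun s t => t - s) :=
  fun ε hε => ⟨ε, hε, fun _ _ _ _ _ h => h⟩

lemma mono (h : IsRegularOn a b W)
    (hle : ∀ s t, a ≤ s → s ≤ t → t ≤ b → W' s t ≤ W s t) : IsRegularOn a b W' := by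
  intro ε hε
  obtain ⟨δ, hδ, H⟩ := h ε hε
  exact ⟨δ, hδ, fun s t h1 h2 h3 h4 => (hle s t h1 h2 h3).trans_lt (H s t h1 h2 h3 h4)⟩

end IsRegularOn

/-! ### The variation as a control -/

variable {E : Type} [NormedAddCommGroup E]

/-- The supremum `sup_P ∑ |A_{s,t}|^q` over the partitions of `[a, b]`. -/
noncomputable def varSup (q : ℝ) (A : ℝ → ℝ → E) (a b : ℝ) : ℝ≥0∞ :=
  ⨆ P : IntervalPartition a b, P.sum (fun s t => ‖A s t‖ₑ ^ q)

/-- The supremum `sup_P ∑ |A_{s,t}|^q` as a real number. -/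
noncomputable def varCtrl (q : ℝ) (A : ℝ → ℝ → E) (a b : ℝ) : ℝ := (varSup q A a b).toReal

lemma varSup_superadd (q : ℝ) (A : ℝ → ℝ → E) {a b c : ℝ} (hab : a ≤ b) (hbc : b ≤ c) :
    varSup q A a b + varSup q A b c ≤ varSup q A a c := by
  -- Suprema over partitions add up only when both families are nonempty, which is where the order
  -- of the endpoints enters.
  obtain ⟨P0, -⟩ := exists_partition_meshLT hab one_pos
  obtain ⟨Q0, -⟩ := exists_partition_meshLT hbc one_pos
  have : Nonempty (IntervalPartition a b) := ⟨P0⟩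
  have : Nonempty (IntervalPartition b c) := ⟨Q0⟩
  refine ENNReal.iSup_add_iSup_le fun P Q => ?_
  obtain ⟨R, -, hR⟩ := P.exists_concat Q
  rw [← hR]
  exact le_iSup (fun R : IntervalPartition a c => R.sum (fun s t => ‖A s t‖ₑ ^ q)) R

lemma varSup_mono (q : ℝ) (A : ℝ → ℝ → E) {a b s t : ℝ} (h1 : a ≤ s) (h2 : s ≤ t) (h3 : t ≤ b) :
    varSup q A s t ≤ varSup q A a b :=
  calc varSup q A s t ≤ varSup q A a s + varSup q A s t := le_add_self
    _ ≤ varSup q A a t := varSup_superadd q A h1 h2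
    _ ≤ varSup q A a t + varSup q A t b := le_self_add
    _ ≤ varSup q A a b := varSup_superadd q A (h1.trans h2) h3

lemma enorm_rpow_le_varSup (q : ℝ) (A : ℝ → ℝ → E) {a b : ℝ} (hab : a < b) :
    ‖A a b‖ₑ ^ q ≤ varSup q A a b := by
  obtain ⟨P, hP⟩ := exists_single_partition hab
  have := le_iSup (fun R : IntervalPartition a b => R.sum (fun s t => ‖A s t‖ₑ ^ q)) P
  simp only [hP] at this
  exact this

/-- The variation is the smallest control dominating `|A| ^ q`: superadditivity collapses the sum of
`W` over any partition to `W a b`. This minimality is the source of all upper bounds on variations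
below. -/
lemma varSup_le_of_control {q : ℝ} {A : ℝ → ℝ → E} {a b : ℝ} (hq : 0 ≤ q)
    {W : ℝ → ℝ → ℝ}
    (hW : IsControlOn a b W) (hA : ∀ s t, a ≤ s → s < t → t ≤ b → ‖A s t‖ ^ q ≤ W s t) :
    varSup q A a b ≤ ENNReal.ofReal (W a b) := by
  refine iSup_le fun P => ?_
  obtain ⟨u, um, u0, u1, uab, us, -, uS⟩ := P.exists_seq
  rw [uS]
  calc ∑ i ∈ Finset.range P.size, ‖A (u i) (u (i + 1))‖ₑ ^ q
      ≤ ∑ i ∈ Finset.range P.size, ENNReal.ofReal (W (u i) (u (i + 1))) := by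
        refine Finset.sum_le_sum fun i hi => ?_
        rw [← ofReal_norm, ENNReal.ofReal_rpow_of_nonneg (norm_nonneg _) hq]
        exact ENNReal.ofReal_le_ofReal
          (hA _ _ (uab i).1 (us i (Finset.mem_range.1 hi)) (uab _).2)
    _ = ENNReal.ofReal (∑ i ∈ Finset.range P.size, W (u i) (u (i + 1))) := by
        rw [ENNReal.ofReal_sum_of_nonneg]
        exact fun i _ => hW.nonneg _ _ (uab i).1 (um i.le_succ) (uab _).2
    _ ≤ ENNReal.ofReal (W a b) := by
        apply ENNReal.ofReal_le_ofReal
        have := hW.sum_le um (fun i => (uab i).1) (fun i => (uab i).2) P.size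
        rwa [u0, u1] at this

lemma varCtrl_le_of_control {q : ℝ} {A : ℝ → ℝ → E} {a b : ℝ} (hq : 0 ≤ q) (hab : a ≤ b)
    {W : ℝ → ℝ → ℝ}
    (hW : IsControlOn a b W) (hA : ∀ s t, a ≤ s → s < t → t ≤ b → ‖A s t‖ ^ q ≤ W s t) :
    varCtrl q A a b ≤ W a b :=
  ENNReal.toReal_le_of_le_ofReal (hW.nonneg a b le_rfl hab le_rfl)
    (varSup_le_of_control hq hW hA)

lemma isControlOn_varCtrl {q : ℝ} {A : ℝ → ℝ → E} {a b : ℝ} (h : varSup q A a b ≠ ⊤) :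
    IsControlOn a b (varCtrl q A) := by
  have fin : ∀ s t, a ≤ s → s ≤ t → t ≤ b → varSup q A s t ≠ ⊤ := fun s t h1 h2 h3 =>
    ne_top_of_le_ne_top h (varSup_mono q A h1 h2 h3)
  refine ⟨fun _ _ _ _ _ => ENNReal.toReal_nonneg, fun s u t h1 h2 h3 h4 => ?_⟩
  unfold varCtrl
  rw [← ENNReal.toReal_add (fin s u h1 h2 (h3.trans h4)) (fin u t (h1.trans h2) h3 h4)]
  exact ENNReal.toReal_mono (fin s t h1 (h2.trans h3) h4) (varSup_superadd q A h2 h3)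

lemma norm_rpow_le_varCtrl {q : ℝ} {A : ℝ → ℝ → E} {a b : ℝ}
    (h : varSup q A a b ≠ ⊤)
    {s t : ℝ} (h1 : a ≤ s) (h2 : s < t) (h3 : t ≤ b) : ‖A s t‖ ^ q ≤ varCtrl q A s t := by
  have e := ENNReal.toReal_mono (ne_top_of_le_ne_top h (varSup_mono q A h1 h2.le h3))
    (enorm_rpow_le_varSup q A h2)
  rwa [← ENNReal.toReal_rpow, toReal_enorm] at e

lemma pVar_eq (q : ℝ) (A : ℝ → ℝ → E) (a b : ℝ) : pVar q A a b = varSup q A a b ^ (1 / q) := rfl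

lemma varSup_eq_pVar_rpow {q : ℝ} (hq : 0 < q) (A : ℝ → ℝ → E) (a b : ℝ) :
    varSup q A a b = pVar q A a b ^ q := by
  rw [pVar_eq, ← ENNReal.rpow_mul, one_div_mul_cancel hq.ne', ENNReal.rpow_one]

lemma varSup_ne_top {q : ℝ} (hq : 0 < q) {A : ℝ → ℝ → E} {a b : ℝ} (h : pVar q A a b ≠ ⊤) :
    varSup q A a b ≠ ⊤ := by
  rw [varSup_eq_pVar_rpow hq]
  exact ENNReal.rpow_ne_top_of_nonneg hq.le h

lemma varCtrl_le_rpow {q : ℝ} (hq : 0 < q) {A : ℝ → ℝ → E} {a b r : ℝ} (hr : 0 ≤ r)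
    (h : pVar q A a b ≤ ENNReal.ofReal r) : varCtrl q A a b ≤ r ^ q := by
  refine ENNReal.toReal_le_of_le_ofReal (by positivity) ?_
  rw [varSup_eq_pVar_rpow hq, ← ENNReal.ofReal_rpow_of_nonneg hr hq.le]
  exact ENNReal.rpow_le_rpow h hq.le

/-! ### Regularity of the variation of a continuous path -/

section

open Filter Topology

variable {E : Type} [NormedAddCommGroup E]

/-- By minimality of the variation. If `V r u ≥ ε` for all `u > r`, then subtracting `ε` from `V` on
the nondegenerate intervals that start at `r` leaves a control, and by continuity of `X` it still
dominates `|X| ^ q`. Hence `V r b ≤ V r b - ε`, which is absurd. -/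
lemma varCtrl_right_regular {q : ℝ} (hq : 0 < q) {X : ℝ → E} {a b : ℝ}
    (hX : ContinuousOn X (Set.Icc a b)) (hfin : varSup q (incr X) a b ≠ ⊤) {r : ℝ}
    (ha : a ≤ r) (hb : r ≤ b) {ε : ℝ} (hε : 0 < ε) :
    ∃ δ > 0, ∀ u, r ≤ u → u ≤ b → u - r < δ → varCtrl q (incr X) r u < ε := by
  have hV := (isControlOn_varCtrl hfin).restrict ha le_rfl
  by_contra! hcon
  have hrb : r < b := by
    obtain ⟨u, h1, h2, -, h4⟩ := hcon 1 one_pos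
    refine lt_of_le_of_ne hb ?_
    rintro rfl
    obtain rfl := le_antisymm h1 h2
    rw [hV.diag le_rfl le_rfl] at h4
    linarith
  have hlow : ∀ u, r < u → u ≤ b → ε ≤ varCtrl q (incr X) r u := by
    intro u h1 h2
    obtain ⟨v, h3, h4, h5, h6⟩ := hcon (u - r) (sub_pos.2 h1)
    exact h6.trans (hV.mono le_rfl le_rfl h3 (by linarith) h2)
  -- When an interval starting at `r` is cut at a point beyond `r`, exactly one of the two pieces
  -- starts at `r`, so `ε` is subtracted once on each side of superadditivity.
  have hV' : IsControlOn r b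
      (fun s t => varCtrl q (incr X) s t - if s = r ∧ r < t then ε else 0) := by
    refine ⟨fun s t h1 h2 h3 => ?_, fun s u t h1 h2 h3 h4 => ?_⟩
    · split_ifs with h
      · obtain ⟨rfl, h⟩ := h
        linarith [hlow t h h3]
      · linarith [hV.nonneg s t h1 h2 h3]
    · have := hV.superadd s u t h1 h2 h3 h4
      by_cases h : s = r ∧ r < t
      · obtain ⟨rfl, h⟩ := h
        rcases h2.eq_or_lt with rfl | h'
        · simp only [lt_irrefl, and_false, if_false, h, and_true, if_true]
          linarith
        · simp only [h', h'.ne', h, and_true, if_true, if_false]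
          linarith
      · have e1 : (0 : ℝ) ≤ if s = r ∧ r < u then ε else 0 := by split_ifs <;> linarith
        have e2 : (0 : ℝ) ≤ if u = r ∧ r < t then ε else 0 := by split_ifs <;> linarith
        simp only [h, if_false]
        linarith
  have := varCtrl_le_of_control hq.le hb hV' (A := incr X) (q := q) (by
    intro s t h1 h2 h3
    split_ifs with h
    · obtain ⟨rfl, h⟩ := h
      -- For `s < u < t` one has `|X_{u,t}| ^ q ≤ V u t ≤ V s t - V s u ≤ V s t - ε`; now let `u`
      -- decrease to `s`.
      have hc : Tendsto (fun u => ‖incr X u t‖ ^ q) (𝓝[Set.Ioc s b] s) (𝓝 (‖incr X s t‖ ^ q)) := by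
        have h1 : Tendsto X (𝓝[Set.Ioc s b] s) (𝓝 (X s)) :=
          (hX s ⟨ha, hb⟩).mono_left (nhdsWithin_mono _ fun x hx => ⟨ha.trans hx.1.le, hx.2⟩)
        exact ((tendsto_const_nhds.sub h1).norm).rpow_const (Or.inr hq.le)
      have hne : (𝓝[Set.Ioc s b] s).NeBot := by
        rw [nhdsWithin_Ioc_eq_nhdsGT hrb]
        infer_instance
      have hlt : ∀ᶠ u in 𝓝[Set.Ioc s b] s, u < t :=
        mem_nhdsWithin_of_mem_nhds (Iio_mem_nhds h)
      refine le_of_tendsto hc ?_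
      filter_upwards [self_mem_nhdsWithin, hlt] with u hu hut
      have e1 := hV.superadd s u t le_rfl hu.1.le hut.le h3
      have e2 := hlow u hu.1 hu.2
      have e3 := norm_rpow_le_varCtrl hfin (ha.trans hu.1.le) hut h3
      linarith
    · have := norm_rpow_le_varCtrl hfin (ha.trans h1) h2 h3
      linarith)
  simp only [hrb, and_true, if_true] at this
  linarith

/-- Mirror image of `varCtrl_right_regular`: `ε` is taken off the intervals ending at `r`. -/
lemma varCtrl_left_regular {q : ℝ} (hq : 0 < q) {X : ℝ → E} {a b : ℝ}
    (hX : ContinuousOn X (Set.Icc a b)) (hfin : varSup q (incr X) a b ≠ ⊤) {r : ℝ}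
    (ha : a ≤ r) (hb : r ≤ b) {ε : ℝ} (hε : 0 < ε) :
    ∃ δ > 0, ∀ u, a ≤ u → u ≤ r → r - u < δ → varCtrl q (incr X) u r < ε := by
  have hV := (isControlOn_varCtrl hfin).restrict le_rfl hb
  by_contra! hcon
  have hra : a < r := by
    obtain ⟨u, h1, h2, -, h4⟩ := hcon 1 one_pos
    refine lt_of_le_of_ne ha ?_
    rintro rfl
    obtain rfl := le_antisymm h1 h2
    rw [hV.diag le_rfl le_rfl] at h4
    linarith
  have hlow : ∀ u, a ≤ u → u < r → ε ≤ varCtrl q (incr X) u r := by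
    intro u h1 h2
    obtain ⟨v, h3, h4, h5, h6⟩ := hcon (r - u) (sub_pos.2 h2)
    exact h6.trans (hV.mono h1 (by linarith) h4 le_rfl le_rfl)
  have hV' : IsControlOn a r
      (fun s t => varCtrl q (incr X) s t - if t = r ∧ s < r then ε else 0) := by
    refine ⟨fun s t h1 h2 h3 => ?_, fun s u t h1 h2 h3 h4 => ?_⟩
    · split_ifs with h
      · obtain ⟨rfl, h⟩ := h
        linarith [hlow s h1 h]
      · linarith [hV.nonneg s t h1 h2 h3]
    · have := hV.superadd s u t h1 h2 h3 h4
      by_cases h : t = r ∧ s < r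
      · obtain ⟨rfl, h⟩ := h
        rcases h3.eq_or_lt with rfl | h'
        · simp only [lt_irrefl, and_false, if_false, h, and_true, if_true]
          linarith
        · simp only [h', h'.ne, h, and_true, if_true, if_false]
          linarith
      · have e1 : (0 : ℝ) ≤ if u = r ∧ s < r then ε else 0 := by split_ifs <;> linarith
        have e2 : (0 : ℝ) ≤ if t = r ∧ u < r then ε else 0 := by split_ifs <;> linarith
        simp only [h, if_false]
        linarith
  have := varCtrl_le_of_control hq.le ha hV' (A := incr X) (q := q) (by
    intro s t h1 h2 h3
    split_ifs with h
    · obtain ⟨rfl, h⟩ := h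
      have hc : Tendsto (fun u => ‖incr X s u‖ ^ q) (𝓝[Set.Ico a t] t) (𝓝 (‖incr X s t‖ ^ q)) := by
        have h1 : Tendsto X (𝓝[Set.Ico a t] t) (𝓝 (X t)) :=
          (hX t ⟨ha, hb⟩).mono_left (nhdsWithin_mono _ fun x hx => ⟨hx.1, hx.2.le.trans hb⟩)
        exact ((h1.sub tendsto_const_nhds).norm).rpow_const (Or.inr hq.le)
      have hne : (𝓝[Set.Ico a t] t).NeBot := by
        rw [nhdsWithin_Ico_eq_nhdsLT hra]
        infer_instance
      have hlt : ∀ᶠ u in 𝓝[Set.Ico a t] t, s < u :=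
        mem_nhdsWithin_of_mem_nhds (Ioi_mem_nhds h)
      refine le_of_tendsto hc ?_
      filter_upwards [self_mem_nhdsWithin, hlt] with u hu hut
      have e1 := hV.superadd s u t h1 hut.le hu.2.le le_rfl
      have e2 := hlow u hu.1 hu.2
      have e3 := norm_rpow_le_varCtrl hfin h1 hut (hu.2.le.trans hb)
      linarith
    · have := norm_rpow_le_varCtrl hfin h1 h2 (h3.trans hb)
      linarith)
  simp only [hra, and_true, if_true] at this
  linarith

/-- Splitting an interval increases the variation of a path by a bounded factor only. -/
lemma varCtrl_incr_le_split {q : ℝ} (hq : 1 ≤ q) {X : ℝ → E} {a b r : ℝ}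
    (hfin : varSup q (incr X) a b ≠ ⊤) (ha : a ≤ r) (hb : r ≤ b) :
    varCtrl q (incr X) a b ≤
      2 ^ (q - 1) * (varCtrl q (incr X) a r + varCtrl q (incr X) r b) := by
  have hV := isControlOn_varCtrl hfin
  -- The candidate control adds the variations over the parts of `[s, t]` to the left and to the
  -- right of `r`. The factor `2 ^ (q - 1)` is the convexity constant in `(x + y) ^ q ≤ 2 ^ (q - 1)
  -- (x ^ q + y ^ q)`, used when `r` lies inside the interval.
  have hU : IsControlOn a b (fun s t => 2 ^ (q - 1) * (varCtrl q (incr X) (min s r) (min t r) +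
      varCtrl q (incr X) (max s r) (max t r))) := by
    refine IsControlOn.const_mul (IsControlOn.add ⟨?_, ?_⟩ ⟨?_, ?_⟩) (by positivity)
    · exact fun s t h1 h2 h3 => hV.nonneg _ _ (le_min h1 ha) (min_le_min_right _ h2)
        ((min_le_right _ _).trans hb)
    · exact fun s u t h1 h2 h3 h4 => hV.superadd _ _ _ (le_min h1 ha) (min_le_min_right _ h2)
        (min_le_min_right _ h3) ((min_le_right _ _).trans hb)
    · exact fun s t h1 h2 h3 => hV.nonneg _ _ (h1.trans (le_max_left _ _)) (max_le_max_right _ h2)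
        (max_le h3 hb)
    · exact fun s u t h1 h2 h3 h4 => hV.superadd _ _ _ (h1.trans (le_max_left _ _))
        (max_le_max_right _ h2) (max_le_max_right _ h3) (max_le h4 hb)
  have hle : ∀ s t, a ≤ s → s ≤ t → t ≤ b → ‖incr X s t‖ ^ q ≤ varCtrl q (incr X) s t := by
    intro s t h1 h2 h3
    rcases h2.eq_or_lt with rfl | h
    · simpa [incr, Real.zero_rpow (by linarith : q ≠ 0)] using hV.nonneg s s h1 le_rfl h3
    · exact norm_rpow_le_varCtrl hfin h1 h h3
  have := varCtrl_le_of_control (by linarith) (ha.trans hb) hU (A := incr X) (q := q) (by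
    intro s t h1 h2 h3
    have e0 : incr X s t = incr X (min s r) (min t r) + incr X (max s r) (max t r) := by
      unfold incr
      rcases le_total s r with h | h <;> rcases le_total t r with h' | h' <;> simp [h, h']
    have e1 := hle (min s r) (min t r) (le_min h1 ha) (min_le_min_right _ h2.le)
      ((min_le_right _ _).trans hb)
    have e2 := hle (max s r) (max t r) (h1.trans (le_max_left _ _)) (max_le_max_right _ h2.le)
      (max_le h3 hb)
    have e3 : (‖incr X (min s r) (min t r)‖ + ‖incr X (max s r) (max t r)‖) ^ q ≤
        2 ^ (q - 1) * (‖incr X (min s r) (min t r)‖ ^ q + ‖incr X (max s r) (max t r)‖ ^ q) :=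
      mod_cast NNReal.rpow_add_le_mul_rpow_add_rpow ‖incr X (min s r) (min t r)‖₊
        ‖incr X (max s r) (max t r)‖₊ hq
    calc ‖incr X s t‖ ^ q
        ≤ (‖incr X (min s r) (min t r)‖ + ‖incr X (max s r) (max t r)‖) ^ q := by
          rw [e0]
          exact Real.rpow_le_rpow (norm_nonneg _) (norm_add_le _ _) (by linarith)
      _ ≤ _ := e3
      _ ≤ _ := by gcongr)
  simpa [ha, hb] using this

/-- One-sided regularity at `r` makes the variation small on intervals near `r` lying on one side;
an interval straddling `r` is split there at the cost of a constant factor. A Lebesgue number makes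
the neighbourhoods uniform. -/
lemma isRegularOn_varCtrl {q : ℝ} (hq : 1 ≤ q) {X : ℝ → E} {a b : ℝ}
    (hX : ContinuousOn X (Set.Icc a b)) (hfin : varSup q (incr X) a b ≠ ⊤) :
    IsRegularOn a b (varCtrl q (incr X)) := by
  intro ε hε
  have hq0 : 0 < q := by linarith
  have hV := isControlOn_varCtrl hfin
  -- Small enough that two pieces of size `ε'` recombine, with the factor `2 ^ (q - 1)`, to less
  -- than `ε`.
  set ε' := ε / (2 ^ (q - 1) * 2 + 1) with hε'
  have h2q : (0 : ℝ) < 2 ^ (q - 1) := by positivity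
  have hε'0 : 0 < ε' := by positivity
  have hle1 : ε' ≤ ε := div_le_self hε.le (by linarith)
  have hle2 : 2 ^ (q - 1) * (ε' + ε') < ε := by
    have : ε' * (2 ^ (q - 1) * 2 + 1) = ε := by rw [hε']; field_simp
    nlinarith
  have loc : ∀ r ∈ Set.Icc a b, ∃ δ > 0, ∀ s t, a ≤ s → s ≤ t → t ≤ b → r - δ < s → t < r + δ →
      varCtrl q (incr X) s t < ε := by
    intro r hr
    obtain ⟨δ1, hδ1, H1⟩ := varCtrl_right_regular hq0 hX hfin hr.1 hr.2 hε'0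
    obtain ⟨δ2, hδ2, H2⟩ := varCtrl_left_regular hq0 hX hfin hr.1 hr.2 hε'0
    refine ⟨min δ1 δ2, lt_min hδ1 hδ2, fun s t h1 h2 h3 h4 h5 => ?_⟩
    have m1 := min_le_left δ1 δ2
    have m2 := min_le_right δ1 δ2
    rcases le_total r s with h | h
    · exact (hV.mono hr.1 h h2 le_rfl h3).trans_lt
        ((H1 t (h.trans h2) h3 (by linarith)).trans_le hle1)
    rcases le_total t r with h' | h'
    · exact (hV.mono h1 le_rfl h2 h' hr.2).trans_lt ((H2 s h1 h (by linarith)).trans_le hle1)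
    · have e1 := H1 t h' h3 (by linarith)
      have e2 := H2 s h1 h (by linarith)
      have e3 := varCtrl_incr_le_split hq (ne_top_of_le_ne_top hfin (varSup_mono q (incr X) h1 h2 h3))
        h h'
      refine e3.trans_lt (lt_of_le_of_lt ?_ hle2)
      gcongr
  choose! δ hδ H using loc
  obtain ⟨η, hη, Hη⟩ := lebesgue_number_lemma_of_metric (s := Set.Icc a b) isCompact_Icc
    (c := fun r : Set.Icc a b => Metric.ball (r : ℝ) (δ r)) (fun _ => Metric.isOpen_ball)
    (fun r hr => Set.mem_iUnion.2 ⟨⟨r, hr⟩, Metric.mem_ball_self (hδ r hr)⟩)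
  refine ⟨η, hη, fun s t h1 h2 h3 h4 => ?_⟩
  obtain ⟨r, hr⟩ := Hη s ⟨h1, h2.trans h3⟩
  have hs := hr (Metric.mem_ball_self hη)
  have ht : t ∈ Metric.ball (r : ℝ) (δ r) := hr (by
    rw [Metric.mem_ball, Real.dist_eq, abs_of_nonneg (by linarith)]; exact h4)
  rw [Metric.mem_ball, Real.dist_eq, abs_lt] at hs ht
  exact H r r.2 s t h1 h2 h3 (by linarith [hs.1]) (by linarith [ht.2])

/-- The variation of a function of two parameters of positive Hölder regularity `1 / q` is
regular. -/
lemma isRegularOn_varCtrl_of_holder {q : ℝ} (hq : 0 < q) {A : ℝ → ℝ → E} {a b K : ℝ}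
    (hK : 0 < K) (hA : ∀ s t, a ≤ s → s < t → t ≤ b → ‖A s t‖ ^ q ≤ K * (t - s)) :
    IsRegularOn a b (varCtrl q A) := by
  refine ((IsRegularOn.length a b).const_mul hK).mono fun s t h1 h2 h3 => ?_
  exact varCtrl_le_of_control hq.le h2 ((IsControlOn.length s t).const_mul hK.le)
    fun u v e1 e2 e3 => hA u v (h1.trans e1) e2 (e3.trans h3)

end

/-! ### Gronwall's inequality along a control -/

/-- A greedy count of steps. Two consecutive steps of the recursion cover an interval on which `W`
exceeds `e`, so by superadditivity about `2 W a b / e` factors `A` suffice. Regularity of `W`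
supplies a grid whose cells have `W ≤ e`, which is needed because `W` need not take the value `e`
exactly. -/
lemma gronwall_of_control {a b e A : ℝ} (he : 0 < e) (hA : 1 ≤ A)
    {W : ℝ → ℝ → ℝ} (hW : IsControlOn a b W) (hreg : IsRegularOn a b W) {f : ℝ → ℝ}
    (hf0 : ∀ t, 0 ≤ f t)
    (hf : ∀ s t, a ≤ s → s ≤ t → t ≤ b → W s t ≤ e → f t ≤ A * f s) :
    ∀ t, a ≤ t → t ≤ b → f t ≤ A ^ (1 + 2 * W a b / e) * f a := by
  have hA0 : 0 < A := by linarith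
  intro t hat htb
  obtain ⟨δ, hδ, H⟩ := hreg e he
  obtain ⟨n, hn⟩ := exists_nat_gt ((t - a) / (δ / 2))
  -- The spacing `δ / 2` stays strictly below the regularity threshold `δ`.
  set u : ℕ → ℝ := fun i => min t (a + i * (δ / 2)) with hu
  have um : Monotone u := by
    intro i j hij
    simp only [hu]
    gcongr
  have u0 : u 0 = a := by simp [hu, hat]
  have un : u n = t := by
    rw [div_lt_iff₀ (by positivity)] at hn
    exact min_eq_left (by linarith)
  have ua : ∀ i, a ≤ u i := fun i => u0 ▸ um (Nat.zero_le i)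
  have ub : ∀ i, u i ≤ b := fun i => (min_le_left _ _).trans htb
  have ustep : ∀ i, W (u i) (u (i + 1)) ≤ e := by
    intro i
    rcases (um i.le_succ).eq_or_lt with h | h
    · rw [← h, hW.diag (ua i) (ub i)]
      exact he.le
    · refine (H _ _ (ua i) h.le (ub _) ?_).le
      have hi : u i = a + i * (δ / 2) := by
        refine min_eq_right ?_
        by_contra! hc
        have h1 : u i = t := min_eq_left hc.le
        have h2 : u (i + 1) ≤ t := min_le_left _ _
        linarith
      have h2 : u (i + 1) ≤ a + ((i + 1 : ℕ) : ℝ) * (δ / 2) := min_le_right _ _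
      push_cast at h2
      linarith
  have key : ∀ j, f (u j) ≤ A ^ (1 + 2 * W a (u j) / e) * f a := by
    intro j
    induction j using Nat.strong_induction_on with
    | _ j ih =>
      classical
      -- Go back from `u j` to the first grid point `u i` with `W (u i) (u j) ≤ e`. If `i > 0`, then
      -- `[u (i-1), u j]` carries more than `e`; crossing it costs two factors `A`, one for the cell
      -- `[u (i-1), u i]` and one for `[u i, u j]`, and this is what the exponent `2 W / e` pays
      -- for.
      have hex : ∃ i, W (u i) (u j) ≤ e ∧ i ≤ j := ⟨j, by rw [hW.diag (ua j) (ub j)]; exact he.le, le_rfl⟩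
      set i := Nat.find hex with hi
      obtain ⟨h1, h2⟩ := Nat.find_spec hex
      rw [← hi] at h1 h2
      have hWj : 0 ≤ W a (u j) := hW.nonneg _ _ le_rfl (ua j) (ub j)
      rcases Nat.eq_zero_or_pos i with h0 | h0
      · have := hf (u i) (u j) (ua i) (um h2) (ub j) h1
        rw [h0, u0] at this
        refine this.trans (mul_le_mul_of_nonneg_right ?_ (hf0 a))
        calc A = A ^ (1 : ℝ) := (Real.rpow_one A).symm
          _ ≤ _ := Real.rpow_le_rpow_of_exponent_le hA (by
            have : 0 ≤ 2 * W a (u j) / e := by positivity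
            linarith)
      · have hlt : i - 1 < i := by omega
        have h3 := Nat.find_min hex (by rw [← hi]; exact hlt)
        have h4 : e < W (u (i - 1)) (u j) := by
          by_contra! hc
          exact h3 ⟨hc, by omega⟩
        have h5 := ustep (i - 1)
        rw [show i - 1 + 1 = i by omega] at h5
        have e1 := hf (u i) (u j) (ua i) (um h2) (ub j) h1
        have e2 := hf (u (i - 1)) (u i) (ua _) (um hlt.le) (ub _) h5
        have e3 := ih (i - 1) (by omega)
        have e4 := hW.superadd a (u (i - 1)) (u j) le_rfl (ua _) (um (by omega)) (ub j)
        calc f (u j) ≤ A * (A * (A ^ (1 + 2 * W a (u (i - 1)) / e) * f a)) := by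
              refine e1.trans (mul_le_mul_of_nonneg_left (e2.trans ?_) hA0.le)
              exact mul_le_mul_of_nonneg_left e3 hA0.le
          _ = A ^ (2 + (1 + 2 * W a (u (i - 1)) / e)) * f a := by
              rw [Real.rpow_add hA0 2, Real.rpow_two]
              ring
          _ ≤ _ := by
              refine mul_le_mul_of_nonneg_right ?_ (hf0 a)
              refine Real.rpow_le_rpow_of_exponent_le hA ?_
              have : 2 * W a (u (i - 1)) / e + 2 ≤ 2 * W a (u j) / e := by
                rw [div_add' _ _ _ he.ne', div_le_div_iff_of_pos_right he]
                linarith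
              linarith
  have := key n
  rw [un] at this
  refine this.trans (mul_le_mul_of_nonneg_right ?_ (hf0 a))
  refine Real.rpow_le_rpow_of_exponent_le hA ?_
  have := hW.mono le_rfl le_rfl hat htb le_rfl
  gcongr

/-! ### Sewing -/

/-- Functions `ω` such that `ω ^ p` is a control on `[a, b]`. -/
structure IsRoughControl (p a b : ℝ) (ω : ℝ → ℝ → ℝ) : Prop where
  nonneg : ∀ s t, a ≤ s → s ≤ t → t ≤ b → 0 ≤ ω s t
  control : IsControlOn a b (fun s t => ω s t ^ p)

/-- The bound `|A_{s,t}| ≤ C ω(s,t)^j` on `[a, b]`. -/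
def BoundedBy {E : Type} [Norm E] (a b : ℝ) (ω : ℝ → ℝ → ℝ) (j : ℕ) (C : ℝ) (A : ℝ → ℝ → E) :
    Prop :=
  ∀ s t, a ≤ s → s ≤ t → t ≤ b → ‖A s t‖ ≤ C * ω s t ^ j

/-- The bound `|Ξ_{s,t} - Ξ_{s,u} - Ξ_{u,t}| ≤ K ω(s,t)³` on `[a, b]`. -/
def AlmostAdditive {E : Type} [NormedAddCommGroup E] (a b : ℝ) (ω : ℝ → ℝ → ℝ) (K : ℝ)
    (Ξ : ℝ → ℝ → E) : Prop :=
  ∀ s u t, a ≤ s → s ≤ u → u ≤ t → t ≤ b → ‖Ξ s t - Ξ s u - Ξ u t‖ ≤ K * ω s t ^ 3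

/-- The sums of `Ξ` over the partitions of `[a, b]` converge to `I` as the mesh tends to `0`. -/
def HasSewing {E : Type} [NormedAddCommGroup E] (Ξ : ℝ → ℝ → E) (a b : ℝ) (I : E) : Prop :=
  ∀ ε > 0, ∃ δ > 0, ∀ P : IntervalPartition a b, P.MeshLT δ → ‖P.sum Ξ - I‖ < ε

/-- The constant of the sewing lemma. -/
noncomputable def sewConst (p : ℝ) : ℝ := 2 / (1 - 2 ^ (1 - 3 / p))

section

variable {p a b : ℝ} {ω : ℝ → ℝ → ℝ} {E : Type} [NormedAddCommGroup E]

lemma IsRoughControl.restrict (h : IsRoughControl p a b ω) {a' b' : ℝ} (ha : a ≤ a')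
    (hb : b' ≤ b) : IsRoughControl p a' b' ω :=
  ⟨fun s t h1 h2 h3 => h.nonneg s t (ha.trans h1) h2 (h3.trans hb), h.control.restrict ha hb⟩

lemma IsRoughControl.mono (h : IsRoughControl p a b ω) (hp : 0 < p) {s s' t t' : ℝ} (h1 : a ≤ s)
    (h2 : s ≤ s') (h3 : s' ≤ t') (h4 : t' ≤ t) (h5 : t ≤ b) : ω s' t' ≤ ω s t := by
  have := h.control.mono h1 h2 h3 h4 h5
  exact (Real.rpow_le_rpow_iff (h.nonneg _ _ (h1.trans h2) h3 (h4.trans h5))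
    (h.nonneg _ _ h1 (h2.trans (h3.trans h4)) h5) hp).1 this

lemma IsRoughControl.diag (h : IsRoughControl p a b ω) (hp : 0 < p) {s : ℝ} (h1 : a ≤ s)
    (h2 : s ≤ b) : ω s s = 0 := by
  have := h.control.diag h1 h2
  exact (Real.rpow_eq_zero (h.nonneg s s h1 le_rfl h2) hp.ne').1 this

lemma BoundedBy.restrict {j : ℕ} {C : ℝ} {A : ℝ → ℝ → E} (h : BoundedBy a b ω j C A)
    {a' b' : ℝ} (ha : a ≤ a') (hb : b' ≤ b) : BoundedBy a' b' ω j C A :=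
  fun s t h1 h2 h3 => h s t (ha.trans h1) h2 (h3.trans hb)

lemma BoundedBy.mono_const {j : ℕ} {C C' : ℝ} {A : ℝ → ℝ → E} (h : BoundedBy a b ω j C A)
    (hω : IsRoughControl p a b ω) (hC : C ≤ C') : BoundedBy a b ω j C' A :=
  fun s t h1 h2 h3 => (h s t h1 h2 h3).trans
    (mul_le_mul_of_nonneg_right hC (pow_nonneg (hω.nonneg s t h1 h2 h3) j))

lemma AlmostAdditive.restrict {K : ℝ} {Ξ : ℝ → ℝ → E} (h : AlmostAdditive a b ω K Ξ)
    {a' b' : ℝ} (ha : a ≤ a') (hb : b' ≤ b) : AlmostAdditive a' b' ω K Ξ :=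
  fun s u t h1 h2 h3 h4 => h s u t (ha.trans h1) h2 h3 (h4.trans hb)

lemma HasSewing.sub {Ξ Ξ' : ℝ → ℝ → E} {I I' : E} (h : HasSewing Ξ a b I)
    (h' : HasSewing Ξ' a b I') : HasSewing (fun s t => Ξ s t - Ξ' s t) a b (I - I') := by
  intro ε hε
  obtain ⟨δ, hδ, H⟩ := h (ε / 2) (by positivity)
  obtain ⟨δ', hδ', H'⟩ := h' (ε / 2) (by positivity)
  refine ⟨min δ δ', lt_min hδ hδ', fun P hP => ?_⟩
  have e1 := H P fun i => (hP i).trans_le (min_le_left _ _)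
  have e2 := H' P fun i => (hP i).trans_le (min_le_right _ _)
  have e3 : P.sum (fun s t => Ξ s t - Ξ' s t) - (I - I') = (P.sum Ξ - I) - (P.sum Ξ' - I') := by
    have : P.sum (fun s t => Ξ s t - Ξ' s t) = P.sum Ξ - P.sum Ξ' := by
      simp [IntervalPartition.sum, Finset.sum_sub_distrib]
    rw [this]; abel
  rw [e3]
  exact (norm_sub_le _ _).trans_lt (by linarith)

/-- The constant is the fixed point of the recursion in the sewing estimate: two halves of the mass
contribute `2 · 2 ^ (-3/p) = 2 ^ (1 - 3/p)`, and two defects contribute `2`. Solvability with a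
nonnegative constant is exactly `3/p > 1`. -/
lemma sewConst_spec (hp : 0 < p) (hp' : p < 3) :
    0 ≤ sewConst p ∧ sewConst p * 2 ^ (1 - 3 / p) + 2 = sewConst p := by
  have h1 : (2 : ℝ) ^ (1 - 3 / p) < 1 := by
    refine Real.rpow_lt_one_of_one_lt_of_neg one_lt_two ?_
    have : 1 < 3 / p := (one_lt_div hp).2 hp'
    linarith
  have h2 : 0 < 1 - (2 : ℝ) ^ (1 - 3 / p) := by linarith
  refine ⟨by unfold sewConst; positivity, ?_⟩
  unfold sewConst
  generalize (2 : ℝ) ^ (1 - 3 / p) = x at h1 h2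
  field_simp
  ring

/-- Riemann sums of an almost additive function. -/
lemma norm_sum_sub_le_of_almostAdditive (hp : 0 < p) (hp' : p < 3) (hω : IsRoughControl p a b ω)
    {K : ℝ} (hK : 0 ≤ K) {Ξ : ℝ → ℝ → E} (hΞ : AlmostAdditive a b ω K Ξ) (n : ℕ) :
    ∀ u : ℕ → ℝ, Monotone u → (∀ i, a ≤ u i) → (∀ i, u i ≤ b) →
      ‖∑ i ∈ Finset.range n, Ξ (u i) (u (i + 1)) - Ξ (u 0) (u n)‖ ≤
        sewConst p * K * ω (u 0) (u n) ^ 3 := by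
  obtain ⟨hC, hCeq⟩ := sewConst_spec hp hp'
  induction n using Nat.strong_induction_on with
  | _ n ih =>
    intro u um ua ub
    have hdiag : ∀ s, a ≤ s → s ≤ b → Ξ s s = 0 := by
      intro s h1 h2
      have := hΞ s s s h1 le_rfl le_rfl h2
      rw [hω.diag hp h1 h2] at this
      simpa using this
    have hω0 : 0 ≤ ω (u 0) (u n) := hω.nonneg _ _ (ua 0) (um (Nat.zero_le n)) (ub n)
    rcases Nat.eq_zero_or_pos n with rfl | hn
    · rw [hdiag _ (ua 0) (ub 0)]
      simp only [Finset.range_zero, Finset.sum_empty, sub_zero, norm_zero]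
      positivity
    -- the splitting index
    set W := fun s t => ω s t ^ p with hW
    have hWc : IsControlOn a b W := hω.control
    have hW0 : 0 ≤ W (u 0) (u n) := hWc.nonneg _ _ (ua 0) (um (Nat.zero_le n)) (ub n)
    -- Take the last `j < n` before the mass from `u 0` exceeds one half; superadditivity then
    -- leaves at most half of it after `u (j+1)`. The cell `[u j, u (j+1)]` may be heavy but is not
    -- subdivided, so isolating it costs two defects and the induction runs on the two sides only.
    obtain ⟨j, hjn, hj1, hj2⟩ : ∃ j < n, W (u 0) (u j) ≤ W (u 0) (u n) / 2 ∧
        W (u (j + 1)) (u n) ≤ W (u 0) (u n) / 2 := by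
      classical
      set j := Nat.findGreatest (fun j => W (u 0) (u j) ≤ W (u 0) (u n) / 2) (n - 1) with hj
      have hjle : j ≤ n - 1 := Nat.findGreatest_le _
      have hspec : W (u 0) (u j) ≤ W (u 0) (u n) / 2 := by
        refine Nat.findGreatest_spec (P := fun j => W (u 0) (u j) ≤ W (u 0) (u n) / 2)
          (Nat.zero_le (n - 1)) ?_
        rw [hWc.diag (ua 0) (ub 0)]
        positivity
      refine ⟨j, by omega, hspec, ?_⟩
      rcases Nat.lt_or_ge (j + 1) n with h | h
      · have h1 := Nat.findGreatest_is_greatest (P := fun j => W (u 0) (u j) ≤ W (u 0) (u n) / 2)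
          (n := n - 1) (k := j + 1) (by omega) (by omega)
        have h2 := hWc.superadd (u 0) (u (j + 1)) (u n) (ua 0) (um (Nat.zero_le _)) (um h.le) (ub n)
        simp only [not_le] at h1
        linarith
      · have : j + 1 = n := by omega
        rw [this, hWc.diag (ua n) (ub n)]
        positivity
    -- Since `ω ^ 3 = W ^ (3/p)`, halving `W` gains the factor `2 ^ (-3/p)`.
    have cube : ∀ s t, a ≤ s → s ≤ t → t ≤ b → W s t ≤ W (u 0) (u n) / 2 →
        ω s t ^ 3 ≤ 2 ^ (1 - 3 / p) / 2 * ω (u 0) (u n) ^ 3 := by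
      intro s t h1 h2 h3 h4
      have h0 := hω.nonneg s t h1 h2 h3
      have r : ∀ x : ℝ, 0 ≤ x → x ^ 3 = (x ^ p) ^ (3 / p) := by
        intro x hx
        rw [← Real.rpow_mul hx, mul_div_cancel₀ _ hp.ne']
        norm_cast
      rw [r _ h0, r _ hω0]
      calc (W s t) ^ (3 / p) ≤ (W (u 0) (u n) / 2) ^ (3 / p) :=
            Real.rpow_le_rpow (hWc.nonneg s t h1 h2 h3) h4 (by positivity)
        _ = 2 ^ (1 - 3 / p) / 2 * W (u 0) (u n) ^ (3 / p) := by
            rw [Real.div_rpow hW0 (by norm_num), Real.rpow_sub two_pos, Real.rpow_one]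
            field_simp
    have u0j := um (Nat.zero_le j)
    have uj1 := um (Nat.le_succ j)
    have ujn : u (j + 1) ≤ u n := um hjn
    have e1 := ih j hjn u um ua ub
    have e2 := ih (n - (j + 1)) (by omega) (fun i => u (j + 1 + i))
      (fun i i' h => um (by omega)) (fun i => ua _) (fun i => ub _)
    simp only [add_zero, show j + 1 + (n - (j + 1)) = n by omega] at e2
    have e3 := hΞ (u 0) (u j) (u n) (ua 0) u0j (uj1.trans ujn) (ub n)
    have e4 := hΞ (u j) (u (j + 1)) (u n) (ua j) uj1 ujn (ub n)
    have e5 : ω (u j) (u n) ^ 3 ≤ ω (u 0) (u n) ^ 3 := by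
      have := hω.mono hp (ua 0) u0j (uj1.trans ujn) le_rfl (ub n)
      have := hω.nonneg (u j) (u n) (ua j) (uj1.trans ujn) (ub n)
      gcongr
    have e6 := cube _ _ (ua 0) u0j (ub j) hj1
    have e7 := cube _ _ (ua _) ujn (ub n) hj2
    have split : ∑ i ∈ Finset.range n, Ξ (u i) (u (i + 1)) =
        ∑ i ∈ Finset.range j, Ξ (u i) (u (i + 1)) + Ξ (u j) (u (j + 1)) +
          ∑ i ∈ Finset.range (n - (j + 1)), Ξ (u (j + 1 + i)) (u (j + 1 + (i + 1))) := by
      conv_lhs => rw [show n = j + 1 + (n - (j + 1)) by omega, Finset.sum_range_add,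
        Finset.sum_range_succ]
      simp only [add_assoc]
    rw [split]
    have alg : ∑ i ∈ Finset.range j, Ξ (u i) (u (i + 1)) + Ξ (u j) (u (j + 1)) +
          ∑ i ∈ Finset.range (n - (j + 1)), Ξ (u (j + 1 + i)) (u (j + 1 + (i + 1))) -
            Ξ (u 0) (u n) =
        (∑ i ∈ Finset.range j, Ξ (u i) (u (i + 1)) - Ξ (u 0) (u j)) +
        (∑ i ∈ Finset.range (n - (j + 1)), Ξ (u (j + 1 + i)) (u (j + 1 + (i + 1))) -
          Ξ (u (j + 1)) (u n)) - (Ξ (u 0) (u n) - Ξ (u 0) (u j) - Ξ (u j) (u n)) -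
          (Ξ (u j) (u n) - Ξ (u j) (u (j + 1)) - Ξ (u (j + 1)) (u n)) := by abel
    rw [alg]
    refine (norm_sub_le _ _).trans ((add_le_add ((norm_sub_le _ _).trans (add_le_add
      ((norm_add_le _ _).trans (add_le_add e1 e2)) e3)) e4).trans ?_)
    have hCK : 0 ≤ sewConst p * K := mul_nonneg hC hK
    calc sewConst p * K * ω (u 0) (u j) ^ 3 + sewConst p * K * ω (u (j + 1)) (u n) ^ 3 +
          K * ω (u 0) (u n) ^ 3 + K * ω (u j) (u n) ^ 3
        ≤ sewConst p * K * (2 ^ (1 - 3 / p) / 2 * ω (u 0) (u n) ^ 3) +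
          sewConst p * K * (2 ^ (1 - 3 / p) / 2 * ω (u 0) (u n) ^ 3) +
          K * ω (u 0) (u n) ^ 3 + K * ω (u 0) (u n) ^ 3 := by gcongr
      _ = (sewConst p * 2 ^ (1 - 3 / p) + 2) * K * ω (u 0) (u n) ^ 3 := by ring
      _ = _ := by rw [hCeq]

/-- The increments of the limit of the Riemann sums are close to the germ. -/
lemma norm_incr_sub_le_of_hasSewing (hp : 0 < p) (hp' : p < 3) {s t : ℝ}
    {ω : ℝ → ℝ → ℝ} (hω : IsRoughControl p s t ω) {K : ℝ} (hK : 0 ≤ K) {Ξ : ℝ → ℝ → E}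
    (hΞ : AlmostAdditive s t ω K Ξ) (has : a ≤ s) (hst : s ≤ t) {I J : E}
    (hI : HasSewing Ξ a s I) (hJ : HasSewing Ξ a t J) :
    ‖J - I - Ξ s t‖ ≤ sewConst p * K * ω s t ^ 3 := by
  refine le_of_forall_pos_le_add fun ε hε => ?_
  obtain ⟨δ1, hδ1, H1⟩ := hI (ε / 2) (by positivity)
  obtain ⟨δ2, hδ2, H2⟩ := hJ (ε / 2) (by positivity)
  obtain ⟨P, hP⟩ := exists_partition_meshLT has (lt_min hδ1 hδ2)
  obtain ⟨Q, hQ⟩ := exists_partition_meshLT hst (lt_min hδ1 hδ2)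
  obtain ⟨R, hR, hRS⟩ := P.exists_concat Q
  have e1 := H1 P fun i => (hP i).trans_le (min_le_left _ _)
  have e2 := H2 R fun i => (hR _ hP hQ i).trans_le (min_le_right _ _)
  rw [hRS] at e2
  obtain ⟨u, um, u0, u1, uab, -, -, uS⟩ := Q.exists_seq
  have e3 := norm_sum_sub_le_of_almostAdditive hp hp' hω hK hΞ Q.size u um
    (fun i => (uab i).1) (fun i => (uab i).2)
  rw [← uS, u0, u1] at e3
  have alg : J - I - Ξ s t = (Q.sum Ξ - Ξ s t) - (P.sum Ξ + Q.sum Ξ - J) + (P.sum Ξ - I) := by abel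
  rw [alg]
  refine (norm_add_le _ _).trans ((add_le_add_left (norm_sub_le _ _) _).trans ?_)
  linarith

end

/-! ### Existence of the sewing limit -/

section

open Filter Topology

variable {p T : ℝ} {ω : ℝ → ℝ → ℝ} {E : Type} [NormedAddCommGroup E]

/-- Write `ω ^ 3 = (ω ^ p) ^ (3/p - 1) ω ^ p`: the first factor is at most `e ^ (3/p - 1)` and the
second is summable by superadditivity. As `3/p - 1 > 0`, sums of cubes vanish as the mesh shrinks.
-/
lemma sum_cube_le (hp : 0 < p) (hp' : p < 3) (hω : IsRoughControl p 0 T ω) {e : ℝ} (he : 0 ≤ e)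
    {u : ℕ → ℝ} (um : Monotone u) (ua : ∀ i, 0 ≤ u i) (ub : ∀ i, u i ≤ T) (n : ℕ)
    (hu : ∀ i < n, ω (u i) (u (i + 1)) ^ p ≤ e) :
    ∑ i ∈ Finset.range n, ω (u i) (u (i + 1)) ^ 3 ≤ e ^ (3 / p - 1) * ω 0 T ^ p := by
  have h3p : 0 < 3 / p - 1 := by
    have : 1 < 3 / p := (one_lt_div hp).2 hp'
    linarith
  have h0 : 0 ≤ e ^ (3 / p - 1) := by positivity
  calc ∑ i ∈ Finset.range n, ω (u i) (u (i + 1)) ^ 3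
      ≤ ∑ i ∈ Finset.range n, e ^ (3 / p - 1) * ω (u i) (u (i + 1)) ^ p := by
        refine Finset.sum_le_sum fun i hi => ?_
        have h := hω.nonneg _ _ (ua i) (um i.le_succ) (ub _)
        rcases h.eq_or_lt with h' | h'
        · rw [← h', Real.zero_rpow hp.ne']
          simp
        · have : ω (u i) (u (i + 1)) ^ 3 =
              (ω (u i) (u (i + 1)) ^ p) ^ (3 / p - 1) * ω (u i) (u (i + 1)) ^ p := by
            rw [← Real.rpow_mul h, ← Real.rpow_add h', mul_sub, mul_div_cancel₀ _ hp.ne']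
            norm_num
          rw [this]
          gcongr
          exact hu i (Finset.mem_range.1 hi)
    _ = e ^ (3 / p - 1) * ∑ i ∈ Finset.range n, ω (u i) (u (i + 1)) ^ p := by
        rw [Finset.mul_sum]
    _ ≤ e ^ (3 / p - 1) * ω 0 T ^ p := by
        gcongr
        exact (hω.control.sum_le um ua ub n).trans
          (hω.control.mono le_rfl (ua 0) (um (Nat.zero_le n)) (ub n) le_rfl)

/-- Existence of the limit of the Riemann sums. -/
lemma exists_hasSewing [NormedSpace ℝ E] [FiniteDimensional ℝ E] (hp : 0 < p) (hp' : p < 3)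
    (hT : 0 ≤ T) (hω : IsRoughControl p 0 T ω) (hreg : IsRegularOn 0 T (fun s t => ω s t ^ p))
    {K : ℝ} (hK : 0 ≤ K) {Ξ : ℝ → ℝ → E} (hΞ : AlmostAdditive 0 T ω K Ξ) :
    ∃ I : ℝ → E, ∀ t ∈ Set.Icc 0 T, HasSewing Ξ 0 t (I t) := by
  have h3p : 0 < 3 / p - 1 := by
    have : 1 < 3 / p := (one_lt_div hp).2 hp'
    linarith
  have hC := (sewConst_spec hp hp').1
  have hdiag : ∀ s, 0 ≤ s → s ≤ T → Ξ s s = 0 := by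
    intro s h1 h2
    have := hΞ s s s h1 le_rfl le_rfl h2
    rw [hω.diag hp h1 h2] at this
    simpa using this
  -- grids
  set g : ℕ → ℕ → ℝ := fun n i => min T (i * (T / n)) with hg
  have gm : ∀ n, Monotone (g n) := by
    intro n i j hij
    simp only [hg]
    gcongr
  have g0 : ∀ n, g n 0 = 0 := by intro n; simp [hg, hT]
  have gn : ∀ n, 0 < n → g n n = T := by
    intro n hn
    have : (0 : ℝ) < n := by exact_mod_cast hn
    simp only [hg]
    rw [mul_div_cancel₀ _ this.ne', min_self]
  have gstep : ∀ n i, g n (i + 1) - g n i ≤ T / n := by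
    intro n i
    have : 0 ≤ T / n := by positivity
    simp only [hg]
    push_cast
    rcases le_total T (i * (T / n)) with h | h
    · rw [min_eq_left h]
      linarith [min_le_left T ((i + 1) * (T / (n : ℝ)))]
    · rw [min_eq_right h]
      linarith [min_le_right T ((i + 1) * (T / (n : ℝ)))]
  have g0' : ∀ n i, 0 ≤ g n i := fun n i => g0 n ▸ gm n (Nat.zero_le i)
  have gT : ∀ n i, g n i ≤ T := fun n i => min_le_left _ _
  -- Sums over one grid of `[0, T]`, stopped at `t`, so that sums for different `t` share their
  -- cells and can be subtracted.
  set S : ℕ → ℝ → E := fun n t =>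
    ∑ i ∈ Finset.range n, Ξ (min t (g n i)) (min t (g n (i + 1))) with hS
  have tm : ∀ n t, Monotone fun i => min t (g n i) := fun n t i j h => min_le_min_left _ (gm n h)
  have t0 : ∀ n t i, 0 ≤ t → 0 ≤ min t (g n i) := fun n t i h => le_min h (g0' n i)
  have tT : ∀ n t i, min t (g n i) ≤ T := fun n t i => (min_le_right _ _).trans (gT n i)
  -- boundedness
  have Sbound : ∀ n t, 0 < n → 0 ≤ t → t ≤ T →
      ‖S n t - Ξ 0 t‖ ≤ sewConst p * K * ω 0 t ^ 3 := by
    intro n t hn h1 h2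
    have := norm_sum_sub_le_of_almostAdditive hp hp' hω hK hΞ n (fun i => min t (g n i)) (tm n t)
      (fun i => t0 n t i h1) (fun i => tT n t i)
    simpa only [g0, gn n hn, min_eq_left h2, min_eq_right h1] using this
  -- Only boundedness of the sums is known here. In finite dimension it gives a limit along a
  -- nonprincipal ultrafilter, the same one for every `t`; the true limit over all partitions is
  -- identified afterwards.
  have lim : ∀ t, ∃ I, t ∈ Set.Icc 0 T → Tendsto (fun n => S n t) (hyperfilter ℕ) (𝓝 I) := by
    intro t
    by_cases ht : t ∈ Set.Icc 0 T
    · have : ProperSpace E := FiniteDimensional.proper ℝ E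
      obtain ⟨I, -, hI⟩ := (isCompact_closedBall (Ξ 0 t)
        (sewConst p * K * ω 0 t ^ 3)).ultrafilter_le_nhds'
          ((hyperfilter ℕ : Ultrafilter ℕ).map fun n => S n t) (by
            have : ∀ᶠ n in (hyperfilter ℕ : Filter ℕ), 0 < n :=
              Nat.hyperfilter_le_atTop (eventually_gt_atTop 0)
            rw [Ultrafilter.mem_map]
            filter_upwards [this] with n hn
            rw [Set.mem_preimage, mem_closedBall_iff_norm]
            exact Sbound n t hn ht.1 ht.2)
      exact ⟨I, fun _ => hI⟩
    · exact ⟨0, fun h => absurd h ht⟩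
  choose I hI using lim
  -- almost additivity of the sums
  have Sadd : ∀ e > 0, ∀ᶠ n in (atTop : Filter ℕ), ∀ s t, 0 ≤ s → s ≤ t → t ≤ T →
      ‖S n t - S n s - Ξ s t‖ ≤
        sewConst p * K * ω s t ^ 3 + K * (e ^ (3 / p - 1) * ω 0 T ^ p) := by
    intro e he
    obtain ⟨δ, hδ, H⟩ := hreg e he
    have hlim : ∀ᶠ n : ℕ in atTop, T / n < δ :=
      (tendsto_const_div_atTop_nhds_zero_nat T).eventually (gt_mem_nhds hδ)
    filter_upwards [hlim, eventually_gt_atTop 0] with n hn hn0 s t h1 h2 h3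
    have e1 := norm_sum_sub_le_of_almostAdditive hp hp' hω hK hΞ n
      (fun i => max s (min t (g n i)))
      (fun i j h => max_le_max_left _ (tm n t h)) (fun i => h1.trans (le_max_left _ _))
      (fun i => max_le (h2.trans h3) (tT n t i))
    simp only [g0, gn n hn0, min_eq_left h3, min_eq_right (h1.trans h2), max_eq_left h1,
      max_eq_right h2] at e1
    have e2 : ‖S n t - S n s - ∑ i ∈ Finset.range n,
        Ξ (max s (min t (g n i))) (max s (min t (g n (i + 1))))‖ ≤
          K * (e ^ (3 / p - 1) * ω 0 T ^ p) := by
      simp only [hS]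
      rw [← Finset.sum_sub_distrib, ← Finset.sum_sub_distrib]
      -- Cells to the left of `s` cancel, cells to the right contribute a degenerate `Ξ s s = 0`,
      -- and a cell containing `s` leaves one defect of additivity.
      have hcell : ∀ i ∈ Finset.range n,
          ‖Ξ (min t (g n i)) (min t (g n (i + 1))) - Ξ (min s (g n i)) (min s (g n (i + 1))) -
            Ξ (max s (min t (g n i))) (max s (min t (g n (i + 1))))‖ ≤
          K * ω (min t (g n i)) (min t (g n (i + 1))) ^ 3 := by
        intro i _
        have hle := gm n i.le_succ
        have hpos : 0 ≤ K * ω (min t (g n i)) (min t (g n (i + 1))) ^ 3 :=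
          mul_nonneg hK (pow_nonneg (hω.nonneg _ _ (t0 n t i (h1.trans h2)) (tm n t i.le_succ)
            (tT n t _)) 3)
        rcases le_total (g n (i + 1)) s with h | h
        · have h' := hle.trans h
          rw [min_eq_right (h.trans h2), min_eq_right (h'.trans h2), min_eq_right h,
            min_eq_right h', max_eq_left h, max_eq_left h', hdiag s h1 (h2.trans h3)]
          rw [min_eq_right (h.trans h2), min_eq_right (h'.trans h2)] at hpos
          simpa using hpos
        rcases le_total s (g n i) with h' | h'
        · rw [min_eq_left h, min_eq_left h', hdiag s h1 (h2.trans h3),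
            max_eq_right (le_min h2 h'), max_eq_right (le_min h2 h)]
          simpa using hpos
        · have e3 := hΞ (min t (g n i)) s (min t (g n (i + 1))) (t0 n t i (h1.trans h2))
            ((min_le_right _ _).trans h') (le_min h2 h) (tT n t _)
          rw [min_eq_left h, min_eq_right h', max_eq_left ((min_le_right _ _).trans h'),
            max_eq_right (le_min h2 h)]
          rwa [min_eq_right (h'.trans h2)] at e3 ⊢
      refine (norm_sum_le_of_le _ hcell).trans ?_
      rw [← Finset.mul_sum]
      refine mul_le_mul_of_nonneg_left ?_ hK
      refine sum_cube_le hp hp' hω he.le (tm n t) (fun i => t0 n t i (h1.trans h2))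
        (fun i => tT n t i) n fun i _ => ?_
      refine (H _ _ (t0 n t i (h1.trans h2)) (tm n t i.le_succ) (tT n t _) ?_).le
      refine lt_of_le_of_lt ?_ hn
      refine le_trans ?_ (gstep n i)
      have : g n i ≤ g n (i + 1) := gm n i.le_succ
      change min t (g n (i + 1)) - min t (g n i) ≤ _
      rcases le_total t (g n (i + 1)) with h | h
      · rw [min_eq_left h]
        rcases le_total t (g n i) with h' | h'
        · rw [min_eq_left h']; linarith
        · rw [min_eq_right h']; linarith
      · rw [min_eq_right h, min_eq_right (this.trans h)]
    have alg : S n t - S n s - Ξ s t = (∑ i ∈ Finset.range n,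
        Ξ (max s (min t (g n i))) (max s (min t (g n (i + 1)))) - Ξ s t) +
        (S n t - S n s - ∑ i ∈ Finset.range n,
          Ξ (max s (min t (g n i))) (max s (min t (g n (i + 1))))) := by abel
    rw [alg]
    exact (norm_add_le _ _).trans (add_le_add e1 e2)
  -- passage to the limit
  have Iadd : ∀ s t, 0 ≤ s → s ≤ t → t ≤ T →
      ‖I t - I s - Ξ s t‖ ≤ sewConst p * K * ω s t ^ 3 := by
    intro s t h1 h2 h3
    have hlim : Tendsto (fun n => ‖S n t - S n s - Ξ s t‖) (hyperfilter ℕ)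
        (𝓝 ‖I t - I s - Ξ s t‖) :=
      (((hI t ⟨h1.trans h2, h3⟩).sub (hI s ⟨h1, h2.trans h3⟩)).sub tendsto_const_nhds).norm
    have hbd : ∀ e > 0, ‖I t - I s - Ξ s t‖ ≤
        sewConst p * K * ω s t ^ 3 + K * (e ^ (3 / p - 1) * ω 0 T ^ p) := by
      intro e he
      refine le_of_tendsto hlim (Nat.hyperfilter_le_atTop ?_)
      filter_upwards [Sadd e he] with n hn
      exact hn s t h1 h2 h3
    have hlim2 : Tendsto (fun e : ℝ => sewConst p * K * ω s t ^ 3 +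
        K * (e ^ (3 / p - 1) * ω 0 T ^ p)) (𝓝[>] 0) (𝓝 (sewConst p * K * ω s t ^ 3 +
          K * ((0 : ℝ) ^ (3 / p - 1) * ω 0 T ^ p))) := by
      refine Tendsto.mono_left ?_ nhdsWithin_le_nhds
      have : Tendsto (fun e : ℝ => e ^ (3 / p - 1)) (𝓝 0) (𝓝 ((0 : ℝ) ^ (3 / p - 1))) :=
        (Real.continuousAt_rpow_const _ _ (Or.inr h3p.le)).tendsto
      exact tendsto_const_nhds.add (tendsto_const_nhds.mul (this.mul tendsto_const_nhds))
    rw [Real.zero_rpow h3p.ne', zero_mul, mul_zero, add_zero] at hlim2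
    exact ge_of_tendsto hlim2 (by filter_upwards [self_mem_nhdsWithin] with e he using hbd e he)
  have I0 : I 0 = 0 := by
    have : ∀ n, S n 0 = 0 := by
      intro n
      simp only [hS]
      refine Finset.sum_eq_zero fun i _ => ?_
      rw [min_eq_left (g0' n i), min_eq_left (g0' n (i + 1)), hdiag 0 le_rfl hT]
    have h := hI 0 ⟨le_rfl, hT⟩
    simp only [this] at h
    exact tendsto_nhds_unique h tendsto_const_nhds
  refine ⟨I, fun t ht ε hε => ?_⟩
  have hCK : 0 ≤ sewConst p * K := mul_nonneg hC hK
  -- choose the mesh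
  obtain ⟨e, he, hee⟩ : ∃ e > 0, sewConst p * K * (e ^ (3 / p - 1) * ω 0 T ^ p) < ε := by
    have hlim2 : Tendsto (fun e : ℝ => sewConst p * K * (e ^ (3 / p - 1) * ω 0 T ^ p)) (𝓝[>] 0)
        (𝓝 (sewConst p * K * ((0 : ℝ) ^ (3 / p - 1) * ω 0 T ^ p))) := by
      refine Tendsto.mono_left ?_ nhdsWithin_le_nhds
      have : Tendsto (fun e : ℝ => e ^ (3 / p - 1)) (𝓝 0) (𝓝 ((0 : ℝ) ^ (3 / p - 1))) :=
        (Real.continuousAt_rpow_const _ _ (Or.inr h3p.le)).tendsto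
      exact tendsto_const_nhds.mul (this.mul tendsto_const_nhds)
    rw [Real.zero_rpow h3p.ne', zero_mul, mul_zero] at hlim2
    obtain ⟨e, h1, h2⟩ := ((hlim2.eventually (gt_mem_nhds hε)).and self_mem_nhdsWithin).exists
    exact ⟨e, h2, h1⟩
  obtain ⟨δ, hδ, H⟩ := hreg e he
  refine ⟨δ, hδ, fun P hP => ?_⟩
  obtain ⟨u, um, u0, u1, uab, -, uM, uS⟩ := P.exists_seq
  rw [uM] at hP
  rw [uS]
  -- The increments of `I` agree with the germ up to third order, so telescoping reduces convergence
  -- over arbitrary partitions to `sum_cube_le`.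
  have tel : I t = ∑ i ∈ Finset.range P.size, (I (u (i + 1)) - I (u i)) := by
    rw [Finset.sum_range_sub (fun i => I (u i)), u0, u1, I0, sub_zero]
  rw [tel, ← Finset.sum_sub_distrib]
  have term : ∀ i ∈ Finset.range P.size, ‖Ξ (u i) (u (i + 1)) - (I (u (i + 1)) - I (u i))‖ ≤
      sewConst p * K * ω (u i) (u (i + 1)) ^ 3 := by
    intro i _
    rw [norm_sub_rev]
    exact Iadd _ _ (uab i).1 (um i.le_succ) ((uab _).2.trans ht.2)
  refine lt_of_le_of_lt ((norm_sum_le_of_le _ term).trans ?_) hee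
  rw [← Finset.mul_sum]
  refine mul_le_mul_of_nonneg_left ?_ hCK
  exact sum_cube_le hp hp' hω he.le um (fun i => (uab i).1) (fun i => (uab i).2.trans ht.2) _
    fun i hi => (H _ _ (uab i).1 (um i.le_succ) ((uab _).2.trans ht.2) (hP i hi)).le

end

/-! ### Smooth functions -/

section

variable {E F G H : Type} [NormedAddCommGroup E] [NormedSpace ℝ E] [NormedAddCommGroup F]
  [NormedSpace ℝ F] [NormedAddCommGroup G] [NormedSpace ℝ G] [NormedAddCommGroup H]
  [NormedSpace ℝ H]

/-- Bounded Lipschitz functions whose increments are Lipschitz in the base point. -/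
structure FourPoint (K : ℝ) (f : E → F) : Prop where
  nonneg : 0 ≤ K
  bound : ∀ z, ‖f z‖ ≤ K
  lip : ∀ z w, ‖f z - f w‖ ≤ K * ‖z - w‖
  four : ∀ z z' w w', ‖(f z' - f z) - (f w' - f w)‖ ≤
    K * (‖(z' - z) - (w' - w)‖ + ‖z' - z‖ * ‖z - w‖)

/-- Bounds for the first order Taylor remainder. -/
structure TaylorBound (K : ℝ) (f : E → F) (f' : E → E →L[ℝ] F) : Prop where
  rem : ∀ z h, ‖f (z + h) - f z - f' z h‖ ≤ K * ‖h‖ ^ 2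
  diff : ∀ z w h k, ‖(f (z + h) - f z - f' z h) - (f (w + k) - f w - f' w k)‖ ≤
    K * (‖h‖ ^ 2 * ‖z - w‖ + (‖h‖ + ‖k‖) * ‖h - k‖)

lemma FourPoint.mono {K K' : ℝ} {f : E → F} (h : FourPoint K f) (hK : K ≤ K') :
    FourPoint K' f :=
  ⟨h.nonneg.trans hK, fun z => (h.bound z).trans hK,
    fun z w => (h.lip z w).trans (mul_le_mul_of_nonneg_right hK (norm_nonneg _)),
    fun z z' w w' => (h.four z z' w w').trans (mul_le_mul_of_nonneg_right hK (by positivity))⟩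

lemma TaylorBound.mono {K K' : ℝ} {f : E → F} {f' : E → E →L[ℝ] F} (h : TaylorBound K f f')
    (hK : K ≤ K') : TaylorBound K' f f' :=
  ⟨fun z w => (h.rem z w).trans (mul_le_mul_of_nonneg_right hK (by positivity)),
    fun z z' w w' => (h.diff z z' w w').trans (mul_le_mul_of_nonneg_right hK (by positivity))⟩

lemma norm_sub_le_of_hasFDerivAt {K : ℝ} {f : E → F} {f' : E → E →L[ℝ] F}
    (hf : ∀ z, HasFDerivAt f (f' z) z) (hK : ∀ z, ‖f' z‖ ≤ K) (z w : E) :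
    ‖f z - f w‖ ≤ K * ‖z - w‖ :=
  convex_univ.norm_image_sub_le_of_norm_hasFDerivWithin_le
    (fun x _ => (hf x).hasFDerivWithinAt) (fun x _ => hK x) (Set.mem_univ w) (Set.mem_univ z)

lemma hasDerivAt_line {f : E → F} {f' : E → E →L[ℝ] F} (hf : ∀ z, HasFDerivAt f (f' z) z)
    (z h : E) (τ : ℝ) : HasDerivAt (fun τ : ℝ => f (z + τ • h)) (f' (z + τ • h) h) τ := by
  have h1 : HasDerivAt (fun τ : ℝ => z + τ • h) h τ := by
    simpa using ((hasDerivAt_id τ).smul_const h).const_add z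
  exact (hf _).comp_hasDerivAt τ h1

/-- Transport the increment `z' - z` to the base point `w`. Increments over parallel segments differ
by the mean value inequality for the base point, since `f'` is Lipschitz; what remains is the
distance from `w + (z' - z)` to `w'`, controlled by the Lipschitz bound of `f`. -/
lemma fourPoint_of_hasFDerivAt {K : ℝ} {f : E → F} {f' : E → E →L[ℝ] F} (h0 : 0 ≤ K)
    (hf : ∀ z, HasFDerivAt f (f' z) z) (hK : ∀ z, ‖f z‖ ≤ K) (hK' : ∀ z, ‖f' z‖ ≤ K)
    (hlip : ∀ z w, ‖f' z - f' w‖ ≤ K * ‖z - w‖) : FourPoint K f := by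
  have hfl := norm_sub_le_of_hasFDerivAt hf hK'
  refine ⟨h0, hK, hfl, fun z z' w w' => ?_⟩
  have e1 : ‖(f (z + (z' - z)) - f z) - (f (w + (z' - z)) - f w)‖ ≤
      K * ‖z' - z‖ * ‖z - w‖ := by
    have := norm_image_sub_le_of_norm_deriv_le_segment_01'
      (f := fun τ : ℝ => f ((w + (z' - z)) + τ • (z - w)) - f (w + τ • (z - w)))
      (f' := fun τ : ℝ => f' ((w + (z' - z)) + τ • (z - w)) (z - w) - f' (w + τ • (z - w)) (z - w))
      (C := K * ‖z' - z‖ * ‖z - w‖)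
      (fun τ _ => ((hasDerivAt_line hf _ _ τ).sub (hasDerivAt_line hf _ _ τ)).hasDerivWithinAt)
      (fun τ _ => by
        rw [← sub_apply]
        refine (ContinuousLinearMap.le_opNorm _ _).trans ?_
        refine mul_le_mul_of_nonneg_right ((hlip _ _).trans_eq ?_) (norm_nonneg _)
        congr 2; abel)
    simp only [one_smul, zero_smul, add_zero, add_sub_cancel,
      show w + (z' - z) + (z - w) = z' by abel] at this
    rw [add_sub_cancel]
    refine le_trans (le_of_eq ?_) this
    congr 1
  have e2 := hfl (w + (z' - z)) w'
  have alg : (f z' - f z) - (f w' - f w) =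
      ((f (z + (z' - z)) - f z) - (f (w + (z' - z)) - f w)) + (f (w + (z' - z)) - f w') := by
    rw [add_sub_cancel]; abel
  rw [alg]
  refine (norm_add_le _ _).trans ((add_le_add e1 e2).trans_eq ?_)
  rw [show w + (z' - z) - w' = (z' - z) - (w' - w) by abel]
  ring

/-- Mean value inequality for `τ ↦ f (z + τ k) - τ f' z k` on `[0, 1]`: its derivative is an
increment of `f'`, and for the difference of two such functions a second difference of `f'`, which
the four-point inequality controls. -/
lemma taylorBound_of_fourPoint {K : ℝ} {f : E → F} {f' : E → E →L[ℝ] F}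
    (hf : ∀ z, HasFDerivAt f (f' z) z) (h : FourPoint K f') : TaylorBound K f f' := by
  have hτ : ∀ τ ∈ Set.Ico (0 : ℝ) 1, ∀ h : E, ‖τ • h‖ ≤ ‖h‖ := by
    intro τ hτ h
    rw [norm_smul, Real.norm_of_nonneg hτ.1]
    exact mul_le_of_le_one_left (norm_nonneg _) hτ.2.le
  have hlin : ∀ (v : F) (τ : ℝ), HasDerivAt (fun τ : ℝ => τ • v) v τ := by
    intro v τ
    simpa using (hasDerivAt_id τ).smul_const v
  have hK := h.nonneg
  constructor
  · intro z k
    have := norm_image_sub_le_of_norm_deriv_le_segment_01'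
      (f := fun τ : ℝ => f (z + τ • k) - τ • f' z k)
      (f' := fun τ : ℝ => f' (z + τ • k) k - f' z k) (C := K * ‖k‖ ^ 2)
      (fun τ _ => ((hasDerivAt_line hf _ _ τ).sub (hlin _ τ)).hasDerivWithinAt)
      (fun τ ht => by
        rw [← sub_apply]
        refine (ContinuousLinearMap.le_opNorm _ _).trans ?_
        have := h.lip (z + τ • k) z
        rw [add_sub_cancel_left] at this
        calc _ ≤ K * ‖k‖ * ‖k‖ := by
              refine mul_le_mul_of_nonneg_right (this.trans ?_) (norm_nonneg _)
              exact mul_le_mul_of_nonneg_left (hτ τ ht k) hK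
          _ = _ := by ring)
    refine le_trans (le_of_eq ?_) this
    simp only [one_smul, zero_smul, add_zero, sub_zero]
    congr 1
    abel
  · intro z w k l
    have := norm_image_sub_le_of_norm_deriv_le_segment_01'
      (f := fun τ : ℝ => f (z + τ • k) - τ • f' z k - (f (w + τ • l) - τ • f' w l))
      (f' := fun τ : ℝ => f' (z + τ • k) k - f' z k - (f' (w + τ • l) l - f' w l))
      (C := K * (‖k‖ ^ 2 * ‖z - w‖ + (‖k‖ + ‖l‖) * ‖k - l‖))
      (fun τ _ => (((hasDerivAt_line hf _ _ τ).sub (hlin _ τ)).sub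
        ((hasDerivAt_line hf _ _ τ).sub (hlin _ τ))).hasDerivWithinAt)
      (fun τ ht => by
        have alg : f' (z + τ • k) k - f' z k - (f' (w + τ • l) l - f' w l) =
            ((f' (z + τ • k) - f' z) - (f' (w + τ • l) - f' w)) k +
              (f' (w + τ • l) - f' w) (k - l) := by
          simp only [sub_apply, map_sub]
          abel
        rw [alg]
        have e1 := h.four z (z + τ • k) w (w + τ • l)
        have e2 := h.lip (w + τ • l) w
        rw [add_sub_cancel_left, add_sub_cancel_left, ← smul_sub] at e1
        rw [add_sub_cancel_left] at e2
        have e3 := hτ τ ht (k - l)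
        have e4 := hτ τ ht k
        have e5 := hτ τ ht l
        calc _ ≤ (K * (‖k - l‖ + ‖k‖ * ‖z - w‖)) * ‖k‖ + (K * ‖l‖) * ‖k - l‖ := by
              refine (norm_add_le _ _).trans (add_le_add ?_ ?_)
              · refine (ContinuousLinearMap.le_opNorm _ _).trans ?_
                refine mul_le_mul_of_nonneg_right (e1.trans ?_) (norm_nonneg _)
                gcongr
              · refine (ContinuousLinearMap.le_opNorm _ _).trans ?_
                refine mul_le_mul_of_nonneg_right (e2.trans ?_) (norm_nonneg _)
                gcongr
          _ = _ := by ring)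
    refine le_trans (le_of_eq ?_) this
    simp only [one_smul, zero_smul, add_zero, sub_zero]
    congr 1
    abel

lemma FourPoint.clm_comp {K K' : ℝ} {A : E → G →L[ℝ] H} {B : E → F →L[ℝ] G}
    (hA : FourPoint K A) (hB : FourPoint K' B) :
    FourPoint (8 * (K * K')) (fun z => (A z).comp (B z)) := by
  have h0 := hA.nonneg
  have h0' := hB.nonneg
  have hKK : 0 ≤ K * K' := mul_nonneg h0 h0'
  have mul2 : ∀ (S : G →L[ℝ] H) (R : F →L[ℝ] G) {x y : ℝ}, ‖S‖ ≤ x → ‖R‖ ≤ y → 0 ≤ x →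
      ‖S.comp R‖ ≤ x * y := fun S R x y h1 h2 h3 =>
    (S.opNorm_comp_le R).trans (mul_le_mul h1 h2 (norm_nonneg _) h3)
  refine ⟨by positivity, fun z => ?_, fun z w => ?_, fun z z' w w' => ?_⟩
  · exact (mul2 _ _ (hA.bound z) (hB.bound z) h0).trans (by linarith)
  · have alg : (A z).comp (B z) - (A w).comp (B w) =
        (A z - A w).comp (B z) + (A w).comp (B z - B w) := by
      simp only [ContinuousLinearMap.sub_comp, ContinuousLinearMap.comp_sub]; abel
    rw [alg]
    refine (norm_add_le _ _).trans ((add_le_add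
      (mul2 _ _ (hA.lip z w) (hB.bound z) (by positivity))
      (mul2 _ _ (hA.bound w) (hB.lip z w) h0)).trans ?_)
    have : 0 ≤ K * K' * ‖z - w‖ := by positivity
    linarith
  · set D := ‖(z' - z) - (w' - w)‖ + ‖z' - z‖ * ‖z - w‖ with hD
    have hD0 : 0 ≤ D := by positivity
    have hDz : ‖z' - z‖ * ‖z - w‖ ≤ D := by rw [hD]; linarith [norm_nonneg ((z' - z) - (w' - w))]
    -- The third and fourth terms together are `(A w' - A w) ∘ (B z - B w)`. Splitting it produces
    -- the admissible product `‖z' - z‖ ‖z - w‖` instead of one with `‖w' - w‖`. The six terms have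
    -- weights 1, 2, 1, 2, 1, 1, whence the constant 8.
    have alg : (A z').comp (B z') - (A z).comp (B z) - ((A w').comp (B w') - (A w).comp (B w)) =
        ((A z' - A z) - (A w' - A w)).comp (B z') +
        (A w' - A w).comp ((B z' - B z) - (B w' - B w)) +
        (A z' - A z).comp (B z - B w) -
        ((A z' - A z) - (A w' - A w)).comp (B z - B w) +
        (A z - A w).comp (B z' - B z) +
        (A w).comp ((B z' - B z) - (B w' - B w)) := by
      simp only [ContinuousLinearMap.sub_comp, ContinuousLinearMap.comp_sub]; abel
    rw [alg]
    have a1 := hA.four z z' w w'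
    have b1 := hB.four z z' w w'
    rw [← hD] at a1 b1
    have a2 : ‖A w' - A w‖ ≤ 2 * K :=
      (norm_sub_le _ _).trans (by linarith [hA.bound w', hA.bound w])
    have b2 : ‖B z - B w‖ ≤ 2 * K' :=
      (norm_sub_le _ _).trans (by linarith [hB.bound z, hB.bound w])
    have t1 := mul2 _ _ a1 (hB.bound z') (by positivity)
    have t2 := mul2 _ _ a2 b1 (by positivity)
    have t3 := mul2 _ _ (hA.lip z' z) (hB.lip z w) (by positivity)
    have t4 := mul2 _ _ a1 b2 (by positivity)
    have t5 := mul2 _ _ (hA.lip z w) (hB.lip z' z) (by positivity)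
    have t6 := mul2 _ _ (hA.bound w) b1 h0
    refine (norm_add_le _ _).trans ((add_le_add ((norm_add_le _ _).trans (add_le_add
      ((norm_sub_le _ _).trans (add_le_add ((norm_add_le _ _).trans (add_le_add
        ((norm_add_le _ _).trans (add_le_add t1 t2)) t3)) t4)) t5)) t6).trans ?_)
    have : K * K' * (‖z' - z‖ * ‖z - w‖) ≤ K * K' * D := mul_le_mul_of_nonneg_left hDz hKK
    linarith

-- All three derivatives are used: the four-point bound for `fderiv ℝ f`, and with it the comparison
-- of Taylor remainders, needs the second derivative to be Lipschitz.
set_option maxSynthPendingDepth 4 in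
lemma IsCb.exists_bounds {f : E → F} (hf : IsCb 3 f) :
    ∃ K : ℝ, 0 ≤ K ∧ FourPoint K f ∧ FourPoint K (fderiv ℝ f) ∧ TaylorBound K f (fderiv ℝ f) := by
  obtain ⟨hc, K, hK⟩ := hf
  have hc : ContDiff ℝ 3 f := by exact_mod_cast hc
  have c1 : ContDiff ℝ 2 (fderiv ℝ f) := hc.fderiv_right (by norm_num)
  have c2 : ContDiff ℝ 1 (fderiv ℝ (fderiv ℝ f)) := c1.fderiv_right (by norm_num)
  have d0 : ∀ z, HasFDerivAt f (fderiv ℝ f z) z := fun z =>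
    (hc.differentiable (by norm_num) z).hasFDerivAt
  have d1 : ∀ z, HasFDerivAt (fderiv ℝ f) (fderiv ℝ (fderiv ℝ f) z) z := fun z =>
    (c1.differentiable (by norm_num) z).hasFDerivAt
  have d2 : ∀ z, HasFDerivAt (fderiv ℝ (fderiv ℝ f)) (fderiv ℝ (fderiv ℝ (fderiv ℝ f)) z) z :=
    fun z => (c2.differentiable (by norm_num) z).hasFDerivAt
  have b0 : ∀ z, ‖f z‖ ≤ K := fun z => by simpa using hK 0 (by norm_num) z
  have b1 : ∀ z, ‖fderiv ℝ f z‖ ≤ K := fun z => by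
    rw [← norm_iteratedFDeriv_one]
    exact hK 1 (by norm_num) z
  have b2 : ∀ z, ‖fderiv ℝ (fderiv ℝ f) z‖ ≤ K := fun z => by
    rw [← norm_iteratedFDeriv_one, norm_iteratedFDeriv_fderiv]
    exact hK 2 (by norm_num) z
  have b3 : ∀ z, ‖fderiv ℝ (fderiv ℝ (fderiv ℝ f)) z‖ ≤ K := fun z => by
    rw [← norm_iteratedFDeriv_one, norm_iteratedFDeriv_fderiv, norm_iteratedFDeriv_fderiv]
    exact hK 3 le_rfl z
  have hK0 : 0 ≤ K := (norm_nonneg _).trans (b0 0)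
  have F0 := fourPoint_of_hasFDerivAt hK0 d0 b0 b1 (norm_sub_le_of_hasFDerivAt d1 b2)
  have F1 := fourPoint_of_hasFDerivAt hK0 d1 b1 b2 (norm_sub_le_of_hasFDerivAt d2 b3)
  exact ⟨K, hK0, F0, F1, taylorBound_of_fourPoint d0 F1⟩

end

/-! ### The action on tensors -/

section

variable {d n : ℕ} {E : Type} [NormedAddCommGroup E] [NormedSpace ℝ E]

lemma tensorApply_tmul (A : Euc d →L[ℝ] Euc d →L[ℝ] E) (u v : Euc d) :
    tensorApply A (u ⊗ₜ[ℝ] v) = A u v := by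
  simp [tensorApply]

lemma tensorApply_sub (A B : Euc d →L[ℝ] Euc d →L[ℝ] E) (v : Euc d ⊗[ℝ] Euc d) :
    tensorApply (A - B) v = tensorApply A v - tensorApply B v := by
  induction v using TensorProduct.induction_on with
  | zero => simp
  | tmul x y => simp [tensorApply_tmul]
  | add x y hx hy => rw [map_add, hx, hy, map_add, map_add]; abel

/-- Expand in the product orthonormal basis; each of the `d * d` terms is at most `‖A‖ ‖v‖`. The
crude dimensional constant is harmless. -/
lemma norm_tensorApply_le (A : Euc d →L[ℝ] Euc d →L[ℝ] E) (v : Euc d ⊗[ℝ] Euc d) :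
    ‖tensorApply A v‖ ≤ (d * d : ℝ) * (‖A‖ * ‖v‖) := by
  set e := (EuclideanSpace.basisFun (Fin d) ℝ).tensorProduct (EuclideanSpace.basisFun (Fin d) ℝ)
  rw [← e.sum_repr v, map_sum, e.sum_repr v]
  have hterm : ∀ i ∈ (Finset.univ : Finset (Fin d × Fin d)),
      ‖tensorApply A (e.repr v i • e i)‖ ≤ ‖A‖ * ‖v‖ := by
    intro i _
    rw [map_smul, norm_smul, OrthonormalBasis.tensorProduct_apply', tensorApply_tmul]
    have h1 : ‖e.repr v i‖ ≤ ‖v‖ := by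
      rw [← e.repr.norm_map v]
      exact PiLp.norm_apply_le _ i
    have h2 := A.le_opNorm₂ (EuclideanSpace.basisFun (Fin d) ℝ i.1)
      (EuclideanSpace.basisFun (Fin d) ℝ i.2)
    rw [OrthonormalBasis.norm_eq_one, OrthonormalBasis.norm_eq_one, mul_one, mul_one] at h2
    rw [mul_comm ‖A‖]
    exact mul_le_mul h1 h2 (norm_nonneg _) (norm_nonneg _)
  refine (norm_sum_le_of_le _ hterm).trans_eq ?_
  simp

end

/-! ### Germs of rough integrals -/

section

variable {p T : ℝ} {d : ℕ} {E : Type} [NormedAddCommGroup E] [NormedSpace ℝ E]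

/-- The germ `Z_s ζ_{s,t} + Z'_s ζ⁽²⁾_{s,t}` of the rough integral. -/
noncomputable def germ (ζ : RoughPath p T d) (Z : ℝ → Euc d →L[ℝ] E)
    (Z' : ℝ → Euc d →L[ℝ] Euc d →L[ℝ] E) (s t : ℝ) : E :=
  Z s (incr ζ.path s t) + tensorApply (Z' s) (ζ.area s t)

/-- Chen's relation: the cross term `ζ_{s,u} ⊗ ζ_{u,t}` supplies exactly the first-order part of the
increment of `Z`, so only its remainder survives. -/
lemma germ_defect (ζ : RoughPath p T d) (Z : ℝ → Euc d →L[ℝ] E)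
    (Z' : ℝ → Euc d →L[ℝ] Euc d →L[ℝ] E) {s u t : ℝ} (h0 : 0 ≤ s) (h1 : s ≤ u) (h2 : u ≤ t)
    (h3 : t ≤ T) :
    germ ζ Z Z' s t - germ ζ Z Z' s u - germ ζ Z Z' u t =
      -(remainder ζ Z Z' s u (incr ζ.path u t) + tensorApply (incr Z' s u) (ζ.area u t)) := by
  have e1 : incr ζ.path s t = incr ζ.path s u + incr ζ.path u t := by simp [incr]
  have e2 : incr Z s u = Z u - Z s := rfl
  have e3 : incr Z' s u = Z' u - Z' s := rfl
  simp only [germ, ζ.chen s u t h0 h1 h2 h3, map_add, tensorApply_tmul, remainder, e1, e2, e3,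
    tensorApply_sub, sub_apply]
  abel

lemma norm_clm_sub_le {F G : Type} [NormedAddCommGroup F] [NormedSpace ℝ F]
    [NormedAddCommGroup G] [NormedSpace ℝ G] (A B : F →L[ℝ] G) (u v : F) :
    ‖A u - B v‖ ≤ ‖A - B‖ * ‖u‖ + ‖B‖ * ‖u - v‖ := by
  have : A u - B v = (A - B) u + B (u - v) := by simp
  rw [this]
  exact (norm_add_le _ _).trans (add_le_add (ContinuousLinearMap.le_opNorm _ _)
    (ContinuousLinearMap.le_opNorm _ _))

lemma norm_tensorApply_sub_le (A B : Euc d →L[ℝ] Euc d →L[ℝ] E) (u v : Euc d ⊗[ℝ] Euc d) :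
    ‖tensorApply A u - tensorApply B v‖ ≤
      (d * d : ℝ) * (‖A - B‖ * ‖u‖ + ‖B‖ * ‖u - v‖) := by
  have : tensorApply A u - tensorApply B v = tensorApply (A - B) u + tensorApply B (u - v) := by
    rw [tensorApply_sub, map_sub]; abel
  rw [this, mul_add]
  exact (norm_add_le _ _).trans (add_le_add (norm_tensorApply_le _ _) (norm_tensorApply_le _ _))

variable {a b : ℝ} {ω : ℝ → ℝ → ℝ}

lemma almostAdditive_germ (hp : 0 < p) (hω : IsRoughControl p a b ω) (ha : 0 ≤ a) (hb : b ≤ T)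
    (ζ : RoughPath p T d) {Z : ℝ → Euc d →L[ℝ] E} {Z' : ℝ → Euc d →L[ℝ] Euc d →L[ℝ] E}
    {A Λ : ℝ} (hA : 0 ≤ A) (hΛ : 0 ≤ Λ) (h1 : BoundedBy a b ω 1 Λ (incr ζ.path))
    (h2 : BoundedBy a b ω 2 Λ ζ.area) (hR : BoundedBy a b ω 2 A (remainder ζ Z Z'))
    (hZ : BoundedBy a b ω 1 A (incr Z')) :
    AlmostAdditive a b ω (A * Λ * (1 + d * d)) (germ ζ Z Z') := by
  intro s u t has hsu hut htb
  rw [germ_defect ζ Z Z' (ha.trans has) hsu hut (htb.trans hb), norm_neg]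
  have m1 := hω.mono hp has le_rfl hsu hut htb
  have m2 := hω.mono hp has hsu hut le_rfl htb
  have n1 := hω.nonneg s u has hsu (hut.trans htb)
  have n2 := hω.nonneg u t (has.trans hsu) hut htb
  have b1 := hR s u has hsu (hut.trans htb)
  have b2 := h1 u t (has.trans hsu) hut htb
  have b3 := hZ s u has hsu (hut.trans htb)
  have b4 := h2 u t (has.trans hsu) hut htb
  rw [pow_one] at b2 b3
  have n3 : 0 ≤ ω s t := n1.trans m1
  calc _ ≤ ‖remainder ζ Z Z' s u‖ * ‖incr ζ.path u t‖ +
        (d * d : ℝ) * (‖incr Z' s u‖ * ‖ζ.area u t‖) :=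
        (norm_add_le _ _).trans (add_le_add (ContinuousLinearMap.le_opNorm _ _)
          (norm_tensorApply_le _ _))
    _ ≤ (A * ω s t ^ 2) * (Λ * ω s t) + (d * d : ℝ) * ((A * ω s t) * (Λ * ω s t ^ 2)) := by
        have b1' : ‖remainder ζ Z Z' s u‖ ≤ A * ω s t ^ 2 := b1.trans (by gcongr)
        have b2' : ‖incr ζ.path u t‖ ≤ Λ * ω s t := b2.trans (by gcongr)
        have b3' : ‖incr Z' s u‖ ≤ A * ω s t := b3.trans (by gcongr)
        have b4' : ‖ζ.area u t‖ ≤ Λ * ω s t ^ 2 := b4.trans (by gcongr)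
        gcongr
    _ = _ := by ring

/-- The defects of the two germs are differences of products. Each is split as (difference) × (bound
for `η`) + (bound for `W`) × (difference), so the result is linear in the differences `A'` and `N`.
-/
lemma almostAdditive_germ_sub (hp : 0 < p) (hω : IsRoughControl p a b ω) (ha : 0 ≤ a) (hb : b ≤ T)
    (η ζ : RoughPath p T d) {Z W : ℝ → Euc d →L[ℝ] E} {Z' W' : ℝ → Euc d →L[ℝ] Euc d →L[ℝ] E}
    {A Λ N A' : ℝ} (hA : 0 ≤ A) (hA' : 0 ≤ A') (hΛ : 0 ≤ Λ) (hN : 0 ≤ N)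
    (h1 : BoundedBy a b ω 1 Λ (incr η.path)) (h2 : BoundedBy a b ω 2 Λ η.area)
    (h1' : BoundedBy a b ω 1 N (fun s t => incr η.path s t - incr ζ.path s t))
    (h2' : BoundedBy a b ω 2 N (fun s t => η.area s t - ζ.area s t))
    (hR : BoundedBy a b ω 2 A (remainder ζ W W')) (hZ : BoundedBy a b ω 1 A (incr W'))
    (hR' : BoundedBy a b ω 2 A' (fun s t => remainder η Z Z' s t - remainder ζ W W' s t))
    (hZ' : BoundedBy a b ω 1 A' (fun s t => incr Z' s t - incr W' s t)) :
    AlmostAdditive a b ω ((A' * Λ + A * N) * (1 + d * d))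
      (fun s t => germ η Z Z' s t - germ ζ W W' s t) := by
  intro s u t has hsu hut htb
  have alg : germ η Z Z' s t - germ ζ W W' s t - (germ η Z Z' s u - germ ζ W W' s u) -
      (germ η Z Z' u t - germ ζ W W' u t) =
      (germ η Z Z' s t - germ η Z Z' s u - germ η Z Z' u t) -
      (germ ζ W W' s t - germ ζ W W' s u - germ ζ W W' u t) := by abel
  rw [alg, germ_defect η Z Z' (ha.trans has) hsu hut (htb.trans hb),
    germ_defect ζ W W' (ha.trans has) hsu hut (htb.trans hb)]
  have alg2 : -(remainder η Z Z' s u (incr η.path u t) + tensorApply (incr Z' s u) (η.area u t)) -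
      -(remainder ζ W W' s u (incr ζ.path u t) + tensorApply (incr W' s u) (ζ.area u t)) =
      -((remainder η Z Z' s u (incr η.path u t) - remainder ζ W W' s u (incr ζ.path u t)) +
        (tensorApply (incr Z' s u) (η.area u t) - tensorApply (incr W' s u) (ζ.area u t))) := by
    abel
  rw [alg2, norm_neg]
  have m1 := hω.mono hp has le_rfl hsu hut htb
  have m2 := hω.mono hp has hsu hut le_rfl htb
  have n1 := hω.nonneg s u has hsu (hut.trans htb)
  have n2 := hω.nonneg u t (has.trans hsu) hut htb
  have n3 : 0 ≤ ω s t := n1.trans m1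
  have b1 : ‖remainder ζ W W' s u‖ ≤ A * ω s t ^ 2 :=
    (hR s u has hsu (hut.trans htb)).trans (by gcongr)
  have b2 : ‖incr η.path u t‖ ≤ Λ * ω s t :=
    (h1 u t (has.trans hsu) hut htb).trans (by rw [pow_one]; gcongr)
  have b3 : ‖incr W' s u‖ ≤ A * ω s t :=
    (hZ s u has hsu (hut.trans htb)).trans (by rw [pow_one]; gcongr)
  have b4 : ‖η.area u t‖ ≤ Λ * ω s t ^ 2 :=
    (h2 u t (has.trans hsu) hut htb).trans (by gcongr)
  have c1 : ‖remainder η Z Z' s u - remainder ζ W W' s u‖ ≤ A' * ω s t ^ 2 :=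
    (hR' s u has hsu (hut.trans htb)).trans (by gcongr)
  have c2 : ‖incr η.path u t - incr ζ.path u t‖ ≤ N * ω s t :=
    (h1' u t (has.trans hsu) hut htb).trans (by rw [pow_one]; gcongr)
  have c3 : ‖incr Z' s u - incr W' s u‖ ≤ A' * ω s t :=
    (hZ' s u has hsu (hut.trans htb)).trans (by rw [pow_one]; gcongr)
  have c4 : ‖η.area u t - ζ.area u t‖ ≤ N * ω s t ^ 2 :=
    (h2' u t (has.trans hsu) hut htb).trans (by gcongr)
  calc _ ≤ (‖remainder η Z Z' s u - remainder ζ W W' s u‖ * ‖incr η.path u t‖ +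
          ‖remainder ζ W W' s u‖ * ‖incr η.path u t - incr ζ.path u t‖) +
        (d * d : ℝ) * (‖incr Z' s u - incr W' s u‖ * ‖η.area u t‖ +
          ‖incr W' s u‖ * ‖η.area u t - ζ.area u t‖) :=
        (norm_add_le _ _).trans (add_le_add (norm_clm_sub_le _ _ _ _)
          (norm_tensorApply_sub_le _ _ _ _))
    _ ≤ ((A' * ω s t ^ 2) * (Λ * ω s t) + (A * ω s t ^ 2) * (N * ω s t)) +
        (d * d : ℝ) * ((A' * ω s t) * (Λ * ω s t ^ 2) + (A * ω s t) * (N * ω s t ^ 2)) := by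
        gcongr
    _ = _ := by ring

end

/-! ### Controlled equations -/

section

variable {p T : ℝ} {m k d n : ℕ}

/-- The function `D_x ψ σ`. -/
noncomputable def derivAlong {G : Type} [NormedAddCommGroup G] [NormedSpace ℝ G]
    (ψ : Euc m × Euc k → G) (σ : Euc m × Euc k → Euc d →L[ℝ] Euc m) (z : Euc m × Euc k) :
    Euc d →L[ℝ] G :=
  (fderiv ℝ ψ z).comp ((ContinuousLinearMap.inl ℝ (Euc m) (Euc k)).comp (σ z))

/-- Bounds on the coefficient `σ` of an equation and on the integrand `ψ`. -/
structure CoeffBound (Λ : ℝ) (σ : Euc m × Euc k → Euc d →L[ℝ] Euc m)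
    (ψ : Euc m × Euc k → Euc d →L[ℝ] Euc n) : Prop where
  coeff : FourPoint Λ σ
  fn : FourPoint Λ ψ
  fn_deriv : FourPoint Λ (fderiv ℝ ψ)
  taylor : TaylorBound Λ ψ (fderiv ℝ ψ)
  along : FourPoint Λ (derivAlong ψ σ)
  diff : Differentiable ℝ ψ

lemma CoeffBound.mono {Λ Λ' : ℝ} {σ : Euc m × Euc k → Euc d →L[ℝ] Euc m}
    {ψ : Euc m × Euc k → Euc d →L[ℝ] Euc n} (h : CoeffBound Λ σ ψ) (hΛ : Λ ≤ Λ') :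
    CoeffBound Λ' σ ψ :=
  ⟨h.coeff.mono hΛ, h.fn.mono hΛ, h.fn_deriv.mono hΛ, h.taylor.mono hΛ, h.along.mono hΛ, h.diff⟩

lemma exists_coeffBound {σ : Euc m × Euc k → Euc d →L[ℝ] Euc m} (hσ : IsCb 3 σ)
    {ψ : Euc m × Euc k → Euc d →L[ℝ] Euc n} (hψ : IsCb 3 ψ) : ∃ Λ, CoeffBound Λ σ ψ := by
  obtain ⟨K, hK, s1, -, -⟩ := hσ.exists_bounds
  obtain ⟨K', hK', f1, f2, f3⟩ := hψ.exists_bounds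
  have inl_le : ∀ A : Euc d →L[ℝ] Euc m,
      ‖(ContinuousLinearMap.inl ℝ (Euc m) (Euc k)).comp A‖ ≤ ‖A‖ := fun A =>
    (ContinuousLinearMap.opNorm_comp_le _ _).trans
      (mul_le_of_le_one_left (norm_nonneg _) (ContinuousLinearMap.norm_inl_le_one ℝ _ _))
  have s2 : FourPoint K
      (fun z => (ContinuousLinearMap.inl ℝ (Euc m) (Euc k)).comp (σ z)) := by
    refine ⟨hK, fun z => (inl_le _).trans (s1.bound z), fun z w => ?_, fun z z' w w' => ?_⟩
    · rw [← ContinuousLinearMap.comp_sub]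
      exact (inl_le _).trans (s1.lip z w)
    · rw [← ContinuousLinearMap.comp_sub, ← ContinuousLinearMap.comp_sub,
        ← ContinuousLinearMap.comp_sub]
      exact (inl_le _).trans (s1.four z z' w w')
  have s3 := f2.clm_comp s2
  have hd : Differentiable ℝ ψ := hψ.1.differentiable (by norm_num)
  have hKK : 0 ≤ 8 * (K' * K) := by positivity
  refine ⟨K + K' + 8 * (K' * K), s1.mono (by linarith), f1.mono (by linarith),
    f2.mono (by linarith), f3.mono (by linarith), s3.mono (by linarith), hd⟩

/-- Bounds, in terms of `ω`, on the data of an equation with coefficient `σ` on `[a, b]`. -/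
structure DataBound (Λ : ℝ) (σ : Euc m × Euc k → Euc d →L[ℝ] Euc m) (ζ : RoughPath p T d)
    (γ : ℝ → Euc k) (X : ℝ → Euc m) (X' : ℝ → Euc d →L[ℝ] Euc m) (a b : ℝ) (ω : ℝ → ℝ → ℝ) :
    Prop where
  p_pos : 0 < p
  one_le : 1 ≤ Λ
  rough : IsRoughControl p a b ω
  left : 0 ≤ a
  right : b ≤ T
  le : ∀ s t, a ≤ s → s ≤ t → t ≤ b → ω s t ≤ Λ
  length : ∀ s t, a ≤ s → s ≤ t → t ≤ b → t - s ≤ Λ * ω s t ^ 2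
  path : BoundedBy a b ω 1 Λ (incr ζ.path)
  area : BoundedBy a b ω 2 Λ ζ.area
  control : BoundedBy a b ω 2 Λ (incr γ)
  deriv : ∀ t, a ≤ t → t ≤ b → X' t = σ (X t, γ t)

variable {Λ : ℝ} {σ : Euc m × Euc k → Euc d →L[ℝ] Euc m} {ψ : Euc m × Euc k → Euc d →L[ℝ] Euc n}
  {ζ : RoughPath p T d} {γ : ℝ → Euc k} {X : ℝ → Euc m} {X' : ℝ → Euc d →L[ℝ] Euc m}
  {a b : ℝ} {ω : ℝ → ℝ → ℝ}

lemma DataBound.restrict (h : DataBound Λ σ ζ γ X X' a b ω) {a' b' : ℝ} (ha : a ≤ a')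
    (hb : b' ≤ b) : DataBound Λ σ ζ γ X X' a' b' ω :=
  ⟨h.p_pos, h.one_le, h.rough.restrict ha hb, h.left.trans ha, hb.trans h.right,
    fun s t h1 h2 h3 => h.le s t (ha.trans h1) h2 (h3.trans hb),
    fun s t h1 h2 h3 => h.length s t (ha.trans h1) h2 (h3.trans hb),
    h.path.restrict ha hb, h.area.restrict ha hb, h.control.restrict ha hb,
    fun t h1 h2 => h.deriv t (ha.trans h1) (h2.trans hb)⟩

lemma DataBound.mono (h : DataBound Λ σ ζ γ X X' a b ω) {Λ' : ℝ} (hΛ : Λ ≤ Λ') :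
    DataBound Λ' σ ζ γ X X' a b ω :=
  ⟨h.p_pos, h.one_le.trans hΛ, h.rough, h.left, h.right,
    fun s t h1 h2 h3 => (h.le s t h1 h2 h3).trans hΛ,
    fun s t h1 h2 h3 => (h.length s t h1 h2 h3).trans
      (mul_le_mul_of_nonneg_right hΛ (by positivity)),
    h.path.mono_const h.rough hΛ, h.area.mono_const h.rough hΛ, h.control.mono_const h.rough hΛ,
    h.deriv⟩

/-- As `X' = σ(X, γ)`, the Gubinelli derivative is a fixed function of `(X, γ)`. Its increments, and
the differences of these along two solutions, then follow from the regularity of that function, with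
no separate estimate for `X'`. -/
lemma compDeriv_eq (hψ : Differentiable ℝ ψ) (h : DataBound Λ σ ζ γ X X' a b ω) {t : ℝ}
    (h1 : a ≤ t) (h2 : t ≤ b) : compDeriv ψ X X' γ t = derivAlong ψ σ (X t, γ t) := by
  have e : HasFDerivAt (fun x => ψ (x, γ t))
      ((fderiv ℝ ψ (X t, γ t)).comp (ContinuousLinearMap.inl ℝ (Euc m) (Euc k))) (X t) :=
    (hψ (X t, γ t)).hasFDerivAt.comp (X t) (hasFDerivAt_prodMk_left (X t) (γ t))
  unfold compDeriv derivAlong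
  rw [e.fderiv, h.deriv t h1 h2]
  rfl

lemma norm_pair_le {E F : Type} [NormedAddCommGroup E] [NormedAddCommGroup F] (x : E) (y : F) :
    ‖(x, y)‖ ≤ ‖x‖ + ‖y‖ :=
  max_le (by linarith [norm_nonneg y]) (by linarith [norm_nonneg x])

/-- The increment of a path is controlled through its remainder. -/
lemma incr_boundedBy (hσ : FourPoint Λ σ) (h : DataBound Λ σ ζ γ X X' a b ω) {B : ℝ} (hB : 0 ≤ B)
    (hR : BoundedBy a b ω 2 B (remainder ζ X X')) :
    BoundedBy a b ω 1 (Λ ^ 2 + B * Λ) (incr X) := by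
  intro s t h1 h2 h3
  have hΛ : 0 ≤ Λ := by linarith [h.one_le]
  have n0 := h.rough.nonneg s t h1 h2 h3
  have alg : incr X s t = X' s (incr ζ.path s t) + remainder ζ X X' s t := by simp [remainder]
  rw [alg, h.deriv s h1 (h2.trans h3), pow_one]
  have e1 := h.path s t h1 h2 h3
  rw [pow_one] at e1
  calc _ ≤ Λ * (Λ * ω s t) + B * ω s t ^ 2 := by
        refine (norm_add_le _ _).trans (add_le_add ?_ (hR s t h1 h2 h3))
        exact (ContinuousLinearMap.le_opNorm _ _).trans
          (mul_le_mul (hσ.bound _) e1 (norm_nonneg _) hΛ)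
    _ ≤ Λ * (Λ * ω s t) + B * (Λ * ω s t) := by
        gcongr
        rw [pow_two]
        exact mul_le_mul_of_nonneg_right (h.le s t h1 h2 h3) n0
    _ = _ := by ring

lemma incr_pair_boundedBy (hσ : FourPoint Λ σ) (h : DataBound Λ σ ζ γ X X' a b ω) {B : ℝ}
    (hB : 0 ≤ B) (hR : BoundedBy a b ω 2 B (remainder ζ X X')) :
    BoundedBy a b ω 1 (2 * Λ ^ 2 + B * Λ) (incr fun t => (X t, γ t)) := by
  intro s t h1 h2 h3
  have hΛ : 0 ≤ Λ := by linarith [h.one_le]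
  have n0 := h.rough.nonneg s t h1 h2 h3
  have e1 := incr_boundedBy hσ h hB hR s t h1 h2 h3
  have e2 := h.control s t h1 h2 h3
  have e3 : ω s t ^ 2 ≤ Λ * ω s t := by
    rw [pow_two]
    exact mul_le_mul_of_nonneg_right (h.le s t h1 h2 h3) n0
  rw [pow_one] at e1 ⊢
  calc ‖incr (fun t => (X t, γ t)) s t‖ ≤ ‖incr X s t‖ + ‖incr γ s t‖ := norm_pair_le _ _
    _ ≤ (Λ ^ 2 + B * Λ) * ω s t + Λ * (Λ * ω s t) := by
        refine add_le_add e1 (e2.trans ?_)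
        gcongr
    _ = _ := by ring

/-- The increment of the pair `(X, γ)` minus its first order part. -/
lemma pair_defect (h : DataBound Λ σ ζ γ X X' a b ω) {s t : ℝ} (h1 : a ≤ s) (h2 : s ≤ t)
    (h3 : t ≤ b) :
    incr (fun t => (X t, γ t)) s t -
      (ContinuousLinearMap.inl ℝ (Euc m) (Euc k)) (σ (X s, γ s) (incr ζ.path s t)) =
        (remainder ζ X X' s t, incr γ s t) := by
  simp [incr, remainder, h.deriv s h1 (h2.trans h3)]

/-- The constant in the estimates for the composition of a solution with a function. -/
noncomputable def compConst (Λ B : ℝ) : ℝ := 2 * Λ ^ 5 * (1 + B)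

/-- Taylor's formula is applied only to the step `v = (X'_s ζ_{s,t}, 0)`, whose size does not
involve `B`; the rest `(R^X, γ_{s,t})` is treated by the Lipschitz bound. The constant is therefore
affine in `B`, whereas expanding along the whole increment would give `B²` and spoil the iteration
from an arbitrary initial `B`. -/
lemma remainder_comp_boundedBy (hψ : CoeffBound Λ σ ψ) (h : DataBound Λ σ ζ γ X X' a b ω) {B : ℝ}
    (hB : 0 ≤ B) (hR : BoundedBy a b ω 2 B (remainder ζ X X')) :
    BoundedBy a b ω 2 (compConst Λ B)
      (remainder ζ (comp ψ X γ) (compDeriv ψ X X' γ)) := by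
  intro s t h1 h2 h3
  have hΛ1 := h.one_le
  have hΛ : 0 ≤ Λ := by linarith
  have n0 := h.rough.nonneg s t h1 h2 h3
  set v : Euc m × Euc k :=
    (ContinuousLinearMap.inl ℝ (Euc m) (Euc k)) (σ (X s, γ s) (incr ζ.path s t)) with hv
  have hv2 : ‖v‖ ≤ Λ * (Λ * ω s t) := by
    have e1 := h.path s t h1 h2 h3
    rw [pow_one] at e1
    have : ‖v‖ ≤ ‖σ (X s, γ s) (incr ζ.path s t)‖ := by
      rw [hv]
      refine (norm_pair_le _ _).trans ?_
      simp
    exact this.trans ((ContinuousLinearMap.le_opNorm _ _).trans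
      (mul_le_mul (hψ.coeff.bound _) e1 (norm_nonneg _) hΛ))
  have alg : remainder ζ (comp ψ X γ) (compDeriv ψ X X' γ) s t =
      (ψ (X t, γ t) - ψ ((X s, γ s) + v)) +
        (ψ ((X s, γ s) + v) - ψ (X s, γ s) - fderiv ℝ ψ (X s, γ s) v) := by
    simp only [remainder, compDeriv_eq hψ.diff h h1 (h2.trans h3), incr, comp, derivAlong]
    simp only [ContinuousLinearMap.comp_apply, hv]
    simp only [incr]
    abel
  have e1 := hψ.fn.lip (X t, γ t) ((X s, γ s) + v)
  have e2 := hψ.taylor.rem (X s, γ s) v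
  have e3 : ‖(X t, γ t) - ((X s, γ s) + v)‖ ≤ B * ω s t ^ 2 + Λ * ω s t ^ 2 := by
    have := pair_defect h h1 h2 h3
    rw [← hv] at this
    rw [← sub_sub]
    change ‖incr (fun t => (X t, γ t)) s t - v‖ ≤ _
    rw [this]
    exact (norm_pair_le _ _).trans (add_le_add (hR s t h1 h2 h3) (h.control s t h1 h2 h3))
  rw [alg]
  have p1 : Λ ≤ Λ ^ 5 := le_self_pow₀ hΛ1 (by norm_num)
  have p2 : Λ ^ 2 ≤ Λ ^ 5 := pow_le_pow_right₀ hΛ1 (by norm_num)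
  calc _ ≤ Λ * (B * ω s t ^ 2 + Λ * ω s t ^ 2) + Λ * (Λ * (Λ * ω s t)) ^ 2 := by
        refine (norm_add_le _ _).trans (add_le_add (e1.trans ?_) (e2.trans ?_))
        · gcongr
        · gcongr
    _ = (Λ * B + Λ ^ 2 + Λ ^ 5) * ω s t ^ 2 := by ring
    _ ≤ (Λ ^ 5 * B + Λ ^ 5 + Λ ^ 5) * ω s t ^ 2 := by gcongr
    _ ≤ _ := by
        refine mul_le_mul_of_nonneg_right ?_ (by positivity)
        unfold compConst
        have : 0 ≤ Λ ^ 5 * B := by positivity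
        linarith

lemma incr_compDeriv_boundedBy (hψ : CoeffBound Λ σ ψ) (h : DataBound Λ σ ζ γ X X' a b ω) {B : ℝ}
    (hB : 0 ≤ B) (hR : BoundedBy a b ω 2 B (remainder ζ X X')) :
    BoundedBy a b ω 1 (compConst Λ B) (incr (compDeriv ψ X X' γ)) := by
  intro s t h1 h2 h3
  have hΛ1 := h.one_le
  have hΛ : 0 ≤ Λ := by linarith
  have n0 := h.rough.nonneg s t h1 h2 h3
  have e1 := incr_pair_boundedBy hψ.coeff h hB hR s t h1 h2 h3
  have e2 := hψ.along.lip (X t, γ t) (X s, γ s)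
  unfold incr
  rw [compDeriv_eq hψ.diff h h1 (h2.trans h3), compDeriv_eq hψ.diff h (h1.trans h2) h3]
  refine (e2.trans (mul_le_mul_of_nonneg_left e1 hΛ)).trans ?_
  rw [pow_one, ← mul_assoc]
  refine mul_le_mul_of_nonneg_right ?_ n0
  have p1 : Λ ^ 3 ≤ Λ ^ 5 := pow_le_pow_right₀ hΛ1 (by norm_num)
  have p2 : Λ ^ 2 * B ≤ Λ ^ 5 * B :=
    mul_le_mul_of_nonneg_right (pow_le_pow_right₀ hΛ1 (by norm_num)) hB
  have p3 : 0 ≤ Λ ^ 5 * B := by positivity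
  unfold compConst
  linarith

/-- The constant in the sewing bound of the germ of the integral of `ψ(X, γ)`. -/
noncomputable def germConst (d : ℕ) (Λ B : ℝ) : ℝ := compConst Λ B * Λ * (1 + d * d)

lemma almostAdditive_comp (hψ : CoeffBound Λ σ ψ) (h : DataBound Λ σ ζ γ X X' a b ω) {B : ℝ}
    (hB : 0 ≤ B) (hR : BoundedBy a b ω 2 B (remainder ζ X X')) :
    AlmostAdditive a b ω (germConst d Λ B) (germ ζ (comp ψ X γ) (compDeriv ψ X X' γ)) := by
  have hΛ : 0 ≤ Λ := by linarith [h.one_le]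
  exact almostAdditive_germ h.p_pos h.rough h.left h.right ζ (by unfold compConst; positivity) hΛ
    h.path h.area
    (remainder_comp_boundedBy hψ h hB hR) (incr_compDeriv_boundedBy hψ h hB hR)

lemma norm_compDeriv_le (hψ : CoeffBound Λ σ ψ) (h : DataBound Λ σ ζ γ X X' a b ω) {t : ℝ}
    (h1 : a ≤ t) (h2 : t ≤ b) : ‖compDeriv ψ X X' γ t‖ ≤ Λ := by
  rw [compDeriv_eq hψ.diff h h1 h2]
  exact hψ.along.bound _

/-- Iterating an estimate that halves the dependence on the previous bound. -/
lemma BoundedBy.bootstrap {E : Type} [NormedAddCommGroup E] {j : ℕ} {A : ℝ → ℝ → E} {C B₀ : ℝ}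
    (hω : IsRoughControl p a b ω) (hC : 0 ≤ C) (hB₀ : 0 ≤ B₀) (h0 : BoundedBy a b ω j B₀ A)
    (hstep : ∀ B, 0 ≤ B → BoundedBy a b ω j B A → BoundedBy a b ω j (C + B / 2) A) :
    BoundedBy a b ω j (2 * C) A := by
  -- The map `B ↦ C + B / 2` contracts to `2 C`, so the influence of `B₀` disappears in the limit.
  have key : ∀ i : ℕ, ∃ B, 0 ≤ B ∧ B ≤ 2 * C + B₀ * (1 / 2) ^ i ∧ BoundedBy a b ω j B A := by
    intro i
    induction i with
    | zero => exact ⟨B₀, hB₀, by simp; linarith, h0⟩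
    | succ i ih =>
      obtain ⟨B, e1, e2, e3⟩ := ih
      refine ⟨C + B / 2, by positivity, ?_, hstep B e1 e3⟩
      rw [pow_succ]
      linarith
  intro s t h1 h2 h3
  have hlim : Filter.Tendsto (fun i : ℕ => (2 * C + B₀ * (1 / 2 : ℝ) ^ i) * ω s t ^ j)
      Filter.atTop (nhds ((2 * C + B₀ * 0) * ω s t ^ j)) :=
    ((tendsto_pow_atTop_nhds_zero_of_lt_one (by norm_num) (by norm_num)).const_mul _
      |>.const_add _).mul_const _
  rw [mul_zero, add_zero] at hlim
  refine ge_of_tendsto' hlim fun i => ?_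
  obtain ⟨B, -, e2, e3⟩ := key i
  exact e3.mono_const hω e2 s t h1 h2 h3

end

/-! ### A priori bounds for solutions -/

section

open MeasureTheory

variable {p T : ℝ} {m k d n : ℕ} {Λ : ℝ} {f : Euc m × Euc k → Euc m}
  {σ : Euc m × Euc k → Euc d →L[ℝ] Euc m} {ψ : Euc m × Euc k → Euc d →L[ℝ] Euc n}
  {ζ : RoughPath p T d} {γ : ℝ → Euc k} {x : Euc m} {X : ℝ → Euc m} {X' : ℝ → Euc d →L[ℝ] Euc m}
  {a b : ℝ} {ω : ℝ → ℝ → ℝ}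

/-- The equation at time `0`: the partition of `[0, 0]` without subintervals has sum zero. -/
lemma IsRDESolution.initial (hT : 0 ≤ T) (h : IsRDESolution f σ ζ γ x X X') : X 0 = x := by
  have h0 := h.equation 0 ⟨le_rfl, hT⟩
  rw [intervalIntegral.integral_same, sub_zero] at h0
  have : ‖X 0 - x‖ ≤ 0 := by
    refine le_of_forall_pos_le_add fun ε hε => ?_
    obtain ⟨δ, -, H⟩ := h0 ε hε
    obtain ⟨P, hP, hPs⟩ := exists_partition_of_seq (a := 0) (b := 0) (fun _ => (0 : ℝ)) 0 rfl rfl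
      (by simp)
    have := H P ((hP δ).2 (by simp))
    rw [hPs] at this
    simp only [Finset.range_zero, Finset.sum_empty, zero_sub, norm_neg] at this
    linarith
  rwa [norm_le_zero_iff, sub_eq_zero] at this

lemma IsRDESolution.intervalIntegrable (hf : Continuous f) (hγ : ContinuousOn γ (Set.Icc 0 T))
    (h : IsRDESolution f σ ζ γ x X X') {s t : ℝ} (hs : s ∈ Set.Icc 0 T) (ht : t ∈ Set.Icc 0 T) :
    IntervalIntegrable (fun s => f (X s, γ s)) volume s t := by
  have hc : ContinuousOn (fun s => f (X s, γ s)) (Set.Icc 0 T) :=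
    hf.comp_continuousOn (h.controlled.path_var.continuousOn.prodMk hγ)
  exact (hc.mono (Set.uIcc_subset_Icc hs ht)).intervalIntegrable

/-- The drift part of an equation. -/
noncomputable def drift (f : Euc m × Euc k → Euc m) (γ : ℝ → Euc k) (X : ℝ → Euc m) (s t : ℝ) :
    Euc m :=
  ∫ r in s..t, f (X r, γ r)

/-- The remainder of a solution, in terms of the drift and the rough integral. -/
lemma IsRDESolution.remainder_eq (hf : Continuous f) (hγ : ContinuousOn γ (Set.Icc 0 T))
    (h : IsRDESolution f σ ζ γ x X X') {s t : ℝ} (h1 : 0 ≤ s) (h2 : s ≤ t) (h3 : t ≤ T) :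
    ∃ I J, HasSewing (germ ζ (comp σ X γ) (compDeriv σ X X' γ)) 0 s I ∧
      HasSewing (germ ζ (comp σ X γ) (compDeriv σ X X' γ)) 0 t J ∧
      remainder ζ X X' s t = drift f γ X s t +
        (J - I - germ ζ (comp σ X γ) (compDeriv σ X X' γ) s t) +
        tensorApply (compDeriv σ X X' γ s) (ζ.area s t) := by
  have hs : s ∈ Set.Icc 0 T := ⟨h1, h2.trans h3⟩
  have ht : t ∈ Set.Icc 0 T := ⟨h1.trans h2, h3⟩
  have h0 : (0 : ℝ) ∈ Set.Icc 0 T := ⟨le_rfl, h1.trans (h2.trans h3)⟩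
  -- `HasRoughIntegral` unfolds to `HasSewing` of the germ, so the equation at `s` and at `t`
  -- provides both limits.
  refine ⟨_, _, h.equation s hs, h.equation t ht, ?_⟩
  have e := intervalIntegral.integral_interval_sub_left
    (h.intervalIntegrable hf hγ h0 ht) (h.intervalIntegrable hf hγ h0 hs)
  unfold drift
  rw [← e, germ, comp, remainder, h.deriv_eq s hs, incr]
  abel

/-- The contraction step of the a priori estimate for the remainder. -/
lemma remainder_improve (hp' : p < 3) (hf : Continuous f) (hfb : ∀ z, ‖f z‖ ≤ Λ)
    (hγ : ContinuousOn γ (Set.Icc 0 T)) (hσ : CoeffBound Λ σ σ)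
    (hsol : IsRDESolution f σ ζ γ x X X') (h : DataBound Λ σ ζ γ X X' a b ω) {ε : ℝ}
    (hε : ∀ s t, a ≤ s → s ≤ t → t ≤ b → ω s t ≤ ε)
    (hε' : sewConst p * (2 * Λ ^ 5 * Λ * (1 + d * d)) * ε ≤ 1 / 2) {B : ℝ}
    (hB : 0 ≤ B) (hR : BoundedBy a b ω 2 B (remainder ζ X X')) :
    BoundedBy a b ω 2 ((Λ ^ 2 * (1 + d * d) + 1 / 2) + B / 2) (remainder ζ X X') := by
  intro s t h1 h2 h3
  have hΛ : 0 ≤ Λ := by linarith [h.one_le]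
  have n0 := h.rough.nonneg s t h1 h2 h3
  obtain ⟨I, J, hI, hJ, e⟩ := hsol.remainder_eq hf hγ (h.left.trans h1) h2 (h3.trans h.right)
  have hK : 0 ≤ germConst d Λ B := by unfold germConst compConst; positivity
  have e1 := norm_incr_sub_le_of_hasSewing h.p_pos hp' (h.rough.restrict h1 h3) hK
    ((almostAdditive_comp hσ h hB hR).restrict h1 h3) (h.left.trans h1) h2 hI hJ
  have e2 : ‖drift f γ X s t‖ ≤ Λ * (Λ * ω s t ^ 2) := by
    refine (intervalIntegral.norm_integral_le_of_norm_le_const fun r _ => hfb _).trans ?_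
    rw [abs_of_nonneg (sub_nonneg.2 h2)]
    exact mul_le_mul_of_nonneg_left (h.length s t h1 h2 h3) hΛ
  have e3 : ‖tensorApply (compDeriv σ X X' γ s) (ζ.area s t)‖ ≤
      (d * d : ℝ) * (Λ * (Λ * ω s t ^ 2)) := by
    refine (norm_tensorApply_le _ _).trans ?_
    refine mul_le_mul_of_nonneg_left ?_ (by positivity)
    exact mul_le_mul (norm_compDeriv_le hσ h h1 (h2.trans h3)) (h.area s t h1 h2 h3)
      (norm_nonneg _) hΛ
  -- The extra factor `ω ≤ ε` in the third-order sewing error buys the coefficient `1/2` in front of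
  -- `B`.
  have e4 : sewConst p * germConst d Λ B * ω s t ^ 3 ≤ (1 / 2 * (1 + B)) * ω s t ^ 2 := by
    have hS := (sewConst_spec h.p_pos hp').1
    calc sewConst p * germConst d Λ B * ω s t ^ 3
        = (sewConst p * (2 * Λ ^ 5 * Λ * (1 + d * d)) * ω s t) * (1 + B) * ω s t ^ 2 := by
          unfold germConst compConst; ring
      _ ≤ (1 / 2) * (1 + B) * ω s t ^ 2 := by
          have : sewConst p * (2 * Λ ^ 5 * Λ * (1 + d * d)) * ω s t ≤ 1 / 2 :=
            (mul_le_mul_of_nonneg_left (hε s t h1 h2 h3) (by positivity)).trans hε'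
          gcongr
      _ = _ := by ring
  rw [e]
  refine (norm_add_le _ _).trans ((add_le_add ((norm_add_le _ _).trans
    (add_le_add e2 (e1.trans e4))) e3).trans (le_of_eq ?_))
  ring

/-- A priori bound on short intervals. -/
lemma remainder_short (hp : 2 ≤ p) (hp' : p < 3) (hf : Continuous f) (hfb : ∀ z, ‖f z‖ ≤ Λ)
    (hγ : ContinuousOn γ (Set.Icc 0 T)) (hσ : CoeffBound Λ σ σ)
    (hsol : IsRDESolution f σ ζ γ x X X') (h : DataBound Λ σ ζ γ X X' a b ω) {ε : ℝ}
    (hεΛ : ε ≤ Λ) (hε' : sewConst p * (2 * Λ ^ 5 * Λ * (1 + d * d)) * ε ≤ 1 / 2)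
    {s t : ℝ} (h1 : a ≤ s) (h2 : s ≤ t) (h3 : t ≤ b) (hst : ω s t < ε) :
    ‖remainder ζ X X' s t‖ ≤ 2 * (Λ ^ 2 * (1 + d * d) + 1 / 2) * ω s t ^ 2 := by
  have hp0 : 0 < p := h.p_pos
  have hq0 : 0 < p / 2 := by linarith
  have hΛ : 0 ≤ Λ := by linarith [h.one_le]
  set R := remainder ζ X X' with hRdef
  have n0 := h.rough.nonneg s t h1 h2 h3
  have hR0 : ∀ r, R r r = 0 := fun r => by simp [hRdef, remainder, incr]
  have hfin : varSup (p / 2) R s t ≠ ⊤ :=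
    ne_top_of_le_ne_top (varSup_ne_top hq0 hsol.controlled.remainder_var.ne)
      (varSup_mono _ _ (h.left.trans h1) h2 (h3.trans h.right))
  set V := varCtrl (p / 2) R with hVdef
  have hV : IsControlOn s t V := isControlOn_varCtrl hfin
  -- the perturbed control
  set w : ℝ → ℝ → ℝ → ℝ := fun κ u v => (ω u v ^ p + κ * V u v) ^ (1 / p) with hw
  have hr := h.rough.restrict h1 h3
  have wlim : Filter.Tendsto (fun κ => w κ s t) (nhdsWithin 0 (Set.Ioi 0)) (nhds (ω s t)) := by
    have : Filter.Tendsto (fun κ => w κ s t) (nhds 0) (nhds (w 0 s t)) := by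
      simp only [hw]
      have : ContinuousAt (fun κ : ℝ => ω s t ^ p + κ * V s t) 0 := by fun_prop
      exact this.rpow_const (Or.inr (by positivity))
    have h0 : w 0 s t = ω s t := by
      simp only [hw, zero_mul, add_zero]
      rw [← Real.rpow_mul n0, mul_one_div_cancel hp0.ne', Real.rpow_one]
    rw [h0] at this
    exact this.mono_left nhdsWithin_le_nhds
  -- Finite `p/2`-variation of `R` gives no bound `|R| ≤ B ω²` from which to start the iteration.
  -- Adding `κ V` to `ω ^ p`, with `V` the variation of `R`, supplies one; the iterated bound does
  -- not depend on `κ`, and `κ → 0` restores `ω`. The strict inequality `ω s t < ε` keeps the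
  -- perturbed control below `ε` for small `κ`.
  have hev : ∀ᶠ κ in nhdsWithin (0 : ℝ) (Set.Ioi 0),
      ‖R s t‖ ≤ 2 * (Λ ^ 2 * (1 + d * d) + 1 / 2) * w κ s t ^ 2 := by
    filter_upwards [self_mem_nhdsWithin, wlim.eventually (gt_mem_nhds hst)] with κ hκ hκε
    have hκ0 : 0 < κ := hκ
    have base : ∀ u v, s ≤ u → u ≤ v → v ≤ t → 0 ≤ ω u v ^ p + κ * V u v := fun u v e1 e2 e3 =>
      add_nonneg (hr.control.nonneg u v e1 e2 e3) (mul_nonneg hκ0.le (hV.nonneg u v e1 e2 e3))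
    have wp : ∀ u v, s ≤ u → u ≤ v → v ≤ t → w κ u v ^ p = ω u v ^ p + κ * V u v := by
      intro u v e1 e2 e3
      simp only [hw]
      rw [← Real.rpow_mul (base u v e1 e2 e3), one_div_mul_cancel hp0.ne', Real.rpow_one]
    have wn : ∀ u v, s ≤ u → u ≤ v → v ≤ t → 0 ≤ w κ u v := fun u v e1 e2 e3 =>
      Real.rpow_nonneg (base u v e1 e2 e3) _
    have wge : ∀ u v, s ≤ u → u ≤ v → v ≤ t → ω u v ≤ w κ u v := by
      intro u v e1 e2 e3
      rw [← Real.rpow_le_rpow_iff (hr.nonneg u v e1 e2 e3) (wn u v e1 e2 e3) hp0, wp u v e1 e2 e3]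
      linarith [mul_nonneg hκ0.le (hV.nonneg u v e1 e2 e3)]
    have hwc : IsRoughControl p s t (w κ) := by
      refine ⟨wn, ?_⟩
      have hc := hr.control.add (hV.const_mul hκ0.le)
      refine ⟨fun u v e1 e2 e3 => Real.rpow_nonneg (wn u v e1 e2 e3) _,
        fun u v r e1 e2 e3 e4 => ?_⟩
      rw [wp u v e1 e2 (e3.trans e4), wp v r (e1.trans e2) e3 e4, wp u r e1 (e2.trans e3) e4]
      exact hc.superadd u v r e1 e2 e3 e4
    have wle : ∀ u v, s ≤ u → u ≤ v → v ≤ t → w κ u v ≤ ε := fun u v e1 e2 e3 =>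
      (hwc.mono hp0 le_rfl e1 e2 e3 le_rfl).trans hκε.le
    have up : ∀ {E : Type} [NormedAddCommGroup E] {j : ℕ} {A : ℝ → ℝ → E},
        BoundedBy s t ω j Λ A → BoundedBy s t (w κ) j Λ A := by
      intro E _ j A hA u v e1 e2 e3
      refine (hA u v e1 e2 e3).trans (mul_le_mul_of_nonneg_left ?_ hΛ)
      exact pow_le_pow_left₀ (hr.nonneg u v e1 e2 e3) (wge u v e1 e2 e3) j
    have h' := h.restrict h1 h3
    have hd : DataBound Λ σ ζ γ X X' s t (w κ) :=
      ⟨hp0, h.one_le, hwc, h'.left, h'.right,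
        fun u v e1 e2 e3 => (wle u v e1 e2 e3).trans hεΛ,
        fun u v e1 e2 e3 => (h'.length u v e1 e2 e3).trans (mul_le_mul_of_nonneg_left
          (pow_le_pow_left₀ (hr.nonneg u v e1 e2 e3) (wge u v e1 e2 e3) 2) hΛ),
        up h'.path, up h'.area, up h'.control, h'.deriv⟩
    have hBnn : 0 ≤ (1 / κ) ^ (2 / p) := by positivity
    -- From `|R| ^ (p/2) ≤ V ≤ w ^ p / κ`. The constant explodes as `κ → 0`, but it only starts the
    -- iteration.
    have hB₀ : BoundedBy s t (w κ) 2 ((1 / κ) ^ (2 / p)) R := by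
      intro u v e1 e2 e3
      rcases e2.eq_or_lt with rfl | e2'
      · rw [hR0, norm_zero]
        exact mul_nonneg hBnn (pow_nonneg (wn u u e1 le_rfl e3) 2)
      · have c1 : ‖R u v‖ ^ (p / 2) ≤ V u v := norm_rpow_le_varCtrl hfin e1 e2' e3
        have c2 : V u v ≤ 1 / κ * w κ u v ^ p := by
          rw [wp u v e1 e2 e3, one_div, inv_mul_eq_div, le_div_iff₀ hκ0]
          linarith [hr.control.nonneg u v e1 e2 e3]
        have c3 := wn u v e1 e2 e3
        have c4 : (w κ u v ^ 2) ^ (p / 2) = w κ u v ^ p := by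
          rw [← Real.rpow_natCast, ← Real.rpow_mul c3]
          congr 1
          push_cast
          ring
        have c5 : ((1 / κ) ^ (2 / p)) ^ (p / 2) = 1 / κ := by
          rw [← Real.rpow_mul (by positivity), show 2 / p * (p / 2) = 1 by field_simp,
            Real.rpow_one]
        rw [← Real.rpow_le_rpow_iff (norm_nonneg _) (mul_nonneg hBnn (pow_nonneg c3 2)) hq0,
          Real.mul_rpow hBnn (pow_nonneg c3 2), c4, c5]
        exact c1.trans c2
    exact BoundedBy.bootstrap hwc (by positivity) hBnn hB₀ (fun B hB hb =>
      remainder_improve hp' hf hfb hγ hσ hsol hd wle hε' hB hb) s t le_rfl h2 le_rfl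
  have hlim2 : Filter.Tendsto (fun κ => 2 * (Λ ^ 2 * (1 + d * d) + 1 / 2) * w κ s t ^ 2)
      (nhdsWithin 0 (Set.Ioi 0)) (nhds (2 * (Λ ^ 2 * (1 + d * d) + 1 / 2) * ω s t ^ 2)) :=
    (wlim.pow 2).const_mul _
  exact ge_of_tendsto hlim2 hev

/-- A priori bound for the remainder of solutions on the whole interval. -/
lemma exists_remainder_bound (hp : 2 ≤ p) (hp' : p < 3) (hT : 0 ≤ T) (hf : Continuous f)
    (hfb : ∀ z, ‖f z‖ ≤ Λ) (hΛ1 : 1 ≤ Λ) (hσ : CoeffBound Λ σ σ) :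
    ∃ C : ℝ, 0 ≤ C ∧ ∀ (ζ : RoughPath p T d) (γ : ℝ → Euc k) (x : Euc m) (X : ℝ → Euc m)
      (X' : ℝ → Euc d →L[ℝ] Euc m) (ω : ℝ → ℝ → ℝ),
      ContinuousOn γ (Set.Icc 0 T) → IsRDESolution f σ ζ γ x X X' →
      DataBound Λ σ ζ γ X X' 0 T ω → IsRegularOn 0 T (fun s t => ω s t ^ p) →
      BoundedBy 0 T ω 2 C (remainder ζ X X') := by
  have hp0 : 0 < p := by linarith
  have hS := (sewConst_spec hp0 hp').1
  have hΛ : 0 < Λ := by linarith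
  set Q := sewConst p * (2 * Λ ^ 5 * Λ * (1 + d * d)) with hQ
  have hQ0 : 0 ≤ Q := by positivity
  set ε := 1 / (2 * Q + 2) with hε
  have hε0 : 0 < ε := by positivity
  have hε1 : ε ≤ 1 := by rw [hε, div_le_one (by positivity)]; linarith
  have hεQ : Q * ε ≤ 1 / 2 := by
    rw [hε, mul_one_div, div_le_div_iff₀ (by positivity) (by positivity)]; linarith
  set C0 := 2 * (Λ ^ 2 * (1 + d * d) + 1 / 2) with hC0
  have hC00 : 0 ≤ C0 := by positivity
  set G := (1 + Λ ^ 2 + C0) ^ (1 + 2 * (Λ ^ p) / (ε / 2) ^ p) with hG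
  have hG0 : 0 ≤ G := by positivity
  -- `C0` serves where `ω ≤ ε / 2`. Elsewhere `1 ≤ (ω / (ε / 2)) ^ 2`, so the uniform bound `2 G + Λ
  -- ^ 3` on the remainder is already of order `ω ^ 2`.
  refine ⟨C0 + (2 * G + Λ ^ 3) * (1 / (ε / 2)) ^ 2, by positivity, ?_⟩
  intro ζ γ x X X' ω hγ hsol h hreg
  have hshort : ∀ s t, 0 ≤ s → s ≤ t → t ≤ T → ω s t ≤ ε / 2 →
      ‖remainder ζ X X' s t‖ ≤ C0 * ω s t ^ 2 := fun s t h1 h2 h3 h4 =>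
    remainder_short hp hp' hf hfb hγ hσ hsol h (hε1.trans hΛ1) hεQ h1 h2 h3 (by linarith)
  have hincr : ∀ s t, 0 ≤ s → s ≤ t → t ≤ T → ‖X' s (incr ζ.path s t)‖ ≤ Λ * (Λ * ω s t) := by
    intro s t h1 h2 h3
    rw [h.deriv s h1 (h2.trans h3)]
    have := h.path s t h1 h2 h3
    rw [pow_one] at this
    exact (ContinuousLinearMap.le_opNorm _ _).trans
      (mul_le_mul (hσ.coeff.bound _) this (norm_nonneg _) hΛ.le)
  have hsplit : ∀ s t, incr X s t = X' s (incr ζ.path s t) + remainder ζ X X' s t := by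
    intro s t; simp [remainder]
  -- On short intervals `X` moves by at most `Λ ^ 2 + C0`; the summand `1` in `f` turns this
  -- additive growth into the multiplicative form required.
  have hglob := gronwall_of_control (a := 0) (b := T) (e := (ε / 2) ^ p)
    (A := 1 + Λ ^ 2 + C0) (W := fun s t => ω s t ^ p) (f := fun t => ‖X t - X 0‖ + 1)
    (by positivity) (by nlinarith [sq_nonneg Λ]) h.rough.control hreg (fun t => by positivity) (by
      intro s t h1 h2 h3 h4
      have n0 := h.rough.nonneg s t h1 h2 h3
      have h5 : ω s t ≤ ε / 2 := (Real.rpow_le_rpow_iff n0 (by positivity) hp0).1 h4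
      have e1 := hshort s t h1 h2 h3 h5
      have e2 := hincr s t h1 h2 h3
      have e3 : ‖X t - X s‖ ≤ Λ ^ 2 + C0 := by
        change ‖incr X s t‖ ≤ _
        rw [hsplit]
        refine (norm_add_le _ _).trans (add_le_add (e2.trans ?_) (e1.trans ?_))
        · calc Λ * (Λ * ω s t) ≤ Λ * (Λ * 1) := by gcongr; linarith
            _ = _ := by ring
        · have : ω s t ^ 2 ≤ 1 := pow_le_one₀ n0 (by linarith)
          exact mul_le_of_le_one_right hC00 this
      have e4 : ‖X t - X 0‖ ≤ ‖X t - X s‖ + ‖X s - X 0‖ := by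
        have : X t - X 0 = (X t - X s) + (X s - X 0) := by abel
        rw [this]; exact norm_add_le _ _
      have e5 : 0 ≤ (Λ ^ 2 + C0) * ‖X s - X 0‖ := by positivity
      nlinarith)
  simp only [sub_self, norm_zero, zero_add, mul_one] at hglob
  have hgG : ∀ t, 0 ≤ t → t ≤ T → ‖X t - X 0‖ ≤ G := by
    intro t h1 h2
    have e1 := hglob t h1 h2
    have e2 : (1 + Λ ^ 2 + C0) ^ (1 + 2 * ω 0 T ^ p / (ε / 2) ^ p) ≤ G := by
      refine Real.rpow_le_rpow_of_exponent_le (by nlinarith [sq_nonneg Λ]) ?_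
      have := h.rough.nonneg 0 T le_rfl hT le_rfl
      have := h.le 0 T le_rfl hT le_rfl
      gcongr
    linarith
  intro s t h1 h2 h3
  have n0 := h.rough.nonneg s t h1 h2 h3
  rcases le_or_gt (ω s t) (ε / 2) with h4 | h4
  · refine (hshort s t h1 h2 h3 h4).trans (mul_le_mul_of_nonneg_right ?_ (by positivity))
    have : 0 ≤ (2 * G + Λ ^ 3) * (1 / (ε / 2)) ^ 2 := by positivity
    linarith
  · have e1 : remainder ζ X X' s t =
        ((X t - X 0) - (X s - X 0)) - X' s (incr ζ.path s t) := by
      simp [remainder, incr]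
    have e2 : ‖remainder ζ X X' s t‖ ≤ 2 * G + Λ ^ 3 := by
      rw [e1]
      refine (norm_sub_le _ _).trans ?_
      have c1 := (norm_sub_le (X t - X 0) (X s - X 0))
      have c2 := hgG t (h1.trans h2) h3
      have c3 := hgG s h1 (h2.trans h3)
      have c4 : Λ * (Λ * ω s t) ≤ Λ * (Λ * Λ) := by
        have := h.le s t h1 h2 h3
        gcongr
      have c5 := hincr s t h1 h2 h3
      nlinarith
    have e3 : 1 ≤ (1 / (ε / 2)) ^ 2 * ω s t ^ 2 := by
      rw [← mul_pow]
      refine one_le_pow₀ ?_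
      rw [one_div, inv_mul_eq_div, one_le_div (by positivity)]
      exact h4.le
    calc ‖remainder ζ X X' s t‖ ≤ (2 * G + Λ ^ 3) * 1 := by linarith
      _ ≤ (2 * G + Λ ^ 3) * ((1 / (ε / 2)) ^ 2 * ω s t ^ 2) := by gcongr
      _ ≤ _ := by
        have : 0 ≤ C0 * ω s t ^ 2 := by positivity
        linarith

end

/-! ### Differences of solutions -/

section

variable {p T : ℝ} {m k d n : ℕ} {Λ : ℝ} {f : Euc m × Euc k → Euc m}
  {σ : Euc m × Euc k → Euc d →L[ℝ] Euc m} {ψ : Euc m × Euc k → Euc d →L[ℝ] Euc n}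
  {η ζ : RoughPath p T d} {γ θ : ℝ → Euc k} {x y : Euc m} {X Y : ℝ → Euc m}
  {X' Y' : ℝ → Euc d →L[ℝ] Euc m} {a b : ℝ} {ω : ℝ → ℝ → ℝ}

/-- Bounds on the difference of the data of two equations on `[a, b]`. -/
structure DataDiff (N : ℝ) (η ζ : RoughPath p T d) (γ θ : ℝ → Euc k) (a b : ℝ)
    (ω : ℝ → ℝ → ℝ) : Prop where
  nonneg : 0 ≤ N
  path : BoundedBy a b ω 1 N (fun s t => incr η.path s t - incr ζ.path s t)
  area : BoundedBy a b ω 2 N (fun s t => η.area s t - ζ.area s t)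
  control : BoundedBy a b ω 2 N (fun s t => incr γ s t - incr θ s t)
  control_sup : ∀ t, a ≤ t → t ≤ b → ‖γ t - θ t‖ ≤ N

/-- Bounds on the difference of two solutions on `[a, b]`. -/
structure SolDiff (N : ℝ) (η ζ : RoughPath p T d) (X Y : ℝ → Euc m)
    (X' Y' : ℝ → Euc d →L[ℝ] Euc m) (a b : ℝ) (ω : ℝ → ℝ → ℝ) : Prop where
  sup : ∀ t, a ≤ t → t ≤ b → ‖X t - Y t‖ ≤ N
  incr : BoundedBy a b ω 1 N (fun s t => incr X s t - incr Y s t)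
  rem : BoundedBy a b ω 2 N (fun s t => remainder η X X' s t - remainder ζ Y Y' s t)

lemma DataDiff.restrict {N : ℝ} (h : DataDiff N η ζ γ θ a b ω) {a' b' : ℝ} (ha : a ≤ a')
    (hb : b' ≤ b) : DataDiff N η ζ γ θ a' b' ω :=
  ⟨h.nonneg, h.path.restrict ha hb, h.area.restrict ha hb, h.control.restrict ha hb,
    fun t h1 h2 => h.control_sup t (ha.trans h1) (h2.trans hb)⟩

lemma DataDiff.mono {N N' : ℝ} (h : DataDiff N η ζ γ θ a b ω) (hω : IsRoughControl p a b ω)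
    (hN : N ≤ N') : DataDiff N' η ζ γ θ a b ω :=
  ⟨h.nonneg.trans hN, h.path.mono_const hω hN, h.area.mono_const hω hN,
    h.control.mono_const hω hN, fun t h1 h2 => (h.control_sup t h1 h2).trans hN⟩

lemma pair_sub_le {N : ℝ} (hD : DataDiff N η ζ γ θ a b ω) (hS : SolDiff N η ζ X Y X' Y' a b ω)
    {t : ℝ} (h1 : a ≤ t) (h2 : t ≤ b) : ‖((X t, γ t) : Euc m × Euc k) - (Y t, θ t)‖ ≤ 2 * N := by
  refine (norm_pair_le (X t - Y t) (γ t - θ t)).trans ?_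
  linarith [hS.sup t h1 h2, hD.control_sup t h1 h2]

lemma incr_pair_sub_le {N : ℝ} (hX : DataBound Λ σ η γ X X' a b ω)
    (hD : DataDiff N η ζ γ θ a b ω) (hS : SolDiff N η ζ X Y X' Y' a b ω)
    {s t : ℝ} (h1 : a ≤ s) (h2 : s ≤ t) (h3 : t ≤ b) :
    ‖incr (fun t => ((X t, γ t) : Euc m × Euc k)) s t - incr (fun t => (Y t, θ t)) s t‖ ≤
      2 * Λ * N * ω s t := by
  have n0 := hX.rough.nonneg s t h1 h2 h3
  have hN := hD.nonneg
  have e1 := hS.incr s t h1 h2 h3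
  have e2 := hD.control s t h1 h2 h3
  have e3 : ω s t ^ 2 ≤ Λ * ω s t := by
    rw [pow_two]
    exact mul_le_mul_of_nonneg_right (hX.le s t h1 h2 h3) n0
  rw [pow_one] at e1
  refine (norm_pair_le (incr X s t - incr Y s t) (incr γ s t - incr θ s t)).trans ?_
  calc _ ≤ N * ω s t + N * (Λ * ω s t) := add_le_add e1 (e2.trans (by gcongr))
    _ ≤ Λ * (N * ω s t) + N * (Λ * ω s t) := by
        have : 0 ≤ N * ω s t := by positivity
        have := le_mul_of_one_le_left this hX.one_le
        linarith
    _ = _ := by ring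

/-- The difference of the increments of a function along two solutions. -/
lemma fourPoint_along {F : Type} [NormedAddCommGroup F] [NormedSpace ℝ F]
    {g : Euc m × Euc k → F} (hg : FourPoint Λ g)
    (hσ : FourPoint Λ σ) (hX : DataBound Λ σ η γ X X' a b ω)
    (hRX : BoundedBy a b ω 2 Λ (remainder η X X'))
    {N : ℝ} (hD : DataDiff N η ζ γ θ a b ω) (hS : SolDiff N η ζ X Y X' Y' a b ω)
    {s t : ℝ} (h1 : a ≤ s) (h2 : s ≤ t) (h3 : t ≤ b) :
    ‖(g (X t, γ t) - g (X s, γ s)) - (g (Y t, θ t) - g (Y s, θ s))‖ ≤ 8 * Λ ^ 3 * N * ω s t := by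
  have hΛ1 := hX.one_le
  have hΛ : 0 ≤ Λ := by linarith
  have n0 := hX.rough.nonneg s t h1 h2 h3
  have hN := hD.nonneg
  have e0 := hg.four (X s, γ s) (X t, γ t) (Y s, θ s) (Y t, θ t)
  have e1 := incr_pair_sub_le hX hD hS h1 h2 h3
  have e2 := pair_sub_le hD hS h1 (h2.trans h3)
  have e3 := incr_pair_boundedBy hσ hX hΛ hRX s t h1 h2 h3
  rw [pow_one] at e3
  refine e0.trans ?_
  calc _ ≤ Λ * (2 * Λ * N * ω s t + ((2 * Λ ^ 2 + Λ * Λ) * ω s t) * (2 * N)) := by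
        refine mul_le_mul_of_nonneg_left (add_le_add e1 ?_) hΛ
        exact mul_le_mul e3 e2 (norm_nonneg _) (by positivity)
    _ = (2 * Λ ^ 2 + 6 * Λ ^ 3) * (N * ω s t) := by ring
    _ ≤ (2 * Λ ^ 3 + 6 * Λ ^ 3) * (N * ω s t) := by
        have : Λ ^ 2 ≤ Λ ^ 3 := pow_le_pow_right₀ hΛ1 (by norm_num)
        gcongr
    _ = _ := by ring

/-- The difference of the remainders of a function along two solutions. -/
lemma remainder_comp_sub_boundedBy (hψ : CoeffBound Λ σ ψ) (hX : DataBound Λ σ η γ X X' a b ω)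
    (hY : DataBound Λ σ ζ θ Y Y' a b ω)
    (hRX : BoundedBy a b ω 2 Λ (remainder η X X')) (hRY : BoundedBy a b ω 2 Λ (remainder ζ Y Y'))
    {N : ℝ} (hD : DataDiff N η ζ γ θ a b ω) (hS : SolDiff N η ζ X Y X' Y' a b ω) :
    BoundedBy a b ω 2 (36 * Λ ^ 5 * N)
      (fun s t => remainder η (comp ψ X γ) (compDeriv ψ X X' γ) s t -
        remainder ζ (comp ψ Y θ) (compDeriv ψ Y Y' θ) s t) := by
  intro s t h1 h2 h3
  have hΛ1 := hX.one_le
  have hΛ : 0 ≤ Λ := by linarith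
  have n0 := hX.rough.nonneg s t h1 h2 h3
  have hN := hD.nonneg
  -- Here the Taylor remainder is taken along the whole increment of `(X, γ)`. The remainders of
  -- both solutions are already bounded by `Λ ω²`, so no quadratic dependence arises and the
  -- difference is linear in `N`.
  have rep : ∀ {ζ : RoughPath p T d} {γ : ℝ → Euc k} {X : ℝ → Euc m}
      {X' : ℝ → Euc d →L[ℝ] Euc m}, DataBound Λ σ ζ γ X X' a b ω →
      remainder ζ (comp ψ X γ) (compDeriv ψ X X' γ) s t =
        (ψ ((X s, γ s) + incr (fun t => (X t, γ t)) s t) - ψ (X s, γ s) -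
          fderiv ℝ ψ (X s, γ s) (incr (fun t => (X t, γ t)) s t)) +
        fderiv ℝ ψ (X s, γ s) (remainder ζ X X' s t, incr γ s t) := by
    intro ζ γ X X' h
    rw [← pair_defect h h1 h2 h3, map_sub]
    simp only [remainder, compDeriv_eq hψ.diff h h1 (h2.trans h3), derivAlong,
      ContinuousLinearMap.comp_apply]
    simp only [incr, comp, add_sub_cancel]
    abel
  simp only [rep hX, rep hY]
  set u := incr (fun t => ((X t, γ t) : Euc m × Euc k)) s t with hu
  set v := incr (fun t => ((Y t, θ t) : Euc m × Euc k)) s t with hv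
  have e1 := incr_pair_sub_le hX hD hS h1 h2 h3
  rw [← hu, ← hv] at e1
  have e2 := pair_sub_le hD hS h1 (h2.trans h3)
  have e3 := incr_pair_boundedBy hψ.coeff hX hΛ hRX s t h1 h2 h3
  have e4 := incr_pair_boundedBy hψ.coeff hY hΛ hRY s t h1 h2 h3
  rw [← hu, pow_one] at e3
  rw [← hv, pow_one] at e4
  have t1 := hψ.taylor.diff (X s, γ s) (Y s, θ s) u v
  have t2 := norm_clm_sub_le (fderiv ℝ ψ (X s, γ s)) (fderiv ℝ ψ (Y s, θ s))
    (remainder η X X' s t, incr γ s t) (remainder ζ Y Y' s t, incr θ s t)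
  have e5 : ‖((remainder η X X' s t, incr γ s t) : Euc m × Euc k)‖ ≤ 2 * Λ * ω s t ^ 2 :=
    (norm_pair_le _ _).trans (by linarith [hRX s t h1 h2 h3, hX.control s t h1 h2 h3])
  have e6 : ‖((remainder η X X' s t, incr γ s t) : Euc m × Euc k) -
      (remainder ζ Y Y' s t, incr θ s t)‖ ≤ 2 * N * ω s t ^ 2 := by
    refine (norm_pair_le (remainder η X X' s t - remainder ζ Y Y' s t)
      (incr γ s t - incr θ s t)).trans ?_
    linarith [hS.rem s t h1 h2 h3, hD.control s t h1 h2 h3]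
  have e7 := (hψ.fn_deriv.lip (X s, γ s) (Y s, θ s)).trans (mul_le_mul_of_nonneg_left e2 hΛ)
  rw [add_sub_add_comm]
  calc _ ≤ Λ * (((2 * Λ ^ 2 + Λ * Λ) * ω s t) ^ 2 * (2 * N) +
          ((2 * Λ ^ 2 + Λ * Λ) * ω s t + (2 * Λ ^ 2 + Λ * Λ) * ω s t) * (2 * Λ * N * ω s t)) +
        (Λ * (2 * N) * (2 * Λ * ω s t ^ 2) + Λ * (2 * N * ω s t ^ 2)) := by
        refine (norm_add_le _ _).trans (add_le_add (t1.trans ?_) (t2.trans ?_))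
        · refine mul_le_mul_of_nonneg_left ?_ hΛ
          gcongr
        · exact add_le_add (mul_le_mul e7 e5 (norm_nonneg _) (by positivity))
            (mul_le_mul (hψ.fn_deriv.bound _) e6 (norm_nonneg _) hΛ)
    _ = (18 * Λ ^ 5 + 12 * Λ ^ 4 + 4 * Λ ^ 2 + 2 * Λ) * (N * ω s t ^ 2) := by ring
    _ ≤ (18 * Λ ^ 5 + 12 * Λ ^ 5 + 4 * Λ ^ 5 + 2 * Λ ^ 5) * (N * ω s t ^ 2) := by
        have p1 : Λ ≤ Λ ^ 5 := le_self_pow₀ hΛ1 (by norm_num)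
        have p2 : Λ ^ 2 ≤ Λ ^ 5 := pow_le_pow_right₀ hΛ1 (by norm_num)
        have p4 : Λ ^ 4 ≤ Λ ^ 5 := pow_le_pow_right₀ hΛ1 (by norm_num)
        gcongr
    _ = _ := by ring

/-- The constant in the sewing bound of the difference of two germs. -/
noncomputable def germDiffConst (d : ℕ) (Λ : ℝ) : ℝ :=
  (36 * Λ ^ 5 * Λ + compConst Λ Λ) * (1 + d * d)

lemma germDiffConst_nonneg (d : ℕ) {Λ : ℝ} (hΛ : 0 ≤ Λ) : 0 ≤ germDiffConst d Λ := by
  unfold germDiffConst compConst; positivity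

lemma almostAdditive_comp_sub (hψ : CoeffBound Λ σ ψ) (hX : DataBound Λ σ η γ X X' a b ω)
    (hY : DataBound Λ σ ζ θ Y Y' a b ω)
    (hRX : BoundedBy a b ω 2 Λ (remainder η X X')) (hRY : BoundedBy a b ω 2 Λ (remainder ζ Y Y'))
    {N : ℝ} (hD : DataDiff N η ζ γ θ a b ω) (hS : SolDiff N η ζ X Y X' Y' a b ω) :
    AlmostAdditive a b ω (germDiffConst d Λ * N)
      (fun s t => germ η (comp ψ X γ) (compDeriv ψ X X' γ) s t -
        germ ζ (comp ψ Y θ) (compDeriv ψ Y Y' θ) s t) := by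
  have hΛ1 := hX.one_le
  have hΛ : 0 ≤ Λ := by linarith
  have hN := hD.nonneg
  have hA : 0 ≤ compConst Λ Λ := by unfold compConst; positivity
  have key := almostAdditive_germ_sub hX.p_pos hX.rough hX.left hX.right η ζ hA
    (A' := 36 * Λ ^ 5 * N) (by positivity) hΛ hN hX.path hX.area hD.path hD.area
    (remainder_comp_boundedBy hψ hY hΛ hRY) (incr_compDeriv_boundedBy hψ hY hΛ hRY)
    (remainder_comp_sub_boundedBy hψ hX hY hRX hRY hD hS) (by
      intro s t h1 h2 h3
      have n0 := hX.rough.nonneg s t h1 h2 h3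
      unfold incr
      beta_reduce
      rw [compDeriv_eq hψ.diff hX h1 (h2.trans h3), compDeriv_eq hψ.diff hX (h1.trans h2) h3,
        compDeriv_eq hψ.diff hY h1 (h2.trans h3), compDeriv_eq hψ.diff hY (h1.trans h2) h3, pow_one]
      refine (fourPoint_along hψ.along hψ.coeff hX hRX hD hS h1 h2 h3).trans ?_
      have p2 : Λ ^ 3 ≤ Λ ^ 5 := pow_le_pow_right₀ hΛ1 (by norm_num)
      have p0 : 0 ≤ Λ ^ 5 := by positivity
      have : 8 * Λ ^ 3 ≤ 36 * Λ ^ 5 := by linarith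
      gcongr)
  have : (36 * Λ ^ 5 * N * Λ + compConst Λ Λ * N) * (1 + d * d : ℝ) = germDiffConst d Λ * N := by
    unfold germDiffConst; ring
  rwa [this] at key

/-- The difference of the second order terms of two germs. -/
lemma norm_tensor_sub_le (hψ : CoeffBound Λ σ ψ) (hX : DataBound Λ σ η γ X X' a b ω)
    (hY : DataBound Λ σ ζ θ Y Y' a b ω) {N : ℝ} (hD : DataDiff N η ζ γ θ a b ω)
    (hsup : ∀ t, a ≤ t → t ≤ b → ‖X t - Y t‖ ≤ N)
    {s t : ℝ} (h1 : a ≤ s) (h2 : s ≤ t) (h3 : t ≤ b) :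
    ‖tensorApply (compDeriv ψ X X' γ s) (η.area s t) -
      tensorApply (compDeriv ψ Y Y' θ s) (ζ.area s t)‖ ≤
        (d * d : ℝ) * (3 * Λ ^ 2 * N * ω s t ^ 2) := by
  have hΛ1 := hX.one_le
  have hΛ : 0 ≤ Λ := by linarith
  have n0 := hX.rough.nonneg s t h1 h2 h3
  have hN := hD.nonneg
  refine (norm_tensorApply_sub_le _ _ _ _).trans (mul_le_mul_of_nonneg_left ?_ (by positivity))
  have e1 : ‖compDeriv ψ X X' γ s - compDeriv ψ Y Y' θ s‖ ≤ Λ * (2 * N) := by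
    rw [compDeriv_eq hψ.diff hX h1 (h2.trans h3), compDeriv_eq hψ.diff hY h1 (h2.trans h3)]
    refine (hψ.along.lip _ _).trans (mul_le_mul_of_nonneg_left ?_ hΛ)
    refine (norm_pair_le (X s - Y s) (γ s - θ s)).trans ?_
    linarith [hsup s h1 (h2.trans h3), hD.control_sup s h1 (h2.trans h3)]
  calc _ ≤ Λ * (2 * N) * (Λ * ω s t ^ 2) + Λ * (N * ω s t ^ 2) :=
        add_le_add (mul_le_mul e1 (hX.area s t h1 h2 h3) (norm_nonneg _) (by positivity))
          (mul_le_mul (norm_compDeriv_le hψ hY h1 (h2.trans h3)) (hD.area s t h1 h2 h3)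
            (norm_nonneg _) hΛ)
    _ = (2 * Λ ^ 2 + Λ) * (N * ω s t ^ 2) := by ring
    _ ≤ (2 * Λ ^ 2 + Λ ^ 2) * (N * ω s t ^ 2) := by
        have p1 : Λ ≤ Λ ^ 2 := le_self_pow₀ hΛ1 (by norm_num)
        gcongr
    _ = _ := by ring

/-- The difference of the first order terms of two germs. -/
lemma norm_first_sub_le {G : Type} [NormedAddCommGroup G] [NormedSpace ℝ G]
    {g : Euc m × Euc k → Euc d →L[ℝ] G} (hg : FourPoint Λ g) (hX : DataBound Λ σ η γ X X' a b ω)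
    {N D : ℝ} (hD : DataDiff N η ζ γ θ a b ω)
    {s t : ℝ} (h1 : a ≤ s) (h2 : s ≤ t) (h3 : t ≤ b) (hs : ‖X s - Y s‖ ≤ D) :
    ‖g (X s, γ s) (incr η.path s t) - g (Y s, θ s) (incr ζ.path s t)‖ ≤
      2 * Λ ^ 2 * (D + N) * ω s t := by
  have hΛ1 := hX.one_le
  have hΛ : 0 ≤ Λ := by linarith
  have n0 := hX.rough.nonneg s t h1 h2 h3
  have hN := hD.nonneg
  have hD0 : 0 ≤ D := (norm_nonneg _).trans hs
  refine (norm_clm_sub_le _ _ _ _).trans ?_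
  have e1 : ‖g (X s, γ s) - g (Y s, θ s)‖ ≤ Λ * (D + N) := by
    refine (hg.lip _ _).trans (mul_le_mul_of_nonneg_left ?_ hΛ)
    refine (norm_pair_le (X s - Y s) (γ s - θ s)).trans ?_
    linarith [hD.control_sup s h1 (h2.trans h3)]
  have e2 := hX.path s t h1 h2 h3
  have e3 := hD.path s t h1 h2 h3
  rw [pow_one] at e2 e3
  calc _ ≤ Λ * (D + N) * (Λ * ω s t) + Λ * ((D + N) * ω s t) := by
        refine add_le_add (mul_le_mul e1 e2 (norm_nonneg _) (by positivity))
          (mul_le_mul (hg.bound _) (e3.trans ?_) (norm_nonneg _) hΛ)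
        gcongr
        linarith
    _ = (Λ ^ 2 + Λ) * ((D + N) * ω s t) := by ring
    _ ≤ (Λ ^ 2 + Λ ^ 2) * ((D + N) * ω s t) := by
        have p1 : Λ ≤ Λ ^ 2 := le_self_pow₀ hΛ1 (by norm_num)
        gcongr
    _ = _ := by ring

end

/-! ### Contraction and stability for the difference of two solutions -/

section

open MeasureTheory

variable {p T : ℝ} {m k d n : ℕ} {Λ : ℝ} {f : Euc m × Euc k → Euc m}
  {σ : Euc m × Euc k → Euc d →L[ℝ] Euc m} {ψ : Euc m × Euc k → Euc d →L[ℝ] Euc n}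
  {η ζ : RoughPath p T d} {γ θ : ℝ → Euc k} {x y : Euc m} {X Y : ℝ → Euc m}
  {X' Y' : ℝ → Euc d →L[ℝ] Euc m} {a b : ℝ} {ω : ℝ → ℝ → ℝ}

/-- A bound on the difference of the remainders controls the difference of the solutions. -/
lemma solDiff_of_remainder (hσ : FourPoint Λ σ) (hX : DataBound Λ σ η γ X X' a b ω)
    (hY : DataBound Λ σ ζ θ Y Y' a b ω) {ρ D B ε : ℝ} (hD : DataDiff ρ η ζ γ θ a b ω)
    (hε1 : ε ≤ 1) (hε : ∀ s t, a ≤ s → s ≤ t → t ≤ b → ω s t ≤ ε) (ha : ‖X a - Y a‖ ≤ D)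
    (hab : a ≤ b) (hB : 0 ≤ B)
    (hR : BoundedBy a b ω 2 B (fun s t => remainder η X X' s t - remainder ζ Y Y' s t)) :
    (∀ t, a ≤ t → t ≤ b → ‖X t - Y t‖ ≤ 3 * Λ ^ 2 * (D + ρ) + B * ε) ∧
    BoundedBy a b ω 1 (8 * Λ ^ 4 * (D + ρ) + 3 * Λ ^ 2 * B * ε)
      (fun s t => incr X s t - incr Y s t) := by
  have hΛ1 := hX.one_le
  have hΛ : 0 ≤ Λ := by linarith
  have hρ := hD.nonneg
  have hD0 : 0 ≤ D := (norm_nonneg _).trans ha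
  have hε0 : 0 ≤ ε := (hX.rough.nonneg a b le_rfl hab le_rfl).trans (hε a b le_rfl hab le_rfl)
  have p2 : 1 ≤ Λ ^ 2 := one_le_pow₀ hΛ1
  -- Since `B ω² ≤ B ε ω`, the unknown `B` enters the path difference only with the small factor
  -- `ε`. The step is used from `a`, for the supremum, and then again from an arbitrary `s`, for the
  -- increments.
  have step : ∀ s t S, a ≤ s → s ≤ t → t ≤ b → ‖X s - Y s‖ ≤ S →
      ‖incr X s t - incr Y s t‖ ≤ (2 * Λ ^ 2 * (S + ρ) + B * ε) * ω s t := by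
    intro s t S h1 h2 h3 hs
    have n0 := hX.rough.nonneg s t h1 h2 h3
    have e1 := norm_first_sub_le hσ hX hD h1 h2 h3 hs
    have alg : incr X s t - incr Y s t = (σ (X s, γ s) (incr η.path s t) -
        σ (Y s, θ s) (incr ζ.path s t)) + (remainder η X X' s t - remainder ζ Y Y' s t) := by
      simp only [remainder, hX.deriv s h1 (h2.trans h3), hY.deriv s h1 (h2.trans h3)]
      abel
    rw [alg]
    calc _ ≤ 2 * Λ ^ 2 * (S + ρ) * ω s t + B * ω s t ^ 2 :=
          (norm_add_le _ _).trans (add_le_add e1 (hR s t h1 h2 h3))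
      _ ≤ 2 * Λ ^ 2 * (S + ρ) * ω s t + B * (ε * ω s t) := by
          have : ω s t ^ 2 ≤ ε * ω s t := by
            rw [pow_two]
            exact mul_le_mul_of_nonneg_right (hε s t h1 h2 h3) n0
          gcongr
      _ = _ := by ring
  have hsup : ∀ t, a ≤ t → t ≤ b → ‖X t - Y t‖ ≤ 3 * Λ ^ 2 * (D + ρ) + B * ε := by
    intro t h1 h2
    have e1 := step a t D le_rfl h1 h2 ha
    have n0 := hX.rough.nonneg a t le_rfl h1 h2
    have e2 : ω a t ≤ 1 := (hε a t le_rfl h1 h2).trans hε1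
    have alg : X t - Y t = (incr X a t - incr Y a t) + (X a - Y a) := by simp only [incr]; abel
    rw [alg]
    calc _ ≤ (2 * Λ ^ 2 * (D + ρ) + B * ε) * 1 + 1 * (D + ρ) := by
          refine (norm_add_le _ _).trans (add_le_add (e1.trans ?_) ?_)
          · gcongr
          · linarith
      _ ≤ (2 * Λ ^ 2 * (D + ρ) + B * ε) * 1 + Λ ^ 2 * (D + ρ) := by gcongr
      _ = _ := by ring
  refine ⟨hsup, fun s t h1 h2 h3 => ?_⟩
  have n0 := hX.rough.nonneg s t h1 h2 h3
  rw [pow_one]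
  refine (step s t _ h1 h2 h3 (hsup s h1 (h2.trans h3))).trans
    (mul_le_mul_of_nonneg_right ?_ n0)
  have p4 : Λ ^ 2 * ρ ≤ Λ ^ 4 * (D + ρ) := by
    have : Λ ^ 2 ≤ Λ ^ 4 := pow_le_pow_right₀ hΛ1 (by norm_num)
    have : ρ ≤ D + ρ := by linarith
    gcongr
  have p5 : 1 * (B * ε) ≤ Λ ^ 2 * (B * ε) := by gcongr
  nlinarith

lemma drift_sub_le (hf : Continuous f) (hfl : ∀ z w, ‖f z - f w‖ ≤ Λ * ‖z - w‖)
    (hγ : ContinuousOn γ (Set.Icc 0 T)) (hθ : ContinuousOn θ (Set.Icc 0 T))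
    (hsX : IsRDESolution f σ η γ x X X') (hsY : IsRDESolution f σ ζ θ y Y Y')
    (hX : DataBound Λ σ η γ X X' a b ω)
    {N : ℝ} (hD : DataDiff N η ζ γ θ a b ω)
    (hsup : ∀ t, a ≤ t → t ≤ b → ‖X t - Y t‖ ≤ N)
    {s t : ℝ} (h1 : a ≤ s) (h2 : s ≤ t) (h3 : t ≤ b) :
    ‖drift f γ X s t - drift f θ Y s t‖ ≤ 2 * Λ ^ 2 * N * ω s t ^ 2 := by
  have hΛ : 0 ≤ Λ := by linarith [hX.one_le]
  have hN := hD.nonneg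
  have hs : s ∈ Set.Icc 0 T := ⟨hX.left.trans h1, h2.trans (h3.trans hX.right)⟩
  have ht : t ∈ Set.Icc 0 T := ⟨hs.1.trans h2, h3.trans hX.right⟩
  unfold drift
  rw [← intervalIntegral.integral_sub (hsX.intervalIntegrable hf hγ hs ht)
    (hsY.intervalIntegrable hf hθ hs ht)]
  have e1 := intervalIntegral.norm_integral_le_of_norm_le_const (a := s) (b := t)
    (f := fun r => f (X r, γ r) - f (Y r, θ r)) (C := Λ * (2 * N)) (fun r hr => by
      rw [Set.uIoc_of_le h2] at hr
      have ha : a ≤ r := h1.trans hr.1.le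
      have hb : r ≤ b := hr.2.trans h3
      refine (hfl _ _).trans (mul_le_mul_of_nonneg_left ?_ hΛ)
      refine (norm_pair_le (X r - Y r) (γ r - θ r)).trans ?_
      linarith [hsup r ha hb, hD.control_sup r ha hb])
  refine e1.trans ?_
  rw [abs_of_nonneg (sub_nonneg.2 h2)]
  calc Λ * (2 * N) * (t - s) ≤ Λ * (2 * N) * (Λ * ω s t ^ 2) :=
        mul_le_mul_of_nonneg_left (hX.length s t h1 h2 h3) (by positivity)
    _ = _ := by ring

/-- The rate in the contraction step for the difference of two remainders. -/
noncomputable def diffRate (p : ℝ) (d : ℕ) (Λ : ℝ) : ℝ :=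
  2 * Λ ^ 2 + 3 * (d * d) * Λ ^ 2 + sewConst p * germDiffConst d Λ

/-- The counterpart of `remainder_improve` for two solutions. The bound `B` acts through the path
difference, where it carries `ε`, and through the sewing error, where `ω³ ≤ ε ω²`; both effects
together have coefficient at most `4 Λ² · rate · ε ≤ 1/2`. -/
lemma remainder_sub_improve (hp' : p < 3) (hf : Continuous f)
    (hfl : ∀ z w, ‖f z - f w‖ ≤ Λ * ‖z - w‖)
    (hγ : ContinuousOn γ (Set.Icc 0 T)) (hθ : ContinuousOn θ (Set.Icc 0 T))
    (hσ : CoeffBound Λ σ σ)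
    (hsX : IsRDESolution f σ η γ x X X') (hsY : IsRDESolution f σ ζ θ y Y Y')
    (hX : DataBound Λ σ η γ X X' a b ω) (hY : DataBound Λ σ ζ θ Y Y' a b ω)
    (hRX : BoundedBy a b ω 2 Λ (remainder η X X')) (hRY : BoundedBy a b ω 2 Λ (remainder ζ Y Y'))
    {ρ D B ε : ℝ} (hD : DataDiff ρ η ζ γ θ a b ω)
    (hε1 : ε ≤ 1) (hε : ∀ s t, a ≤ s → s ≤ t → t ≤ b → ω s t ≤ ε)
    (hε' : 4 * Λ ^ 2 * diffRate p d Λ * ε ≤ 1 / 2) (ha : ‖X a - Y a‖ ≤ D)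
    (hab : a ≤ b) (hB : 0 ≤ B)
    (hR : BoundedBy a b ω 2 B (fun s t => remainder η X X' s t - remainder ζ Y Y' s t)) :
    BoundedBy a b ω 2 (diffRate p d Λ * (8 * Λ ^ 4 * (D + ρ)) + B / 2)
      (fun s t => remainder η X X' s t - remainder ζ Y Y' s t) := by
  have hΛ1 := hX.one_le
  have hΛ : 0 ≤ Λ := by linarith
  have hρ := hD.nonneg
  have hD0 : 0 ≤ D := (norm_nonneg _).trans ha
  have hε0 : 0 ≤ ε := (hX.rough.nonneg a b le_rfl hab le_rfl).trans (hε a b le_rfl hab le_rfl)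
  obtain ⟨sup, inc⟩ := solDiff_of_remainder hσ.coeff hX hY hD hε1 hε ha hab hB hR
  set S := 8 * Λ ^ 4 * (D + ρ) + 3 * Λ ^ 2 * B * ε with hS
  have p2 : 1 ≤ Λ ^ 2 := one_le_pow₀ hΛ1
  have p4 : Λ ^ 2 ≤ Λ ^ 4 := pow_le_pow_right₀ hΛ1 (by norm_num)
  have q1 : Λ ^ 2 * (D + ρ) ≤ Λ ^ 4 * (D + ρ) := by gcongr
  have q2 : 1 * (B * ε) ≤ Λ ^ 2 * (B * ε) := by gcongr
  have q3 : 1 * (D + ρ) ≤ Λ ^ 2 * (D + ρ) := by gcongr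
  have q4 : 0 ≤ B * ε := by positivity
  have hS0 : 0 ≤ S := by positivity
  have supS : ∀ t, a ≤ t → t ≤ b → ‖X t - Y t‖ ≤ S := fun t h1 h2 => by
    refine (sup t h1 h2).trans ?_
    rw [hS]
    linarith
  have hρS : ρ ≤ S := by
    rw [hS]
    linarith
  -- Two levels are kept apart: the drift and the area term need only the path difference `S`, in
  -- which `B` is multiplied by `ε`. The full level `S + B` enters only the germ, whose estimate has
  -- a spare factor `ω`.
  have hDS := hD.mono hX.rough hρS
  have hDN := hD.mono hX.rough (hρS.trans (le_add_of_nonneg_right hB))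
  have hSol : SolDiff (S + B) η ζ X Y X' Y' a b ω :=
    ⟨fun t h1 h2 => (supS t h1 h2).trans (le_add_of_nonneg_right hB),
      inc.mono_const hX.rough (le_add_of_nonneg_right hB),
      hR.mono_const hX.rough (le_add_of_nonneg_left hS0)⟩
  have hadd := almostAdditive_comp_sub hσ hX hY hRX hRY hDN hSol
  intro s t h1 h2 h3
  have n0 := hX.rough.nonneg s t h1 h2 h3
  have hG := germDiffConst_nonneg d hΛ
  have hC := (sewConst_spec hX.p_pos hp').1
  obtain ⟨I, J, hI, hJ, e⟩ := hsX.remainder_eq hf hγ (hX.left.trans h1) h2 (h3.trans hX.right)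
  obtain ⟨I', J', hI', hJ', e'⟩ := hsY.remainder_eq hf hθ (hX.left.trans h1) h2 (h3.trans hX.right)
  have e1 := norm_incr_sub_le_of_hasSewing hX.p_pos hp' (hX.rough.restrict h1 h3)
    (mul_nonneg hG (add_nonneg hS0 hB)) (hadd.restrict h1 h3) (hX.left.trans h1) h2
    (hI.sub hI') (hJ.sub hJ')
  have e2 := drift_sub_le hf hfl hγ hθ hsX hsY hX hDS supS h1 h2 h3
  have e3 := norm_tensor_sub_le hσ hX hY hDS supS h1 h2 h3
  beta_reduce
  rw [e, e']
  have alg : ∀ d1 d2 g1 g2 t1 t2 : Euc m,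
      d1 + (J - I - g1) + t1 - (d2 + (J' - I' - g2) + t2) =
      (d1 - d2) + (J - J' - (I - I') - (g1 - g2)) + (t1 - t2) := by
    intro d1 d2 g1 g2 t1 t2
    abel
  rw [alg]
  have e4 : sewConst p * (germDiffConst d Λ * (S + B)) * ω s t ^ 3 ≤
      sewConst p * germDiffConst d Λ * (S + B * ε) * ω s t ^ 2 := by
    calc sewConst p * (germDiffConst d Λ * (S + B)) * ω s t ^ 3
        = sewConst p * germDiffConst d Λ * (S * ω s t + B * ω s t) * ω s t ^ 2 := by ring
      _ ≤ sewConst p * germDiffConst d Λ * (S * 1 + B * ε) * ω s t ^ 2 := by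
          have := hε s t h1 h2 h3
          have : ω s t ≤ 1 := this.trans hε1
          gcongr
      _ = _ := by ring
  refine (norm_add_le _ _).trans ((add_le_add ((norm_add_le _ _).trans
    (add_le_add e2 (e1.trans e4))) e3).trans ?_)
  have hrate : 0 ≤ diffRate p d Λ := by unfold diffRate; positivity
  have hrate2 : sewConst p * germDiffConst d Λ ≤ diffRate p d Λ := by
    unfold diffRate
    have : 0 ≤ 2 * Λ ^ 2 + 3 * (d * d) * Λ ^ 2 := by positivity
    linarith
  calc 2 * Λ ^ 2 * S * ω s t ^ 2 +
        sewConst p * germDiffConst d Λ * (S + B * ε) * ω s t ^ 2 +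
        (d * d : ℝ) * (3 * Λ ^ 2 * S * ω s t ^ 2)
      = (diffRate p d Λ * S + sewConst p * germDiffConst d Λ * (B * ε)) * ω s t ^ 2 := by
        unfold diffRate; ring
    _ ≤ (diffRate p d Λ * S + diffRate p d Λ * (Λ ^ 2 * (B * ε))) * ω s t ^ 2 := by
        have q5 : B * ε ≤ Λ ^ 2 * (B * ε) := by linarith
        gcongr
    _ = (diffRate p d Λ * (8 * Λ ^ 4 * (D + ρ)) + 4 * Λ ^ 2 * diffRate p d Λ * ε * B) *
          ω s t ^ 2 := by rw [hS]; ring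
    _ ≤ (diffRate p d Λ * (8 * Λ ^ 4 * (D + ρ)) + 1 / 2 * B) * ω s t ^ 2 := by gcongr
    _ = _ := by ring

/-- Stability of solutions with respect to the data. -/
lemma exists_solDiff_bound (hp0 : 0 < p) (hp' : p < 3) (hT : 0 ≤ T) (hf : Continuous f)
    (hfl : ∀ z w, ‖f z - f w‖ ≤ Λ * ‖z - w‖) (hΛ1 : 1 ≤ Λ) (hσ : CoeffBound Λ σ σ) :
    ∃ C : ℝ, 1 ≤ C ∧ ∀ (η ζ : RoughPath p T d) (γ θ : ℝ → Euc k) (x y : Euc m) (X Y : ℝ → Euc m)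
      (X' Y' : ℝ → Euc d →L[ℝ] Euc m) (ω : ℝ → ℝ → ℝ) (ρ : ℝ),
      ContinuousOn γ (Set.Icc 0 T) → ContinuousOn θ (Set.Icc 0 T) →
      IsRDESolution f σ η γ x X X' → IsRDESolution f σ ζ θ y Y Y' →
      DataBound Λ σ η γ X X' 0 T ω → DataBound Λ σ ζ θ Y Y' 0 T ω →
      IsRegularOn 0 T (fun s t => ω s t ^ p) →
      BoundedBy 0 T ω 2 Λ (remainder η X X') → BoundedBy 0 T ω 2 Λ (remainder ζ Y Y') →
      DataDiff ρ η ζ γ θ 0 T ω → ‖x - y‖ ≤ ρ → SolDiff (C * ρ) η ζ X Y X' Y' 0 T ω := by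
  have hC := (sewConst_spec hp0 hp').1
  have hΛ : 0 < Λ := by linarith
  have hG := germDiffConst_nonneg d hΛ.le
  set r := diffRate p d Λ with hr
  have hr0 : 0 ≤ r := by rw [hr]; unfold diffRate; positivity
  set Q := 4 * Λ ^ 2 * r with hQ
  have hQ0 : 0 ≤ Q := by positivity
  set ε := 1 / (2 * Q + 2) with hε
  have hε0 : 0 < ε := by positivity
  have hε1 : ε ≤ 1 := by rw [hε, div_le_one (by positivity)]; linarith
  have hεQ : Q * ε ≤ 1 / 2 := by
    rw [hε, mul_one_div, div_le_div_iff₀ (by positivity) (by positivity)]; linarith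
  set C0 := 2 * (r * (8 * Λ ^ 4)) with hC0
  have hC00 : 0 ≤ C0 := by positivity
  set A := 3 * Λ ^ 2 + C0 + 1 with hA
  have hA1 : 1 ≤ A := by rw [hA]; nlinarith [sq_nonneg Λ]
  -- The Gronwall factor with `ω 0 T ≤ Λ`; the final `2` accounts for the initial value `‖x - y‖ + ρ
  -- ≤ 2 ρ`.
  set G := A ^ (1 + 2 * (Λ ^ p) / ε ^ p) * 2 with hGdef
  have hG0 : 0 ≤ G := by positivity
  set C1 := 2 * G + 2 * Λ ^ 3 * (G + 1) with hC1
  set C2 := C0 * (G + 1) + C1 * (1 / ε) ^ 2 with hC2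
  set C3 := 2 * Λ ^ 2 * (G + 1) + C2 * Λ with hC3
  have hC10 : 0 ≤ C1 := by positivity
  have hC20 : 0 ≤ C2 := by positivity
  have hC30 : 0 ≤ C3 := by positivity
  refine ⟨1 + G + C2 + C3, by linarith, ?_⟩
  intro η ζ γ θ x y X Y X' Y' ω ρ hγ hθ hsX hsY hX hY hreg hRX hRY hD hxy
  have hρ := hD.nonneg
  -- the estimate on short intervals
  have hshort : ∀ s t, 0 ≤ s → s ≤ t → t ≤ T → ω s t ≤ ε →
      (‖X t - Y t‖ + ρ ≤ A * (‖X s - Y s‖ + ρ)) ∧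
      ‖remainder η X X' s t - remainder ζ Y Y' s t‖ ≤
        C0 * (‖X s - Y s‖ + ρ) * ω s t ^ 2 := by
    intro s t h1 h2 h3 h4
    have hX' := hX.restrict h1 h3
    have hY' := hY.restrict h1 h3
    have hD' := hD.restrict h1 h3
    have small : ∀ u v, s ≤ u → u ≤ v → v ≤ t → ω u v ≤ ε := fun u v e1 e2 e3 =>
      (hX'.rough.mono hp0 le_rfl e1 e2 e3 le_rfl).trans h4
    have hd0 : 0 ≤ ‖X s - Y s‖ + ρ := by positivity
    have key : BoundedBy s t ω 2 (2 * (r * (8 * Λ ^ 4 * (‖X s - Y s‖ + ρ))))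
        (fun s t => remainder η X X' s t - remainder ζ Y Y' s t) := by
      -- The a priori bounds on both remainders start the iteration; no perturbation of the control
      -- is needed this time.
      refine BoundedBy.bootstrap hX'.rough (by positivity) (B₀ := 2 * Λ) (by positivity) ?_ ?_
      · intro u v e1 e2 e3
        refine (norm_sub_le _ _).trans ?_
        have c1 := hRX u v (h1.trans e1) e2 (e3.trans h3)
        have c2 := hRY u v (h1.trans e1) e2 (e3.trans h3)
        linarith
      · intro B hB hb
        exact remainder_sub_improve hp' hf hfl hγ hθ hσ hsX hsY hX' hY' (hRX.restrict h1 h3)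
          (hRY.restrict h1 h3) hD' hε1 small hεQ le_rfl h2 hB hb
    have hk : 2 * (r * (8 * Λ ^ 4 * (‖X s - Y s‖ + ρ))) = C0 * (‖X s - Y s‖ + ρ) := by
      rw [hC0]; ring
    rw [hk] at key
    refine ⟨?_, key s t le_rfl h2 le_rfl⟩
    have e1 := (solDiff_of_remainder hσ.coeff hX' hY' hD' hε1 small le_rfl h2
      (by positivity) key).1 t h2 le_rfl
    have e2 : C0 * (‖X s - Y s‖ + ρ) * ε ≤ C0 * (‖X s - Y s‖ + ρ) * 1 := by gcongr
    have e3 : A * (‖X s - Y s‖ + ρ) = 3 * Λ ^ 2 * (‖X s - Y s‖ + ρ) +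
        C0 * (‖X s - Y s‖ + ρ) * 1 + (‖X s - Y s‖ + ρ) := by rw [hA]; ring
    rw [e3]
    linarith [norm_nonneg (X s - Y s)]
  -- Adding `ρ` to the difference makes the short-time estimate homogeneous.
  have hglob := gronwall_of_control (a := 0) (b := T) (e := ε ^ p)
    (A := A) (W := fun s t => ω s t ^ p) (f := fun t => ‖X t - Y t‖ + ρ)
    (by positivity) hA1 hX.rough.control hreg (fun t => by positivity) (by
      intro s t h1 h2 h3 h4
      have n0 := hX.rough.nonneg s t h1 h2 h3
      exact (hshort s t h1 h2 h3 ((Real.rpow_le_rpow_iff n0 hε0.le hp0).1 h4)).1)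
  have sup : ∀ t, 0 ≤ t → t ≤ T → ‖X t - Y t‖ ≤ G * ρ := by
    intro t h1 h2
    have e1 := hglob t h1 h2
    rw [hsX.initial hT, hsY.initial hT] at e1
    have e2 : A ^ (1 + 2 * ω 0 T ^ p / ε ^ p) ≤ A ^ (1 + 2 * (Λ ^ p) / ε ^ p) := by
      refine Real.rpow_le_rpow_of_exponent_le hA1 ?_
      have := hX.rough.nonneg 0 T le_rfl hT le_rfl
      have := hX.le 0 T le_rfl hT le_rfl
      gcongr
    have e3 : A ^ (1 + 2 * ω 0 T ^ p / ε ^ p) * (‖x - y‖ + ρ) ≤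
        A ^ (1 + 2 * (Λ ^ p) / ε ^ p) * (2 * ρ) := by
      have : ‖x - y‖ + ρ ≤ 2 * ρ := by linarith
      gcongr
    have e4 : A ^ (1 + 2 * (Λ ^ p) / ε ^ p) * (2 * ρ) = G * ρ := by rw [hGdef]; ring
    linarith
  have first : ∀ s t, 0 ≤ s → s ≤ t → t ≤ T →
      ‖X' s (incr η.path s t) - Y' s (incr ζ.path s t)‖ ≤ 2 * Λ ^ 2 * (G + 1) * ρ * ω s t := by
    intro s t h1 h2 h3
    rw [hX.deriv s h1 (h2.trans h3), hY.deriv s h1 (h2.trans h3)]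
    refine (norm_first_sub_le hσ.coeff hX hD h1 h2 h3 (sup s h1 (h2.trans h3))).trans
      (le_of_eq ?_)
    ring
  have rem : BoundedBy 0 T ω 2 (C2 * ρ)
      (fun s t => remainder η X X' s t - remainder ζ Y Y' s t) := by
    intro s t h1 h2 h3
    have n0 := hX.rough.nonneg s t h1 h2 h3
    have hs := sup s h1 (h2.trans h3)
    -- For `ω > ε` the remainder difference is read off from the uniform bound on `X - Y`, and `1 ≤
    -- (ω / ε) ^ 2` restores the order.
    rcases le_or_gt (ω s t) ε with h4 | h4
    · refine (hshort s t h1 h2 h3 h4).2.trans (mul_le_mul_of_nonneg_right ?_ (by positivity))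
      calc C0 * (‖X s - Y s‖ + ρ) ≤ C0 * (G * ρ + ρ) := by gcongr
        _ = C0 * (G + 1) * ρ := by ring
        _ ≤ C2 * ρ := by
          have : 0 ≤ C1 * (1 / ε) ^ 2 := by positivity
          refine mul_le_mul_of_nonneg_right ?_ hρ
          rw [hC2]; linarith
    · have alg : remainder η X X' s t - remainder ζ Y Y' s t = ((X t - Y t) - (X s - Y s)) -
          (X' s (incr η.path s t) - Y' s (incr ζ.path s t)) := by
        simp only [remainder]
        simp only [incr]
        abel
      have e1 : ‖remainder η X X' s t - remainder ζ Y Y' s t‖ ≤ C1 * ρ := by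
        rw [alg]
        have c1 := first s t h1 h2 h3
        have c2 : 2 * Λ ^ 2 * (G + 1) * ρ * ω s t ≤ 2 * Λ ^ 2 * (G + 1) * ρ * Λ := by
          have := hX.le s t h1 h2 h3
          gcongr
        have c3 := norm_sub_le (X t - Y t) (X s - Y s)
        have c4 := sup t (h1.trans h2) h3
        refine (norm_sub_le _ _).trans ?_
        rw [hC1]
        linarith
      have e3 : 1 ≤ (1 / ε) ^ 2 * ω s t ^ 2 := by
        rw [← mul_pow]
        refine one_le_pow₀ ?_
        rw [one_div, inv_mul_eq_div, one_le_div (by positivity)]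
        exact h4.le
      calc ‖remainder η X X' s t - remainder ζ Y Y' s t‖ ≤ C1 * ρ * 1 := by linarith
        _ ≤ C1 * ρ * ((1 / ε) ^ 2 * ω s t ^ 2) := by gcongr
        _ ≤ _ := by
          have : 0 ≤ C0 * (G + 1) * ρ * ω s t ^ 2 := by positivity
          rw [hC2]
          linarith
  have inc : BoundedBy 0 T ω 1 (C3 * ρ) (fun s t => incr X s t - incr Y s t) := by
    intro s t h1 h2 h3
    have n0 := hX.rough.nonneg s t h1 h2 h3
    have alg : incr X s t - incr Y s t = (X' s (incr η.path s t) - Y' s (incr ζ.path s t)) +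
        (remainder η X X' s t - remainder ζ Y Y' s t) := by
      simp only [remainder]
      abel
    beta_reduce
    rw [alg, pow_one]
    calc _ ≤ 2 * Λ ^ 2 * (G + 1) * ρ * ω s t + C2 * ρ * ω s t ^ 2 :=
          (norm_add_le _ _).trans (add_le_add (first s t h1 h2 h3) (rem s t h1 h2 h3))
      _ ≤ 2 * Λ ^ 2 * (G + 1) * ρ * ω s t + C2 * ρ * (Λ * ω s t) := by
          have : ω s t ^ 2 ≤ Λ * ω s t := by
            rw [pow_two]
            exact mul_le_mul_of_nonneg_right (hX.le s t h1 h2 h3) n0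
          gcongr
      _ = _ := by rw [hC3]; ring
  have w1 : G * ρ ≤ (1 + G + C2 + C3) * ρ := mul_le_mul_of_nonneg_right (by linarith) hρ
  have w2 : C2 * ρ ≤ (1 + G + C2 + C3) * ρ := mul_le_mul_of_nonneg_right (by linarith) hρ
  have w3 : C3 * ρ ≤ (1 + G + C2 + C3) * ρ := mul_le_mul_of_nonneg_right (by linarith) hρ
  exact ⟨fun t h1 h2 => (sup t h1 h2).trans w1, inc.mono_const hX.rough w3,
    rem.mono_const hX.rough w2⟩

/-- Stability of the rough integrals. -/
lemma integral_sub_boundedBy (hp' : p < 3) (hψ : CoeffBound Λ σ ψ)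
    (hX : DataBound Λ σ η γ X X' 0 T ω) (hY : DataBound Λ σ ζ θ Y Y' 0 T ω)
    (hRX : BoundedBy 0 T ω 2 Λ (remainder η X X')) (hRY : BoundedBy 0 T ω 2 Λ (remainder ζ Y Y'))
    {N : ℝ} (hD : DataDiff N η ζ γ θ 0 T ω) (hS : SolDiff N η ζ X Y X' Y' 0 T ω)
    {I J : ℝ → Euc n}
    (hI : ∀ t ∈ Set.Icc 0 T, HasRoughIntegral η (comp ψ X γ) (compDeriv ψ X X' γ) 0 t (I t))
    (hJ : ∀ t ∈ Set.Icc 0 T, HasRoughIntegral ζ (comp ψ Y θ) (compDeriv ψ Y Y' θ) 0 t (J t)) :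
    BoundedBy 0 T ω 1
      ((4 * Λ ^ 2 + 3 * (d * d) * Λ ^ 3 + sewConst p * germDiffConst d Λ * Λ ^ 2) * N)
      (incr fun t => I t - J t) := by
  intro s t h1 h2 h3
  have hΛ1 := hX.one_le
  have hΛ : 0 ≤ Λ := by linarith
  have hN := hD.nonneg
  have n0 := hX.rough.nonneg s t h1 h2 h3
  have hG := germDiffConst_nonneg d hΛ
  have hC := (sewConst_spec hX.p_pos hp').1
  have hs : s ∈ Set.Icc 0 T := ⟨h1, h2.trans h3⟩
  have ht : t ∈ Set.Icc 0 T := ⟨h1.trans h2, h3⟩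
  have e1 := norm_incr_sub_le_of_hasSewing hX.p_pos hp' (hX.rough.restrict h1 h3)
    (mul_nonneg hG hN) ((almostAdditive_comp_sub hψ hX hY hRX hRY hD hS).restrict h1 h3) h1 h2
    (HasSewing.sub (hI s hs) (hJ s hs)) (HasSewing.sub (hI t ht) (hJ t ht))
  have e2 := norm_first_sub_le hψ.fn hX hD h1 h2 h3 (hS.sup s h1 (h2.trans h3))
  have e3 := norm_tensor_sub_le hψ hX hY hD hS.sup h1 h2 h3
  have alg : incr (fun t => I t - J t) s t =
      (I t - J t - (I s - J s) - (germ η (comp ψ X γ) (compDeriv ψ X X' γ) s t -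
        germ ζ (comp ψ Y θ) (compDeriv ψ Y Y' θ) s t)) +
      (ψ (X s, γ s) (incr η.path s t) - ψ (Y s, θ s) (incr ζ.path s t)) +
      (tensorApply (compDeriv ψ X X' γ s) (η.area s t) -
        tensorApply (compDeriv ψ Y Y' θ s) (ζ.area s t)) := by
    simp only [germ, comp]
    simp only [incr]
    abel
  rw [alg, pow_one]
  have w1 := hX.le s t h1 h2 h3
  have w2 : ω s t ^ 2 ≤ Λ * ω s t := by
    rw [pow_two]
    exact mul_le_mul_of_nonneg_right w1 n0
  have w3 : ω s t ^ 3 ≤ Λ ^ 2 * ω s t := by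
    calc ω s t ^ 3 = ω s t ^ 2 * ω s t := by ring
      _ ≤ Λ ^ 2 * ω s t := by gcongr
  calc _ ≤ sewConst p * (germDiffConst d Λ * N) * ω s t ^ 3 + 2 * Λ ^ 2 * (N + N) * ω s t +
        (d * d : ℝ) * (3 * Λ ^ 2 * N * ω s t ^ 2) :=
        (norm_add_le _ _).trans (add_le_add ((norm_add_le _ _).trans (add_le_add e1 e2)) e3)
    _ ≤ sewConst p * (germDiffConst d Λ * N) * (Λ ^ 2 * ω s t) + 2 * Λ ^ 2 * (N + N) * ω s t +
        (d * d : ℝ) * (3 * Λ ^ 2 * N * (Λ * ω s t)) := by gcongr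
    _ = _ := by ring

end

/-! ### Controls for the data -/

section

variable {p T : ℝ} {E : Type} [NormedAddCommGroup E]

lemma isRoughControl_rpow (hp : 0 < p) {a b : ℝ} {W : ℝ → ℝ → ℝ} (hW : IsControlOn a b W) :
    (∀ s t, a ≤ s → s ≤ t → t ≤ b → (W s t ^ (1 / p)) ^ p = W s t) ∧
      IsRoughControl p a b (fun s t => W s t ^ (1 / p)) := by
  have key : ∀ s t, a ≤ s → s ≤ t → t ≤ b → (W s t ^ (1 / p)) ^ p = W s t := by
    intro s t h1 h2 h3
    rw [← Real.rpow_mul (hW.nonneg s t h1 h2 h3), one_div_mul_cancel hp.ne', Real.rpow_one]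
  refine ⟨key, fun s t h1 h2 h3 => Real.rpow_nonneg (hW.nonneg s t h1 h2 h3) _,
    fun s t h1 h2 h3 => ?_, fun s u t h1 h2 h3 h4 => ?_⟩
  · rw [key s t h1 h2 h3]
    exact hW.nonneg s t h1 h2 h3
  · rw [key s u h1 h2 (h3.trans h4), key u t (h1.trans h2) h3 h4, key s t h1 (h2.trans h3) h4]
    exact hW.superadd s u t h1 h2 h3 h4

lemma le_mul_pow_of_rpow_le (hp : 0 < p) {j : ℕ} (hj : 0 < j) {x c W : ℝ} (hx : 0 ≤ x)
    (hc : 0 ≤ c) (hW : 0 ≤ W) (h : x ^ (p / j) ≤ c ^ (p / j) * W) :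
    x ≤ c * (W ^ (1 / p)) ^ j := by
  have hj' : (0 : ℝ) < j := by exact_mod_cast hj
  have hq : 0 < p / j := by positivity
  rw [← Real.rpow_le_rpow_iff hx (by positivity) hq, Real.mul_rpow hc (by positivity),
    ← Real.rpow_natCast, ← Real.rpow_mul (by positivity), ← Real.rpow_mul hW,
    show 1 / p * (j * (p / j)) = 1 by field_simp, Real.rpow_one]
  exact h

/-- Functions dominated by a power of `ω` have finite variation. -/
lemma pVar_le_of_boundedBy (hp : 0 < p) (hT : 0 ≤ T) {ω : ℝ → ℝ → ℝ}
    (hω : IsRoughControl p 0 T ω) {j : ℕ} (hj : 0 < j) {C : ℝ} (hC : 0 ≤ C) {A : ℝ → ℝ → E}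
    (hA : BoundedBy 0 T ω j C A) : pVar (p / j) A 0 T ≤ ENNReal.ofReal (C * ω 0 T ^ j) := by
  have hj' : (0 : ℝ) < j := by exact_mod_cast hj
  have hq : 0 < p / j := by positivity
  have hpow : ∀ s t, 0 ≤ s → s ≤ t → t ≤ T →
      (C * ω s t ^ j) ^ (p / j) = C ^ (p / j) * ω s t ^ p := by
    intro s t h1 h2 h3
    have n0 := hω.nonneg s t h1 h2 h3
    rw [Real.mul_rpow hC (by positivity), ← Real.rpow_natCast, ← Real.rpow_mul n0,
      mul_div_cancel₀ _ hj'.ne']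
  have key := varSup_le_of_control hq.le (hω.control.const_mul (c := C ^ (p / j)) (by positivity))
    (A := A) (q := p / j) (by
      intro s t h1 h2 h3
      have n0 := hω.nonneg s t h1 h2.le h3
      rw [← hpow s t h1 h2.le h3]
      exact Real.rpow_le_rpow (norm_nonneg _) (hA s t h1 h2.le h3) hq.le)
  rw [← hpow 0 T le_rfl hT le_rfl] at key
  have n0 := hω.nonneg 0 T le_rfl hT le_rfl
  rw [pVar_eq]
  calc _ ≤ ENNReal.ofReal ((C * ω 0 T ^ j) ^ (p / j)) ^ (1 / (p / j)) :=
        ENNReal.rpow_le_rpow key (by positivity)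
    _ = ENNReal.ofReal (C * ω 0 T ^ j) := by
        rw [ENNReal.ofReal_rpow_of_nonneg (by positivity) (by positivity),
          ← Real.rpow_mul (by positivity), mul_one_div_cancel hq.ne', Real.rpow_one]

lemma norm_le_of_holderNorm_le {α L : ℝ} (hL : 0 ≤ L) {A : ℝ → ℝ → E}
    (h : holderNorm α T A ≤ ENNReal.ofReal L) {s t : ℝ} (h1 : 0 ≤ s) (h2 : s < t) (h3 : t ≤ T) :
    ‖A s t‖ ≤ L * (t - s) ^ α := by
  have hpos : 0 < (t - s) ^ α := Real.rpow_pos_of_pos (sub_pos.2 h2) _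
  have e1 : ‖A s t‖ₑ / ENNReal.ofReal ((t - s) ^ α) ≤ ENNReal.ofReal L := by
    refine le_trans ?_ h
    unfold holderNorm
    refine le_iSup₂_of_le s ⟨h1, h2.le.trans h3⟩ ?_
    exact le_iSup₂_of_le t ⟨h2, h3⟩ le_rfl
  rw [ENNReal.div_le_iff (ENNReal.ofReal_pos.2 hpos).ne' ENNReal.ofReal_ne_top,
    ← ENNReal.ofReal_mul hL, ← ofReal_norm] at e1
  exact (ENNReal.ofReal_le_ofReal_iff (by positivity)).1 e1

lemma RoughPath.area_self {d : ℕ} (ζ : RoughPath p T d) {s : ℝ} (h1 : 0 ≤ s) (h2 : s ≤ T) :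
    ζ.area s s = 0 := by
  have := ζ.chen s s s h1 le_rfl le_rfl h2
  simpa [incr] using this

lemma RoughPath.norm_path_le {d : ℕ} (ζ : RoughPath p T d) {L : ℝ} (hL : 0 ≤ L)
    (h : ζ.holder ≤ ENNReal.ofReal L) {s t : ℝ} (h1 : 0 ≤ s) (h2 : s ≤ t) (h3 : t ≤ T) :
    ‖incr ζ.path s t‖ ≤ L * (t - s) ^ (1 / p) := by
  rcases h2.eq_or_lt with rfl | h2
  · have : 0 ≤ (s - s) ^ (1 / p) := Real.rpow_nonneg (by simp) _
    simpa [incr] using mul_nonneg hL this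
  · exact norm_le_of_holderNorm_le hL (le_self_add.trans h) h1 h2 h3

lemma RoughPath.norm_area_le {d : ℕ} (ζ : RoughPath p T d) {L : ℝ} (hL : 0 ≤ L)
    (h : ζ.holder ≤ ENNReal.ofReal L) {s t : ℝ} (h1 : 0 ≤ s) (h2 : s ≤ t) (h3 : t ≤ T) :
    ‖ζ.area s t‖ ≤ L * (t - s) ^ (2 / p) := by
  rcases h2.eq_or_lt with rfl | h2
  · rw [ζ.area_self h1 h3, norm_zero]
    exact mul_nonneg hL (Real.rpow_nonneg (by simp) _)
  · exact norm_le_of_holderNorm_le hL (le_add_self.trans h) h1 h2 h3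

variable {m k d n : ℕ} {σ : Euc m × Euc k → Euc d →L[ℝ] Euc m} {ζ : RoughPath p T d}
  {γ : ℝ → Euc k} {X : ℝ → Euc m} {X' : ℝ → Euc d →L[ℝ] Euc m}

/-- Any control that dominates length and the variation of `γ` dominates the rough path as well,
because its Hölder bounds are powers of `t - s`. -/
lemma dataBound_of_control (hp : 2 ≤ p) {Λ L W₀ : ℝ} (hΛ : 1 ≤ Λ) (hL : 0 ≤ L)
    (hLΛ : L ≤ Λ) (hTΛ : T ^ (1 - 2 / p) ≤ Λ) (hWΛ : W₀ ^ (1 / p) ≤ Λ) {W : ℝ → ℝ → ℝ}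
    (hW : IsControlOn 0 T W) (hW₀ : W 0 T ≤ W₀)
    (hlen : ∀ s t, 0 ≤ s → s ≤ t → t ≤ T → t - s ≤ W s t)
    (hfin : varSup (p / 2) (incr γ) 0 T ≠ ⊤)
    (hV : ∀ s t, 0 ≤ s → s ≤ t → t ≤ T → varCtrl (p / 2) (incr γ) s t ≤ W s t)
    (hζ : ζ.holder ≤ ENNReal.ofReal L) (hX : ∀ t ∈ Set.Icc 0 T, X' t = σ (X t, γ t)) :
    DataBound Λ σ ζ γ X X' 0 T (fun s t => W s t ^ (1 / p)) := by
  have hp0 : 0 < p := by linarith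
  obtain ⟨hpow, hω⟩ := isRoughControl_rpow hp0 hW
  have sq : ∀ s t, 0 ≤ s → s ≤ t → t ≤ T → (t - s) ^ (2 / p) ≤ (W s t ^ (1 / p)) ^ 2 := by
    intro s t h1 h2 h3
    rw [← Real.rpow_natCast, ← Real.rpow_mul (hW.nonneg s t h1 h2 h3),
      show 1 / p * ((2 : ℕ) : ℝ) = 2 / p by push_cast; ring]
    exact Real.rpow_le_rpow (sub_nonneg.2 h2) (hlen s t h1 h2 h3) (by positivity)
  have h2p : 0 ≤ 1 - 2 / p := by
    rw [sub_nonneg, div_le_one hp0]; exact hp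
  refine ⟨hp0, hΛ, hω, le_rfl, le_rfl, ?_, ?_, ?_, ?_, ?_, fun t h1 h2 => hX t ⟨h1, h2⟩⟩
  · intro s t h1 h2 h3
    refine (Real.rpow_le_rpow (hW.nonneg s t h1 h2 h3) ?_ (by positivity)).trans hWΛ
    exact (hW.mono le_rfl h1 h2 h3 le_rfl).trans hW₀
  · intro s t h1 h2 h3
    rcases h2.eq_or_lt with rfl | h2'
    · rw [sub_self]
      have := hω.nonneg s s h1 le_rfl h3
      positivity
    have hpos : 0 < t - s := sub_pos.2 h2'
    -- As `p ≥ 2`, the first exponent is nonnegative and that factor is at most `T ^ (1 - 2 / p)`: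
    -- the drift counts as a second-order term.
    calc t - s = (t - s) ^ (1 - 2 / p) * (t - s) ^ (2 / p) := by
          rw [← Real.rpow_add hpos, sub_add_cancel, Real.rpow_one]
      _ ≤ Λ * (W s t ^ (1 / p)) ^ 2 := by
          refine mul_le_mul ?_ (sq s t h1 h2 h3) (by positivity) (by positivity)
          exact (Real.rpow_le_rpow hpos.le (by linarith) h2p).trans hTΛ
  · intro s t h1 h2 h3
    refine (ζ.norm_path_le hL hζ h1 h2 h3).trans ?_
    rw [pow_one]
    refine mul_le_mul hLΛ ?_ (Real.rpow_nonneg (sub_nonneg.2 h2) _) (by positivity)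
    exact Real.rpow_le_rpow (sub_nonneg.2 h2) (hlen s t h1 h2 h3) (by positivity)
  · intro s t h1 h2 h3
    refine (ζ.norm_area_le hL hζ h1 h2 h3).trans ?_
    exact mul_le_mul hLΛ (sq s t h1 h2 h3) (Real.rpow_nonneg (sub_nonneg.2 h2) _) (by positivity)
  · intro s t h1 h2 h3
    have hWn := hW.nonneg s t h1 h2 h3
    rcases h2.eq_or_lt with rfl | h2'
    · simp only [incr, sub_self, norm_zero]
      positivity
    refine le_mul_pow_of_rpow_le hp0 two_pos (norm_nonneg _) (by positivity) hWn ?_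
    have e1 := norm_rpow_le_varCtrl hfin h1 h2' h3
    have e2 := hV s t h1 h2 h3
    have e3 : 1 ≤ Λ ^ (p / ((2 : ℕ) : ℝ)) := Real.one_le_rpow hΛ (by positivity)
    push_cast at e3 ⊢
    calc _ ≤ 1 * W s t := by rw [one_mul]; exact e1.trans e2
      _ ≤ _ := by gcongr

/-- The control of the data of one equation. -/
lemma exists_control_single (hp : 2 ≤ p) {M : ℝ} (hM : 0 ≤ M)
    (hγ : IsVarPath (p / 2) T γ) (hγM : pVar (p / 2) (incr γ) 0 T ≤ ENNReal.ofReal M) :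
    IsControlOn 0 T (fun s t => (t - s) + varCtrl (p / 2) (incr γ) s t) ∧
    IsRegularOn 0 T (fun s t => (t - s) + varCtrl (p / 2) (incr γ) s t) ∧
    varSup (p / 2) (incr γ) 0 T ≠ ⊤ ∧ varCtrl (p / 2) (incr γ) 0 T ≤ M ^ (p / 2) := by
  have hq : 0 < p / 2 := by linarith
  have hfin := varSup_ne_top hq hγ.finite.ne
  exact ⟨(IsControlOn.length 0 T).add (isControlOn_varCtrl hfin),
    (IsRegularOn.length 0 T).add (isRegularOn_varCtrl (by linarith) hγ.continuousOn hfin), hfin,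
    varCtrl_le_rpow hq hM hγM⟩

/-- The weight `1 / ρ ^ (p / j)` on the variation of `A` inside `W` reappears as the factor `ρ` once
the root of order `p / j` is taken. -/
lemma boundedBy_of_control (hp : 0 < p) {j : ℕ} (hj : 0 < j) {A : ℝ → ℝ → E} {ρ : ℝ}
    (hρ : 0 < ρ) (hfin : varSup (p / j) A 0 T ≠ ⊤) {W : ℝ → ℝ → ℝ} (hW : IsControlOn 0 T W)
    (h0 : ∀ s, 0 ≤ s → s ≤ T → A s s = 0)
    (hV : ∀ s t, 0 ≤ s → s ≤ t → t ≤ T → 1 / ρ ^ (p / j) * varCtrl (p / j) A s t ≤ W s t) :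
    BoundedBy 0 T (fun s t => W s t ^ (1 / p)) j ρ A := by
  intro s t h1 h2 h3
  have hWn := hW.nonneg s t h1 h2 h3
  rcases h2.eq_or_lt with rfl | h2'
  · rw [h0 s h1 h3, norm_zero]
    positivity
  refine le_mul_pow_of_rpow_le hp hj (norm_nonneg _) hρ.le hWn ?_
  have e1 := norm_rpow_le_varCtrl hfin h1 h2' h3
  have e2 := hV s t h1 h2 h3
  rw [one_div, inv_mul_le_iff₀ (by positivity)] at e2
  exact e1.trans e2

/-- A control for the data of two equations and their differences. -/
lemma exists_control_pair (hp : 2 ≤ p) {L M : ℝ} (hL : 0 < L) (hM : 0 ≤ M)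
    {γ θ : ℝ → Euc k} {η ζ : RoughPath p T d} {x y : Euc m}
    (hγ : IsVarPath (p / 2) T γ) (hθ : IsVarPath (p / 2) T θ)
    (hγM : pVar (p / 2) (incr γ) 0 T ≤ ENNReal.ofReal M)
    (hθM : pVar (p / 2) (incr θ) 0 T ≤ ENNReal.ofReal M)
    (hη : η.holder ≤ ENNReal.ofReal L) (hζ : ζ.holder ≤ ENNReal.ofReal L)
    {ρ : ℝ} (hρ : 0 < ρ) (hdist : dataDist x y γ θ η ζ ≤ ENNReal.ofReal ρ) :
    ∃ W : ℝ → ℝ → ℝ, IsControlOn 0 T W ∧ IsRegularOn 0 T W ∧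
      W 0 T ≤ T + 2 * M ^ (p / 2) + 3 ∧
      (∀ s t, 0 ≤ s → s ≤ t → t ≤ T → t - s ≤ W s t) ∧
      (∀ s t, 0 ≤ s → s ≤ t → t ≤ T → varCtrl (p / 2) (incr γ) s t ≤ W s t) ∧
      (∀ s t, 0 ≤ s → s ≤ t → t ≤ T → varCtrl (p / 2) (incr θ) s t ≤ W s t) ∧
      DataDiff ρ η ζ γ θ 0 T (fun s t => W s t ^ (1 / p)) ∧ ‖x - y‖ ≤ ρ := by
  have hp0 : 0 < p := by linarith
  have hq : 0 < p / 2 := by linarith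
  have d1 : ‖x - y‖ₑ ≤ ENNReal.ofReal ρ := by
    refine le_trans ?_ hdist
    unfold dataDist
    rw [add_assoc, add_assoc]
    exact le_self_add
  have d2 : supNorm T (fun t => γ t - θ t) ≤ ENNReal.ofReal ρ := by
    refine le_trans ?_ hdist
    unfold dataDist
    exact le_add_self.trans (le_self_add.trans le_self_add)
  have d3 : pVar (p / 2) (incr fun t => γ t - θ t) 0 T ≤ ENNReal.ofReal ρ := by
    refine le_trans ?_ hdist
    unfold dataDist
    exact le_add_self.trans le_self_add
  have d4 : pVar p (incr fun t => η.path t - ζ.path t) 0 T ≤ ENNReal.ofReal ρ := by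
    refine le_trans ?_ hdist
    unfold dataDist roughDist
    exact le_self_add.trans le_add_self
  have d5 : pVar (p / 2) (fun s t => η.area s t - ζ.area s t) 0 T ≤ ENNReal.ofReal ρ := by
    refine le_trans ?_ hdist
    unfold dataDist roughDist
    exact le_add_self.trans le_add_self
  set A1 := incr fun t => η.path t - ζ.path t with hA1
  set A2 := fun s t => η.area s t - ζ.area s t with hA2
  set A3 := incr fun t => γ t - θ t with hA3
  have f1 : varSup p A1 0 T ≠ ⊤ := varSup_ne_top hp0 (ne_top_of_le_ne_top ENNReal.ofReal_ne_top d4)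
  have f2 : varSup (p / 2) A2 0 T ≠ ⊤ :=
    varSup_ne_top hq (ne_top_of_le_ne_top ENNReal.ofReal_ne_top d5)
  have f3 : varSup (p / 2) A3 0 T ≠ ⊤ :=
    varSup_ne_top hq (ne_top_of_le_ne_top ENNReal.ofReal_ne_top d3)
  have b1 := varCtrl_le_rpow hp0 hρ.le d4
  have b2 := varCtrl_le_rpow hq hρ.le d5
  have b3 := varCtrl_le_rpow hq hρ.le d3
  obtain ⟨c4, r4, f4, b4⟩ := exists_control_single hp hM hγ hγM
  obtain ⟨-, -, f5, b5⟩ := exists_control_single hp hM hθ hθM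
  have c1 := isControlOn_varCtrl f1
  have c2 := isControlOn_varCtrl f2
  have c3 := isControlOn_varCtrl f3
  have c5 := isControlOn_varCtrl f5
  have r5 := isRegularOn_varCtrl (by linarith) hθ.continuousOn f5
  have r3 : IsRegularOn 0 T (varCtrl (p / 2) A3) :=
    isRegularOn_varCtrl (by linarith) (hγ.continuousOn.sub hθ.continuousOn) f3
  have hold : ∀ (q : ℝ), 0 < q → ∀ (x : ℝ), 0 ≤ x → ∀ s t : ℝ, s < t →
      x ≤ 2 * L * (t - s) ^ (1 / q) → x ^ q ≤ (2 * L) ^ q * (t - s) := by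
    intro q hq0 x hx s t hst h
    have hpos : 0 < t - s := sub_pos.2 hst
    calc x ^ q ≤ (2 * L * (t - s) ^ (1 / q)) ^ q := Real.rpow_le_rpow hx h hq0.le
      _ = _ := by
        rw [Real.mul_rpow (by positivity) (by positivity), ← Real.rpow_mul hpos.le,
          one_div_mul_cancel hq0.ne', Real.rpow_one]
  have eA1 : ∀ s t, A1 s t = incr η.path s t - incr ζ.path s t := by
    intro s t
    simp only [hA1, incr]
    abel
  have eA3 : ∀ s t, A3 s t = incr γ s t - incr θ s t := by
    intro s t
    simp only [hA3, incr]
    abel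
  have r1 : IsRegularOn 0 T (varCtrl p A1) := by
    refine isRegularOn_varCtrl_of_holder hp0 (K := (2 * L) ^ p) (by positivity) ?_
    intro s t h1 h2 h3
    refine hold p hp0 _ (norm_nonneg _) s t h2 ?_
    rw [eA1]
    refine (norm_sub_le _ _).trans ?_
    linarith [η.norm_path_le hL.le hη h1 h2.le h3, ζ.norm_path_le hL.le hζ h1 h2.le h3]
  -- The difference of areas is not the increment of a path, so regularity cannot come from
  -- continuity; the Hölder bounds on both areas give it, with exponent `2 / p`.
  have r2 : IsRegularOn 0 T (varCtrl (p / 2) A2) := by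
    refine isRegularOn_varCtrl_of_holder hq (K := (2 * L) ^ (p / 2)) (by positivity) ?_
    intro s t h1 h2 h3
    refine hold (p / 2) hq _ (norm_nonneg _) s t h2 ?_
    rw [one_div_div]
    refine (norm_sub_le _ _).trans ?_
    linarith [η.norm_area_le hL.le hη h1 h2.le h3, ζ.norm_area_le hL.le hζ h1 h2.le h3]
  have i1 : 0 < 1 / ρ ^ p := by positivity
  have i2 : 0 < 1 / ρ ^ (p / 2) := by positivity
  -- After normalisation each of the three difference terms is at most `1` on `[0, T]`, which
  -- explains the `3` in the bound for `W 0 T`. The length appears once, inside `c4`.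
  have hW := (((c4.add c5).add (c1.const_mul i1.le)).add (c2.const_mul i2.le)).add
    (c3.const_mul i2.le)
  have hR := (((r4.add r5).add (r1.const_mul i1)).add (r2.const_mul i2)).add
    (r3.const_mul i2)
  have nn : ∀ s t, 0 ≤ s → s ≤ t → t ≤ T →
      0 ≤ varCtrl (p / 2) (incr γ) s t ∧ 0 ≤ varCtrl (p / 2) (incr θ) s t ∧
      0 ≤ 1 / ρ ^ p * varCtrl p A1 s t ∧ 0 ≤ 1 / ρ ^ (p / 2) * varCtrl (p / 2) A2 s t ∧
      0 ≤ 1 / ρ ^ (p / 2) * varCtrl (p / 2) A3 s t := by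
    intro s t _ _ _
    exact ⟨ENNReal.toReal_nonneg, ENNReal.toReal_nonneg,
      mul_nonneg i1.le ENNReal.toReal_nonneg, mul_nonneg i2.le ENNReal.toReal_nonneg,
      mul_nonneg i2.le ENNReal.toReal_nonneg⟩
  refine ⟨_, hW, hR, ?_, ?_, ?_, ?_, ⟨hρ.le, ?_, ?_, ?_, ?_⟩, ?_⟩
  · have e1 : 1 / ρ ^ p * varCtrl p A1 0 T ≤ 1 := by
      rw [one_div, inv_mul_le_iff₀ (by positivity), mul_one]; exact b1
    have e2 : 1 / ρ ^ (p / 2) * varCtrl (p / 2) A2 0 T ≤ 1 := by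
      rw [one_div, inv_mul_le_iff₀ (by positivity), mul_one]; exact b2
    have e3 : 1 / ρ ^ (p / 2) * varCtrl (p / 2) A3 0 T ≤ 1 := by
      rw [one_div, inv_mul_le_iff₀ (by positivity), mul_one]; exact b3
    linarith
  · intro s t h1 h2 h3
    obtain ⟨n1, n2, n3, n4, n5⟩ := nn s t h1 h2 h3
    linarith
  · intro s t h1 h2 h3
    obtain ⟨n1, n2, n3, n4, n5⟩ := nn s t h1 h2 h3
    linarith
  · intro s t h1 h2 h3
    obtain ⟨n1, n2, n3, n4, n5⟩ := nn s t h1 h2 h3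
    linarith
  · have := boundedBy_of_control (A := A1) (j := 1) hp0 one_pos hρ (by simpa using f1) hW
      (fun s _ _ => by simp [hA1, incr]) (by
        intro s t h1 h2 h3
        obtain ⟨n1, n2, n3, n4, n5⟩ := nn s t h1 h2 h3
        rw [Nat.cast_one, div_one]
        linarith)
    intro s t h1 h2 h3
    beta_reduce
    rw [← eA1]
    exact this s t h1 h2 h3
  · refine boundedBy_of_control (A := A2) (j := 2) hp0 two_pos hρ (by exact_mod_cast f2) hW
      (fun s h1 h2 => by simp only [hA2, η.area_self h1 h2, ζ.area_self h1 h2, sub_self]) ?_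
    intro s t h1 h2 h3
    obtain ⟨n1, n2, n3, n4, n5⟩ := nn s t h1 h2 h3
    rw [Nat.cast_ofNat]
    linarith
  · have := boundedBy_of_control (A := A3) (j := 2) hp0 two_pos hρ (by exact_mod_cast f3) hW
      (fun s _ _ => by simp [hA3, incr]) (by
        intro s t h1 h2 h3
        obtain ⟨n1, n2, n3, n4, n5⟩ := nn s t h1 h2 h3
        rw [Nat.cast_ofNat]
        linarith)
    intro s t h1 h2 h3
    beta_reduce
    rw [← eA3]
    exact this s t h1 h2 h3
  · intro t h1 h2
    have e : ‖γ t - θ t‖ₑ ≤ ENNReal.ofReal ρ :=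
      (le_iSup₂_of_le (f := fun t (_ : t ∈ Set.Icc 0 T) => ‖γ t - θ t‖ₑ) t ⟨h1, h2⟩ le_rfl).trans d2
    rw [← ofReal_norm] at e
    exact (ENNReal.ofReal_le_ofReal_iff hρ.le).1 e
  · rw [← ofReal_norm] at d1
    exact (ENNReal.ofReal_le_ofReal_iff hρ.le).1 d1

lemma isRegularOn_rpow (hp : 0 < p) {W : ℝ → ℝ → ℝ} (hW : IsControlOn 0 T W)
    (h : IsRegularOn 0 T W) : IsRegularOn 0 T (fun s t => (W s t ^ (1 / p)) ^ p) :=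
  h.mono fun s t h1 h2 h3 => ((isRoughControl_rpow hp hW).1 s t h1 h2 h3).le

end

/-! ### The main estimates -/

section

variable {m k d n : ℕ} {p T L M : ℝ}

-- Assembly of the estimates under a bound `ρ` on the distance. Positivity of `ρ` is required
-- because the control divides by powers of it. The estimate for the integrals holds for any
-- functions representing them, so existence can be proved separately.
set_option maxHeartbeats 1000000 in
lemma exists_stability (hp : 2 ≤ p) (hp' : p < 3) (hT : 0 < T)
    (hL : 0 < L) (hM : 0 < M) {b : Euc m × Euc k → Euc m} (hb : IsLipB b)
    {σ : Euc m × Euc k → Euc d →L[ℝ] Euc m} (hσ : IsCb 3 σ)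
    {ψ : Euc m × Euc k → Euc d →L[ℝ] Euc n} (hψ : IsCb 3 ψ) :
    ∃ C : ℝ, 0 ≤ C ∧ ∀ (γ θ : ℝ → Euc k) (η ζ : RoughPath p T d) (x y : Euc m) (X Y : ℝ → Euc m)
      (X' Y' : ℝ → Euc d →L[ℝ] Euc m), IsSolutionPair L M b σ γ θ η ζ x y X Y X' Y' →
        (∃ I J : ℝ → Euc n,
          (∀ t ∈ Set.Icc 0 T, HasRoughIntegral η (comp ψ X γ) (compDeriv ψ X X' γ) 0 t (I t)) ∧
          (∀ t ∈ Set.Icc 0 T, HasRoughIntegral ζ (comp ψ Y θ) (compDeriv ψ Y Y' θ) 0 t (J t))) ∧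
        ∀ ρ > 0, dataDist x y γ θ η ζ ≤ ENNReal.ofReal ρ →
          pVar p (incr fun t => X' t - Y' t) 0 T +
            pVar (p / 2) (fun s t => remainder η X X' s t - remainder ζ Y Y' s t) 0 T ≤
              ENNReal.ofReal (C * ρ) ∧
          ∀ I J : ℝ → Euc n,
            (∀ t ∈ Set.Icc 0 T, HasRoughIntegral η (comp ψ X γ) (compDeriv ψ X X' γ) 0 t (I t)) →
            (∀ t ∈ Set.Icc 0 T, HasRoughIntegral ζ (comp ψ Y θ) (compDeriv ψ Y Y' θ) 0 t (J t)) →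
            pVar p (incr fun t => I t - J t) 0 T ≤ ENNReal.ofReal (C * ρ) := by
  have hp0 : 0 < p := by linarith
  have hS := (sewConst_spec hp0 hp').1
  obtain ⟨⟨Kl, hKl⟩, Kb, hKb⟩ := hb
  have hbc : Continuous b := hKl.continuous
  have hbl : ∀ z w, ‖b z - b w‖ ≤ Kl * ‖z - w‖ := fun z w => hKl.norm_sub_le z w
  have hKb0 : 0 ≤ Kb := (norm_nonneg _).trans (hKb 0)
  obtain ⟨Λs, hΛs⟩ := exists_coeffBound hσ hσ
  obtain ⟨Λp, hΛp⟩ := exists_coeffBound hσ hψ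
  have hΛs0 := hΛs.coeff.nonneg
  have hΛp0 := hΛp.coeff.nonneg
  obtain ⟨W₀, hW₀⟩ : ∃ c : ℝ, c = T + 2 * M ^ (p / 2) + 3 := ⟨_, rfl⟩
  have hMp : 0 ≤ M ^ (p / 2) := by positivity
  have hW₀0 : 0 ≤ W₀ := by rw [hW₀]; positivity
  have hTp : 0 ≤ T ^ (1 - 2 / p) := by positivity
  have hWp : 0 ≤ W₀ ^ (1 / p) := by positivity
  have hKl0 : (0 : ℝ) ≤ Kl := Kl.2
  obtain ⟨Λ, hΛ⟩ : ∃ c : ℝ, c = 1 + Kl + Kb + Λs + Λp + L + T ^ (1 - 2 / p) + W₀ ^ (1 / p) := ⟨_, rfl⟩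
  have hΛ1 : 1 ≤ Λ := by linarith
  obtain ⟨CR, hCR0, hCR⟩ := exists_remainder_bound (f := b) hp hp' hT.le hbc
    (fun z => (hKb z).trans (by linarith : Kb ≤ Λ)) hΛ1
    (hΛs.mono (by linarith : Λs ≤ Λ))
  -- The a priori bound `CR` depends on `Λ`, so it is absorbed into a second, larger constant; the
  -- comparison of solutions then uses `Λ'` for both data and remainders.
  obtain ⟨Λ', hΛ'⟩ : ∃ c : ℝ, c = Λ + CR := ⟨_, rfl⟩
  have hΛ'1 : 1 ≤ Λ' := by linarith
  have hΛΛ' : Λ ≤ Λ' := by linarith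
  obtain ⟨C, hC1, hC⟩ := exists_solDiff_bound (f := b) hp0 hp' hT.le hbc
    (fun z w => (hbl z w).trans (mul_le_mul_of_nonneg_right (by linarith : (Kl : ℝ) ≤ Λ')
      (norm_nonneg _))) hΛ'1 (hΛs.mono (by linarith : Λs ≤ Λ'))
  have hG := germDiffConst_nonneg d (by linarith : 0 ≤ Λ')
  obtain ⟨D1, hD1⟩ : ∃ c : ℝ, c = 8 * Λ' ^ 3 * C := ⟨_, rfl⟩
  obtain ⟨D2, hD2⟩ : ∃ c : ℝ, c = 4 * Λ' ^ 2 + 3 * (d * d) * Λ' ^ 3 + sewConst p * germDiffConst d Λ' * Λ' ^ 2 := ⟨_, rfl⟩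
  have hΛ'0 : 0 ≤ Λ' := by linarith
  have hD10 : 0 ≤ D1 := by rw [hD1]; positivity
  have hD20 : 0 ≤ D2 := by rw [hD2]; positivity
  refine ⟨D1 * Λ' + C * Λ' ^ 2 + D2 * C * Λ', by positivity, ?_⟩
  intro γ θ η ζ x y X Y X' Y' h
  have hψ' : CoeffBound Λ' σ ψ := hΛp.mono (by linarith)
  -- bounds in terms of a common control
  have single : ∀ {ζ : RoughPath p T d} {γ : ℝ → Euc k} {x : Euc m} {X : ℝ → Euc m}
      {X' : ℝ → Euc d →L[ℝ] Euc m}, IsVarPath (p / 2) T γ →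
      pVar (p / 2) (incr γ) 0 T ≤ ENNReal.ofReal M → ζ.holder ≤ ENNReal.ofReal L →
      IsRDESolution b σ ζ γ x X X' → ∀ W : ℝ → ℝ → ℝ, IsControlOn 0 T W → IsRegularOn 0 T W →
      W 0 T ≤ W₀ → (∀ s t, 0 ≤ s → s ≤ t → t ≤ T → t - s ≤ W s t) →
      (∀ s t, 0 ≤ s → s ≤ t → t ≤ T → varCtrl (p / 2) (incr γ) s t ≤ W s t) →
      DataBound Λ' σ ζ γ X X' 0 T (fun s t => W s t ^ (1 / p)) ∧
      BoundedBy 0 T (fun s t => W s t ^ (1 / p)) 2 Λ' (remainder ζ X X') := by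
    intro ζ γ x X X' hγ hγM hζ hsol W hW hreg hW0 hlen hV
    have hd := dataBound_of_control hp hΛ1 hL.le (by linarith : L ≤ Λ)
      (by linarith : T ^ (1 - 2 / p) ≤ Λ) (by linarith : W₀ ^ (1 / p) ≤ Λ) hW hW0 hlen
      (exists_control_single hp hM.le hγ hγM).2.2.1 hV hζ hsol.deriv_eq
    refine ⟨hd.mono hΛΛ', ?_⟩
    exact (hCR ζ γ x X X' _ hγ.continuousOn hsol hd (isRegularOn_rpow hp0 hW hreg)).mono_const
      hd.rough (by linarith)
  refine ⟨?_, ?_⟩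
  · have ex : ∀ {ζ : RoughPath p T d} {γ : ℝ → Euc k} {x : Euc m} {X : ℝ → Euc m}
        {X' : ℝ → Euc d →L[ℝ] Euc m}, IsVarPath (p / 2) T γ →
        pVar (p / 2) (incr γ) 0 T ≤ ENNReal.ofReal M → ζ.holder ≤ ENNReal.ofReal L →
        IsRDESolution b σ ζ γ x X X' → ∃ I : ℝ → Euc n, ∀ t ∈ Set.Icc 0 T,
          HasRoughIntegral ζ (comp ψ X γ) (compDeriv ψ X X' γ) 0 t (I t) := by
      intro ζ γ x X X' hγ hγM hζ hsol
      -- Existence of an integral concerns one equation only; a control without the difference terms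
      -- suffices and no bound on the distance is used.
      obtain ⟨hW, hreg, hfin, hM'⟩ := exists_control_single hp hM.le hγ hγM
      obtain ⟨hd, hR⟩ := single hγ hγM hζ hsol _ hW hreg (by linarith)
        (fun s t h1 h2 h3 => le_add_of_nonneg_right ENNReal.toReal_nonneg)
        (fun s t h1 h2 h3 => le_add_of_nonneg_left (sub_nonneg.2 h2))
      exact exists_hasSewing hp0 hp' hT.le hd.rough (isRegularOn_rpow hp0 hW hreg)
        (by unfold germConst compConst; positivity) (almostAdditive_comp hψ' hd hΛ'0 hR)
    obtain ⟨I, hI⟩ := ex h.control_left h.control_left_le h.rough_left_le h.sol_left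
    obtain ⟨J, hJ⟩ := ex h.control_right h.control_right_le h.rough_right_le h.sol_right
    exact ⟨I, J, hI, hJ⟩
  intro ρ hρ hdist
  obtain ⟨W, hW, hreg, hW0, hlen, hV, hV', hDD, hxy⟩ := exists_control_pair hp hL hM.le
    h.control_left h.control_right h.control_left_le h.control_right_le h.rough_left_le
    h.rough_right_le hρ hdist
  rw [← hW₀] at hW0
  obtain ⟨hX, hRX⟩ := single h.control_left h.control_left_le h.rough_left_le h.sol_left W hW hreg
    hW0 hlen hV
  obtain ⟨hY, hRY⟩ := single h.control_right h.control_right_le h.rough_right_le h.sol_right W hW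
    hreg hW0 hlen hV'
  have hSol := hC η ζ γ θ x y X Y X' Y' _ ρ h.control_left.continuousOn
    h.control_right.continuousOn h.sol_left h.sol_right hX hY (isRegularOn_rpow hp0 hW hreg) hRX
    hRY hDD hxy
  have hDD' := hDD.mono hX.rough (le_mul_of_one_le_left hρ.le hC1)
  have hω0 := hX.rough.nonneg 0 T le_rfl hT.le le_rfl
  have hωΛ := hX.le 0 T le_rfl hT.le le_rfl
  refine ⟨?_, ?_⟩
  · have hderiv : BoundedBy 0 T (fun s t => W s t ^ (1 / p)) 1 (D1 * ρ)
        (incr fun t => X' t - Y' t) := by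
      intro s t h1 h2 h3
      have e := fourPoint_along hψ'.coeff hψ'.coeff hX hRX hDD' hSol h1 h2 h3
      have alg : incr (fun t => X' t - Y' t) s t =
          (σ (X t, γ t) - σ (X s, γ s)) - (σ (Y t, θ t) - σ (Y s, θ s)) := by
        simp only [incr, hX.deriv s h1 (h2.trans h3), hX.deriv t (h1.trans h2) h3,
          hY.deriv s h1 (h2.trans h3), hY.deriv t (h1.trans h2) h3]
        abel
      rw [alg, pow_one]
      refine e.trans (le_of_eq ?_)
      rw [hD1]; ring
    have e1 := pVar_le_of_boundedBy hp0 hT.le hX.rough one_pos (by positivity) hderiv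
    have e2 := pVar_le_of_boundedBy hp0 hT.le hX.rough two_pos (by positivity) hSol.rem
    rw [Nat.cast_one, div_one, pow_one] at e1
    rw [Nat.cast_ofNat] at e2
    refine (add_le_add e1 e2).trans ?_
    rw [← ENNReal.ofReal_add (by positivity) (by positivity)]
    refine ENNReal.ofReal_le_ofReal ?_
    calc _ ≤ D1 * ρ * Λ' + C * ρ * Λ' ^ 2 := by gcongr
      _ ≤ _ := by
        have : 0 ≤ D2 * C * Λ' * ρ := by positivity
        linarith
  · intro I J hI hJ
    have e0 := integral_sub_boundedBy hp' hψ' hX hY hRX hRY hDD' hSol hI hJ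
    rw [← hD2] at e0
    have e1 := pVar_le_of_boundedBy hp0 hT.le hX.rough one_pos (by positivity) e0
    rw [Nat.cast_one, div_one, pow_one] at e1
    refine e1.trans (ENNReal.ofReal_le_ofReal ?_)
    calc _ ≤ D2 * (C * ρ) * Λ' := by gcongr
      _ ≤ _ := by
        have : 0 ≤ (D1 * Λ' + C * Λ' ^ 2) * ρ := by positivity
        linarith

/-- Let `ρ` decrease to the distance `D`, which also covers `D = 0`. For `D = ∞` the right-hand side
must be infinite, and `C + 1 > 0` guarantees this even when `C = 0`. -/
lemma le_mul_of_forall_ofReal {C : ℝ} (hC : 0 ≤ C) {D V : ℝ≥0∞}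
    (h : ∀ ρ > 0, D ≤ ENNReal.ofReal ρ → V ≤ ENNReal.ofReal (C * ρ)) :
    V ≤ ((C + 1).toNNReal : ℝ≥0∞) * D := by
  rcases eq_or_ne D ⊤ with rfl | hD
  · rw [ENNReal.mul_top]
    · exact le_top
    · have : (0 : ℝ) < C + 1 := by linarith
      simpa using this
  · have hlim : Filter.Tendsto (fun e : ℝ => ENNReal.ofReal (C * (D.toReal + e)))
        (nhdsWithin 0 (Set.Ioi 0)) (nhds (ENNReal.ofReal (C * (D.toReal + 0)))) := by
      refine Filter.Tendsto.mono_left ?_ nhdsWithin_le_nhds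
      have : Continuous fun e : ℝ => ENNReal.ofReal (C * (D.toReal + e)) :=
        ENNReal.continuous_ofReal.comp (by fun_prop)
      exact this.tendsto 0
    have hV : V ≤ ENNReal.ofReal (C * (D.toReal + 0)) := by
      refine ge_of_tendsto hlim ?_
      filter_upwards [self_mem_nhdsWithin] with e he
      have he' : 0 < e := he
      refine h _ (by positivity) ?_
      rw [← ENNReal.ofReal_toReal hD]
      refine ENNReal.ofReal_le_ofReal ?_
      rw [ENNReal.ofReal_toReal hD]
      linarith
    refine hV.trans ?_
    rw [add_zero, ENNReal.ofReal_mul hC, ENNReal.ofReal_toReal hD]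
    gcongr
    exact ENNReal.ofReal_le_ofReal (by linarith)

end

end ControlledRDE

theorem mainTheorem5 (m k d : ℕ) (p T L M : ℝ) (hp : 2 ≤ p) (hp' : p < 3) (hT : 0 < T)
    (hL : 0 < L) (hM : 0 < M) (b : Euc m × Euc k → Euc m) (hb : IsLipB b)
    (σ : Euc m × Euc k → Euc d →L[ℝ] Euc m) (hσ : IsCb 3 σ) :
    (∃ C : ℝ≥0, ∀ (γ θ : ℝ → Euc k) (η ζ : RoughPath p T d) (x y : Euc m) (X Y : ℝ → Euc m)
      (X' Y' : ℝ → Euc d →L[ℝ] Euc m), IsSolutionPair L M b σ γ θ η ζ x y X Y X' Y' →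
        pVar p (incr fun t => X' t - Y' t) 0 T +
            pVar (p / 2) (fun s t => remainder η X X' s t - remainder ζ Y Y' s t) 0 T
          ≤ C * dataDist x y γ θ η ζ) ∧
    ∀ (n : ℕ) (ψ : Euc m × Euc k → Euc d →L[ℝ] Euc n), IsCb 3 ψ →
      ∃ C : ℝ≥0, ∀ (γ θ : ℝ → Euc k) (η ζ : RoughPath p T d) (x y : Euc m) (X Y : ℝ → Euc m)
        (X' Y' : ℝ → Euc d →L[ℝ] Euc m), IsSolutionPair L M b σ γ θ η ζ x y X Y X' Y' →
          ∃ I J : ℝ → Euc n,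
            (∀ t ∈ Set.Icc 0 T,
              HasRoughIntegral η (comp ψ X γ) (compDeriv ψ X X' γ) 0 t (I t)) ∧
            (∀ t ∈ Set.Icc 0 T,
              HasRoughIntegral ζ (comp ψ Y θ) (compDeriv ψ Y Y' θ) 0 t (J t)) ∧
            pVar p (incr fun t => I t - J t) 0 T ≤ C * dataDist x y γ θ η ζ := by
  refine ⟨?_, fun n ψ hψ => ?_⟩
  · obtain ⟨C, hC, H⟩ := exists_stability hp hp' hT hL hM hb hσ hσ
    refine ⟨(C + 1).toNNReal, fun γ θ η ζ x y X Y X' Y' h => le_mul_of_forall_ofReal hC ?_⟩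
    exact fun ρ hρ hd => ((H γ θ η ζ x y X Y X' Y' h).2 ρ hρ hd).1
  · obtain ⟨C, hC, H⟩ := exists_stability hp hp' hT hL hM hb hσ hψ
    refine ⟨(C + 1).toNNReal, fun γ θ η ζ x y X Y X' Y' h => ?_⟩
    obtain ⟨⟨I, J, hI, hJ⟩, H'⟩ := H γ θ η ζ x y X Y X' Y' h
    exact ⟨I, J, hI, hJ, le_mul_of_forall_ofReal hC fun ρ hρ hd => (H' ρ hρ hd).2 I J hI hJ⟩
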